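/- Fix $\varepsilon>0$, $\alpha>0$, put $w(R)=R^{1-\varepsilon}(1+R)^{1+2\varepsilon}$ for $R>0$, and let $X$ be the Hilbert space of measurable $x:(0,\infty)\to\mathbb C$ with $\int_0^\infty w(R)e^{2\alpha R}|x(R)|^2\,dR<\infty$. Let $V$ be a rotationally invariant nonlocal potential on $\mathbb R^3\times\mathbb R^3$, $V(\mathbf R,\mathbf R')=V(R,R';\cos\eta)$ with $R=|\mathbf R|$, $R'=|\mathbf R'|$ and $\eta$ the angle between $\mathbf R$ and $\mathbf R'$, which is real, measurable, symmetric, and satisfies $$\int_{\mathbb R^3}w(R)e^{2\alpha R}\,d\mathbf R\int_{\mathbb R^3}w(R')e^{2\alpha R'}V(\mathbf R,\mathbf R')^2\,d\mathbf R'<\infty .$$ For an integer $\ell\ge 0$ put $V_\ell(R,R')=2\pi RR'\int_{-1}^1V(R,R';t)P_\ell(t)\,dt$, where $P_\ell$ is the Legendre polynomial. Let $j_\ell$, $h^{(1)}_\ell$ be the spherical Bessel and Hankel functions and let $G_\ell(k;R,R')=-ikRR'j_\ell(k\min(R,R'))\,h^{(1)}_\ell(k\max(R,R'))$, which is an entire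 function of $k$ (its value at $k=0$ being the limit). Put $$v_{\ell,0}(k;R)=\int_0^\infty V_\ell(R,R')\,kR'j_\ell(kR')\,dR',\qquad L_\ell(k;R,R')=\int_0^\infty V_\ell(R,R'')\,G_\ell(k;R'',R')\,dR'',$$ and let $L_\ell(k)$ be the integral operator with kernel $L_\ell(k;R,R')$. For $g\in\mathbb C$ let $$\sigma_\ell(k;g)=1+\sum_{n\ge1}\frac{(-1)^n}{n!}Q_n(k)\,g^n$$ be the Fredholm--Smithies denominator. Here $Q_n(k)$ is the $n\times n$ determinant with zero diagonal, superdiagonal $n-1,n-2,\dots,1$, entry $\operatorname{Tr}[L_\ell(k)^{i-j+1}]$ at each position $(i,j)$ with $i>j$, and $0$ elsewhere. Where the equation $[1-gL_\ell(k)]v_\ell(k,g;\cdot)=v_{\ell,0}(k;\cdot)$ has a unique solution in $X$, the partial scattering amplitude is $$T_\ell(k;g)=-g\int_0^\infty R\,j_\ell(kR)\,v_\ell(k,g;R)\,dR ,$$ and $S_\ell(k;g)=1+2i\,T_\ell(k;g)$. Let $\Omega_\alpha=\{k\in\mathbb C:|\operatorname{Im}k|<\alpha\}$. Then for every integer $\ell\ge0$: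 (i) For every real $g$, for all $k\in\Omega_\alpha$ with $|k|$ large enough one has $\sigma_\ell(k;g)\ne0$ and the equation has a unique solution in $X$ (so that $T_\ell(k;g)$ is defined), and $T_\ell(k;g)=O(1/k)$ as $k\to\infty$ in $\Omega_\alpha$. (ii) If $g\in\mathbb C$ (in particular, if $g$ is real) and $\sigma_\ell(0;g)\neq0$, then for all $k$ in a complex neighbourhood of $0$ one has $\sigma_\ell(k;g)\ne0$, the equation has a unique solution in $X$, and $T_\ell(k;g)=k^{2\ell+1}\,\widehat T_\ell^{(\mathrm{loc})}(k;g)$, where $\widehat T_\ell^{(\mathrm{loc})}(\cdot\,;g)$ is bounded on this neighbourhood. (iii) For every real $g$, the phase shift $\delta_\ell(k;g)$, defined modulo $\pi$ by $S_\ell(k;g)=e^{2i\delta_\ell(k;g)}$ (and allowed to be complex for complex $k$), exists for all $k\in\Omega_\alpha$ with $|k|$ large enough, and for every choice of it $\delta_\ell(k;g)\to0$ in $\mathbb C/\pi\mathbb Z$ as $k\to\infty$ in $\Omega_\alpha$. -/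

import Mathlib

open Set Filter Topology MeasureTheory Asymptotics

noncomputable section

namespace NonlocalScattering

/-- The weight function `w(R) = R^(1-ε) (1+R)^(1+2ε)`. -/
def weight (ε R : ℝ) : ℝ := R ^ (1 - ε) * (1 + R) ^ (1 + 2 * ε)

/-- The measure `w(R) e^(2αR) dR` on `(0, ∞)`; its complex `L²` space is the Hilbert space
`X_{w,α}`. -/
def weightedMeasure (ε α : ℝ) : Measure ℝ :=
  (volume.restrict (Ioi 0)).withDensity
    fun R => ENNReal.ofReal (weight ε R * Real.exp (2 * α * R))

/-- Three-dimensional Euclidean space. -/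
abbrev E3 : Type := EuclideanSpace ℝ (Fin 3)

/-- The rotationally invariant kernel on `ℝ³ × ℝ³` with profile `V(R, R'; cos η)`, where
`cos η = x·y / (|x| |y|)`. -/
def kernel3 (V : ℝ → ℝ → ℝ → ℝ) (x y : E3) : ℝ :=
  V ‖x‖ ‖y‖ (inner ℝ x y / (‖x‖ * ‖y‖))

/-- The class `N_{w,α}` of rotationally invariant nonlocal potentials: real, symmetric, and with
`∫ w(|x|) e^(2α|x|) dx ∫ w(|y|) e^(2α|y|) V(x,y)² dy < ∞`. -/
structure IsNonlocalPotential (ε α : ℝ) (V : ℝ → ℝ → ℝ → ℝ) : Prop where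
  measurable : Measurable fun p : ℝ × ℝ × ℝ => V p.1 p.2.1 p.2.2
  symm : ∀ R R' t, 0 < R → 0 < R' → t ∈ Icc (-1 : ℝ) 1 → V R R' t = V R' R t
  finite : ∫⁻ x : E3, ∫⁻ y : E3, ENNReal.ofReal
      (weight ε ‖x‖ * Real.exp (2 * α * ‖x‖) *
        (weight ε ‖y‖ * Real.exp (2 * α * ‖y‖)) * kernel3 V x y ^ 2) < ⊤

/-- The Legendre polynomial `P_ℓ`, by Rodrigues' formula. -/
def legendreP (l : ℕ) : Polynomial ℝ :=
  Polynomial.C ((2 ^ l * (l.factorial : ℝ))⁻¹) *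
    Polynomial.derivative^[l] ((Polynomial.X ^ 2 - 1) ^ l)

/-- The partial potential `V_ℓ(R,R') = 2π R R' ∫_{-1}^{1} V(R,R';t) P_ℓ(t) dt`. -/
def partialPotential (V : ℝ → ℝ → ℝ → ℝ) (l : ℕ) (R R' : ℝ) : ℝ :=
  2 * Real.pi * R * R' * ∫ t in (-1 : ℝ)..1, V R R' t * (legendreP l).eval t

/-- The spherical Bessel function `j_ℓ` (an entire function), by Poisson's integral
`j_ℓ(z) = z^ℓ / (2^(ℓ+1) ℓ!) ∫_{-1}^{1} e^(izt) (1-t²)^ℓ dt`. -/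
def sphericalBessel (l : ℕ) (z : ℂ) : ℂ :=
  z ^ l / (2 ^ (l + 1) * (l.factorial : ℂ)) *
    ∫ t in (-1 : ℝ)..1, Complex.exp (Complex.I * z * (t : ℂ)) * (1 - (t : ℂ) ^ 2) ^ l

/-- The spherical Hankel function of the first kind, `z ≠ 0`:
`h_ℓ(z) = (-i)^(ℓ+1) (e^(iz)/z) ∑_{m ≤ ℓ} (i^m / (m! (2z)^m)) (ℓ+m)! / (ℓ-m)!`. -/
def sphericalHankel (l : ℕ) (z : ℂ) : ℂ :=
  (-Complex.I) ^ (l + 1) * (Complex.exp (Complex.I * z) / z) *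
    ∑ m ∈ Finset.range (l + 1),
      Complex.I ^ m / ((m.factorial : ℂ) * (2 * z) ^ m) *
        (((l + m).factorial : ℂ) / ((l - m).factorial : ℂ))

/-- The Green function `G_ℓ(k;R,R') = -i k R R' j_ℓ(k min(R,R')) h_ℓ(k max(R,R'))`, for
`R, R' > 0`.  It is entire in `k`; the value at `k = 0` is the limit
`-min(R,R')^(ℓ+1) / ((2ℓ+1) max(R,R')^ℓ)`. -/
def green (l : ℕ) (k : ℂ) (R R' : ℝ) : ℂ :=
  if k = 0 then
    -((min R R' : ℝ) : ℂ) ^ (l + 1) / ((2 * (l : ℂ) + 1) * ((max R R' : ℝ) : ℂ) ^ l)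
  else
    -Complex.I * k * (R : ℂ) * (R' : ℂ) * sphericalBessel l (k * ((min R R' : ℝ) : ℂ)) *
      sphericalHankel l (k * ((max R R' : ℝ) : ℂ))

/-- `v_{ℓ,0}(k;R) = ∫_0^∞ V_ℓ(R,R') k R' j_ℓ(kR') dR'`. -/
def sourceTerm (V : ℝ → ℝ → ℝ → ℝ) (l : ℕ) (k : ℂ) (R : ℝ) : ℂ :=
  ∫ R' in Ioi (0 : ℝ),
    (partialPotential V l R R' : ℂ) * (k * (R' : ℂ) * sphericalBessel l (k * (R' : ℂ)))

/-- `L_ℓ(k;R,R') = ∫_0^∞ V_ℓ(R,R'') G_ℓ(k;R'',R') dR''`. -/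
def kernelL (V : ℝ → ℝ → ℝ → ℝ) (l : ℕ) (k : ℂ) (R R' : ℝ) : ℂ :=
  ∫ R'' in Ioi (0 : ℝ), (partialPotential V l R R'' : ℂ) * green l k R'' R'

/-- The kernel on `(0, ∞)` of the `(n+1)`-st power of the integral operator with kernel `K`. -/
def iteratedKernel (K : ℝ → ℝ → ℂ) : ℕ → ℝ → ℝ → ℂ
  | 0 => K
  | n + 1 => fun R R' => ∫ R'' in Ioi (0 : ℝ), iteratedKernel K n R R'' * K R'' R'

/-- `ρ_n = Tr (K^n)` of the integral operator with kernel `K` (used for `n ≥ 2`), i.e. the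
integral over the diagonal of the kernel of `K^n`. -/
def traceOfPower (K : ℝ → ℝ → ℂ) (n : ℕ) : ℂ :=
  ∫ R in Ioi (0 : ℝ), iteratedKernel K (n - 1) R R

/-- The `n × n` determinant `Q_n` in the traces `ρ_2, …, ρ_n`: zero diagonal, superdiagonal
`n-1, n-2, …, 1`, entries `ρ_{i-j+1}` below the diagonal, and zero elsewhere. -/
def smithiesDet (K : ℝ → ℝ → ℂ) (n : ℕ) : ℂ :=
  Matrix.det (Matrix.of fun i j : Fin n =>
    if (j : ℕ) = (i : ℕ) + 1 then ((n - 1 - (i : ℕ) : ℕ) : ℂ)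
    else if (j : ℕ) < (i : ℕ) then traceOfPower K ((i : ℕ) - (j : ℕ) + 1)
    else 0)

/-- The Fredholm–Smithies denominator `σ_ℓ(k;g) = ∑_n ((-1)^n / n!) Q_n(k) g^n`
(the term `n = 0` is `1`). -/
def sigma (V : ℝ → ℝ → ℝ → ℝ) (l : ℕ) (k g : ℂ) : ℂ :=
  ∑' n : ℕ, (-1) ^ n / (n.factorial : ℂ) * smithiesDet (kernelL V l k) n * g ^ n

/-- `v` is a solution in `X_{w,α}` of the Lippmann–Schwinger equation
`[1 - g L_ℓ(k)] v = v_{ℓ,0}(k;·)`. -/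
def IsSolution (ε α : ℝ) (V : ℝ → ℝ → ℝ → ℝ) (l : ℕ) (k g : ℂ) (v : ℝ → ℂ) : Prop :=
  MemLp v 2 (weightedMeasure ε α) ∧
    ∀ᵐ R ∂(volume.restrict (Ioi (0 : ℝ))),
      v R - g * ∫ R' in Ioi (0 : ℝ), kernelL V l k R R' * v R' = sourceTerm V l k R

/-- The Lippmann–Schwinger equation has one and only one solution in `X_{w,α}`. -/
def IsWellPosed (ε α : ℝ) (V : ℝ → ℝ → ℝ → ℝ) (l : ℕ) (k g : ℂ) : Prop :=
  ∃ v, IsSolution ε α V l k g v ∧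
    ∀ v', IsSolution ε α V l k g v' → v' =ᵐ[volume.restrict (Ioi (0 : ℝ))] v

/-- The solution `v_ℓ(k,g;·)` (an arbitrary function where there is no solution). -/
def solution (ε α : ℝ) (V : ℝ → ℝ → ℝ → ℝ) (l : ℕ) (k g : ℂ) : ℝ → ℂ :=
  Classical.epsilon (IsSolution ε α V l k g)

/-- The partial scattering amplitude `T_ℓ(k;g) = -g ∫_0^∞ R j_ℓ(kR) v_ℓ(k,g;R) dR`. -/
def amplitude (ε α : ℝ) (V : ℝ → ℝ → ℝ → ℝ) (l : ℕ) (k g : ℂ) : ℂ :=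
  -g * ∫ R in Ioi (0 : ℝ),
    (R : ℂ) * sphericalBessel l (k * (R : ℂ)) * solution ε α V l k g R

/-- `S_ℓ(k;g) = 1 + 2 i T_ℓ(k;g)`. -/
def scatteringFn (ε α : ℝ) (V : ℝ → ℝ → ℝ → ℝ) (l : ℕ) (k g : ℂ) : ℂ :=
  1 + 2 * Complex.I * amplitude ε α V l k g

/-- The open strip `Ω_α = {|Im k| < α}`. -/
def strip (α : ℝ) : Set ℂ := {k | |k.im| < α}

/-- `k → ∞` in the strip `Ω_α`. -/
def atInftyInStrip (α : ℝ) : Filter ℂ := Bornology.cobounded ℂ ⊓ 𝓟 (strip α)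

/-- `d` is a phase shift at `k`: `S_ℓ(k;g) = e^(2id)`. -/
def IsPhaseShift (ε α : ℝ) (V : ℝ → ℝ → ℝ → ℝ) (l : ℕ) (k g d : ℂ) : Prop :=
  scatteringFn ε α V l k g = Complex.exp (2 * Complex.I * d)

end NonlocalScattering

end

/-! Dividing kernels by the density w(R)e^{2αR} turns integrals against dR into integrals against
the measure of X. There L_ℓ(k) becomes the composition of V_ℓ with the Green operator. V_ℓ is
Hilbert–Schmidt by the hypothesis on V, through spherical coordinates and Cauchy–Schwarz in the
angle (`IsNonlocalPotential.isL2Kernel`). On the strip |G_ℓ| is at most C/(1+|k|) times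
√(1+R)e^{αR}√(1+R')e^{αR'} (`exists_norm_green_le_growth`), and ∫(1+R)/w dR is finite. Hence L_ℓ(k)
is Hilbert–Schmidt with norm O(1/(1+|k|)), and it depends continuously on k by dominated
convergence.

The denominator is controlled through finite matrices. For a matrix A the Smithies series sums to
det(1-gA)exp(g tr A) (`hasSum_smithiesCoeff_trace`), and Carleman's inequality bounds its
coefficients by the Hilbert–Schmidt norm alone, whatever the size of A. Truncating in an orthonormal
basis and passing to the limit, σ vanishes whenever 1/g is an eigenvalue; by the Fredholm
alternative, σ ≠ 0 makes 1-gL invertible (`HasTraces.isUnit_one_sub`). The same coefficient bounds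
give σ ≠ 0 when gL is small (`fredholmDenominator_ne_zero`) and continuity of σ in k
(`continuous_sigma`).

The Riccati–Bessel function u = kRj_ℓ(kR) enters kT_ℓ twice: kT_ℓ is -g times the bilinear pairing
of u with (1-gL)⁻¹V_ℓu. So |k||T_ℓ| ≤ D·N·c², with N a bound for the inverse and c one for u
(`exists_mul_norm_amplitude_le`). At infinity N = 2 and c is constant, whence T_ℓ = O(1/k), S_ℓ → 1,
and continuity of the logarithm at 1 handles the phase shifts. Near 0, N is bounded by perturbing
the inverse at k = 0 and c is of order |k|^{ℓ+1}, so |k||T_ℓ| = O(|k|^{2ℓ+2}). -/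

noncomputable section

namespace NonlocalScattering

/-! ### Smithies' determinants -/

/-- Smithies' determinant matrix built from a sequence of traces. -/
def smithiesMatrix (ρ : ℕ → ℂ) (n : ℕ) : Matrix (Fin n) (Fin n) ℂ :=
  Matrix.of fun i j : Fin n =>
    if (j : ℕ) = (i : ℕ) + 1 then ((n - 1 - (i : ℕ) : ℕ) : ℂ)
    else if (j : ℕ) < (i : ℕ) then ρ ((i : ℕ) - (j : ℕ) + 1)
    else 0

/-- The coefficients of the Fredholm–Smithies denominator. -/
def smithiesCoeff (ρ : ℕ → ℂ) (n : ℕ) : ℂ :=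
  (-1) ^ n / (n.factorial : ℂ) * (smithiesMatrix ρ n).det

/-- A Hessenberg determinant: rows `< i` are shifted to the diagonal. -/
lemma det_smithiesMatrix_submatrix (ρ : ℕ → ℂ) (n : ℕ) (i : Fin (n + 1)) :
    ((smithiesMatrix ρ (n + 1)).submatrix i.succAbove Fin.succ).det =
      (n.descFactorial i : ℂ) * (smithiesMatrix ρ (n - i)).det := by
  obtain ⟨i, hi⟩ := i
  obtain ⟨m, rfl⟩ : ∃ m, n = i + m := ⟨n - i, by omega⟩
  let e : Fin i ⊕ Fin m ≃ Fin (i + m) := finSumFinEquiv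
  rw [← Matrix.det_submatrix_equiv_self e]
  have hs : ∀ a : Fin (i + m), ((Fin.succAbove ⟨i, hi⟩ a : Fin (i + m + 1)) : ℕ) =
      if (a : ℕ) < i then (a : ℕ) else a + 1 := by
    intro a
    simp only [Fin.succAbove, Fin.lt_def, Fin.val_castSucc]
    split_ifs <;> rfl
  have hl : ∀ a : Fin i, (e (Sum.inl a) : ℕ) = a := fun a => by simp [e]
  have hr : ∀ a : Fin m, (e (Sum.inr a) : ℕ) = i + a := fun a => by simp [e]
  -- Without row i and column 0 the matrix is block lower triangular. The first i rows have their
  -- superdiagonal moved onto the diagonal, giving n(n-1)⋯(n-i+1); the last block is the Smithies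
  -- matrix of size n-i.
  have key : (((smithiesMatrix ρ (i + m + 1)).submatrix (Fin.succAbove ⟨i, hi⟩) Fin.succ).submatrix
      e e) = Matrix.fromBlocks
        (Matrix.of fun a b : Fin i => smithiesMatrix ρ (i + m + 1)
          (Fin.succAbove ⟨i, hi⟩ (e (Sum.inl a))) (Fin.succ (e (Sum.inl b))))
        0
        (Matrix.of fun (a : Fin m) (b : Fin i) => smithiesMatrix ρ (i + m + 1)
          (Fin.succAbove ⟨i, hi⟩ (e (Sum.inr a))) (Fin.succ (e (Sum.inl b))))
        (smithiesMatrix ρ m) := by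
    ext a b
    rcases a with a | a <;> rcases b with b | b
    · simp
    · have h1 := a.2
      simp only [smithiesMatrix, Matrix.submatrix_apply, Matrix.of_apply, hs, hl, hr,
        Fin.val_succ, Matrix.fromBlocks_apply₁₂, Matrix.zero_apply]
      rw [if_neg, if_neg] <;> split_ifs <;> omega
    · simp
    · simp only [smithiesMatrix, Matrix.submatrix_apply, Matrix.of_apply, hs, hr,
        Fin.val_succ, Matrix.fromBlocks_apply₂₂]
      rw [if_neg (by omega : ¬ (i + (a : ℕ) < i))]
      have e1 : (i + (b : ℕ) + 1 = i + a + 1 + 1) = ((b : ℕ) = a + 1) := by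
        apply propext; omega
      have e2 : (i + (b : ℕ) + 1 < i + a + 1) = ((b : ℕ) < a) := by
        apply propext; omega
      have e3 : i + m + 1 - 1 - (i + (a : ℕ) + 1) = m - 1 - a := by omega
      have e4 : i + (a : ℕ) + 1 - (i + b + 1) + 1 = a - b + 1 := by omega
      simp only [e1, e2, e3, e4]
  rw [key, Matrix.det_fromBlocks_zero₁₂, show i + m - i = m by omega]
  congr 1
  rw [Matrix.det_of_isLowerTriangular]
  · rw [Nat.descFactorial_eq_prod_range, Nat.cast_prod,
      ← Fin.prod_univ_eq_prod_range (fun j => (((i + m - j : ℕ)) : ℂ))]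
    refine Finset.prod_congr rfl fun a _ => ?_
    have h1 := a.2
    simp only [smithiesMatrix, Matrix.of_apply, hs, hl, Fin.val_succ]
    rw [if_pos h1, if_pos rfl, Nat.add_sub_cancel]
  · intro a b hab
    have h1 := a.2
    have h2 := b.2
    have h3 : (a : ℕ) < b := hab
    simp only [smithiesMatrix, Matrix.of_apply, hs, hl, Fin.val_succ]
    rw [if_pos h1, if_neg (by omega), if_neg (by omega)]

/-- Laplace expansion along the first column, whose top entry vanishes and whose entry in row i+1 is
ρ_{i+2}. -/
lemma det_smithiesMatrix_succ (ρ : ℕ → ℂ) (n : ℕ) :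
    (smithiesMatrix ρ (n + 1)).det = ∑ i ∈ Finset.range n, (-1) ^ (i + 1) * ρ (i + 2) *
      ((n.descFactorial (i + 1) : ℂ) * (smithiesMatrix ρ (n - (i + 1))).det) := by
  rw [Matrix.det_succ_column_zero, Fin.sum_univ_succ, ← Fin.sum_univ_eq_sum_range (fun i =>
    (-1) ^ (i + 1) * ρ (i + 2) *
      ((n.descFactorial (i + 1) : ℂ) * (smithiesMatrix ρ (n - (i + 1))).det))]
  have h0 : smithiesMatrix ρ (n + 1) 0 0 = 0 := by simp [smithiesMatrix]
  rw [h0]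
  simp only [mul_zero, zero_mul, zero_add]
  refine Finset.sum_congr rfl fun i _ => ?_
  rw [det_smithiesMatrix_submatrix]
  simp [smithiesMatrix]

@[simp] lemma smithiesCoeff_zero (ρ : ℕ → ℂ) : smithiesCoeff ρ 0 = 1 := by
  simp [smithiesCoeff]

/-- The recurrence for the coefficients, i.e. `σ' = -σ ∑ ρ_m g^(m-1)`. -/
lemma smithiesCoeff_succ (ρ : ℕ → ℂ) (n : ℕ) :
    ((n + 1 : ℕ) : ℂ) * smithiesCoeff ρ (n + 1) =
      -∑ i ∈ Finset.range n, ρ (i + 2) * smithiesCoeff ρ (n - (i + 1)) := by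
  rw [smithiesCoeff, det_smithiesMatrix_succ, Finset.mul_sum, Finset.mul_sum,
    ← Finset.sum_neg_distrib]
  refine Finset.sum_congr rfl fun i hi => ?_
  have hi' : i + 1 ≤ n := by simpa using hi
  rw [smithiesCoeff]
  obtain ⟨m, rfl⟩ : ∃ m, n = i + 1 + m := ⟨n - (i + 1), by omega⟩
  have h2 : i + 1 + m - (i + 1) = m := by omega
  rw [h2]
  have h3 : (((i + 1 + m).descFactorial (i + 1) : ℕ) : ℂ) * (m.factorial : ℂ) =
      ((i + 1 + m).factorial : ℂ) := by
    rw [← Nat.factorial_mul_descFactorial hi', h2]; push_cast; ring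
  have h4 : ((i + 1 + m + 1).factorial : ℂ) =
      ((i + 1 + m + 1 : ℕ) : ℂ) * ((i + 1 + m).factorial : ℂ) := by
    rw [Nat.factorial_succ]; push_cast; ring
  have h5 : ((i + 1 + m).factorial : ℂ) ≠ 0 := by exact_mod_cast Nat.factorial_ne_zero _
  have h6 : (m.factorial : ℂ) ≠ 0 := by exact_mod_cast Nat.factorial_ne_zero _
  have h7 : ((i + 1 + m + 1 : ℕ) : ℂ) ≠ 0 := by exact Nat.cast_ne_zero.mpr (Nat.succ_ne_zero _)
  have h9 : ((i + 1 + m).descFactorial (i + 1) : ℂ) ≠ 0 := by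
    rw [← h3] at h5; exact left_ne_zero_of_mul h5
  rw [h4, ← h3]
  field_simp
  have h8 : ((-1 : ℂ)) ^ (i + 1 + m + 1) * (-1) ^ (i + 1) = - (-1) ^ m := by
    rw [← pow_add, show i + 1 + m + 1 + (i + 1) = 2 * (i + 1) + m + 1 by ring, pow_succ, pow_add,
      pow_mul]
    simp
  linear_combination (ρ (i+2) * (smithiesMatrix ρ m).det) * h8

lemma eq_smithiesCoeff {ρ c : ℕ → ℂ} (h0 : c 0 = 1)
    (h : ∀ n, ((n + 1 : ℕ) : ℂ) * c (n + 1) =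
      -∑ i ∈ Finset.range n, ρ (i + 2) * c (n - (i + 1))) (n : ℕ) :
    c n = smithiesCoeff ρ n := by
  induction n using Nat.strong_induction_on with
  | _ n ih =>
    rcases n with _ | n
    · simp [h0]
    · have h7 : ((n + 1 : ℕ) : ℂ) ≠ 0 := by exact Nat.cast_ne_zero.mpr (Nat.succ_ne_zero _)
      apply mul_left_cancel₀ h7
      rw [h, smithiesCoeff_succ]
      congr 1
      refine Finset.sum_congr rfl fun i hi => ?_
      rw [ih _ (by omega)]

lemma continuous_smithiesCoeff (n : ℕ) : Continuous fun ρ : ℕ → ℂ => smithiesCoeff ρ n := by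
  unfold smithiesCoeff
  refine continuous_const.mul (Continuous.matrix_det ?_)
  refine continuous_pi fun i => continuous_pi fun j => ?_
  simp only [smithiesMatrix, Matrix.of_apply]
  split_ifs
  · exact continuous_const
  · exact continuous_apply _
  · exact continuous_const

/-- Below the diagonal i-j+1 ≥ 2, so ρ_0 and ρ_1 never occur. This matters for limits: the first
trace of the truncations of a Hilbert–Schmidt operator need not converge. -/
lemma smithiesCoeff_congr {ρ ρ' : ℕ → ℂ} (h : ∀ n, 2 ≤ n → ρ n = ρ' n) (n : ℕ) :
    smithiesCoeff ρ n = smithiesCoeff ρ' n := by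
  unfold smithiesCoeff
  congr 2
  ext i j
  simp only [smithiesMatrix, Matrix.of_apply]
  split_ifs
  · rfl
  · exact h _ (by omega)
  · rfl

/-! ### The regularized determinant of a matrix -/

section Matrix

variable {m : Type*} [Fintype m] [DecidableEq m]

open Polynomial in
lemma hasDerivAt_det_one_add_smul (M : Matrix m m ℂ) :
    HasDerivAt (fun z : ℂ => (1 + z • M).det) M.trace 0 := by
  have h := ((Matrix.det (1 + (X : ℂ[X]) • M.map C)).hasDerivAt 0)
  rw [Matrix.derivative_det_one_add_X_smul] at h
  have h1 : (fun z : ℂ => (1 + z • M).det) =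
      fun z => eval z (Matrix.det (1 + (X : ℂ[X]) • M.map C)) := by
    ext z
    rw [← coe_evalRingHom, RingHom.map_det]
    congr 1
    ext i j
    by_cases hij : i = j <;> simp [hij, mul_comm z]
  rwa [h1]

open Polynomial in
lemma eval_charpolyRev_eq (A : Matrix m m ℂ) (z : ℂ) :
    A.charpolyRev.eval z = (1 - z • A).det := by
  rw [Matrix.charpolyRev, ← coe_evalRingHom, RingHom.map_det]
  congr 1
  ext i j
  by_cases hij : i = j <;> simp [hij, mul_comm z]

open Polynomial in
/-- Jacobi's formula for `det (1 - X A)`. -/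
lemma derivative_charpolyRev (A : Matrix m m ℂ) :
    derivative A.charpolyRev =
      -(Matrix.adjugate (1 - (X : ℂ[X]) • A.map C) * A.map C).trace := by
  have hne : A.charpolyRev ≠ 0 := by
    intro h
    have := A.eval_charpolyRev
    simp [h] at this
  -- Polynomials agreeing off the finite zero set of det(1-zA) are equal, so 1-zA may be assumed
  -- invertible.
  refine Polynomial.eq_of_infinite_eval_eq _ _ ((Set.Finite.infinite_compl
    (A.charpolyRev.rootSet_finite ℂ)).mono fun z hz => ?_)
  have hz0 : (1 - z • A).det ≠ 0 := by
    intro h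
    apply hz
    rw [mem_rootSet]
    exact ⟨hne, by simpa [eval_charpolyRev_eq] using h⟩
  have hu : IsUnit (1 - z • A).det := isUnit_iff_ne_zero.mpr hz0
  have h1 : HasDerivAt (fun w => A.charpolyRev.eval w) ((derivative A.charpolyRev).eval z) z :=
    A.charpolyRev.hasDerivAt z
  -- Factoring 1-wA = (1-zA)(1-(w-z)(1-zA)⁻¹A) reduces the derivative at z to the derivative at 0.
  have h2 : HasDerivAt (fun w : ℂ => (1 - z • A).det * (1 + (w - z) • (-((1 - z • A)⁻¹ * A))).det)
      ((1 - z • A).det * (-((1 - z • A)⁻¹ * A)).trace) z := by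
    refine HasDerivAt.const_mul _ ?_
    have h3 := hasDerivAt_det_one_add_smul (-((1 - z • A)⁻¹ * A))
    have h4 : HasDerivAt (fun w : ℂ => w - z) 1 z := (hasDerivAt_id z).sub_const z
    have h5 := HasDerivAt.comp_of_eq z h3 h4 (sub_self z).symm
    rwa [mul_one] at h5
  have h5 : (fun w => A.charpolyRev.eval w) =
      fun w : ℂ => (1 - z • A).det * (1 + (w - z) • (-((1 - z • A)⁻¹ * A))).det := by
    ext w
    rw [eval_charpolyRev_eq, ← Matrix.det_mul]
    congr 1
    rw [mul_add, mul_one, mul_smul_comm, mul_neg, ← mul_assoc, Matrix.mul_nonsing_inv _ hu, one_mul]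
    ext i j
    simp
    ring
  rw [h5] at h1
  show eval z _ = eval z _
  rw [h1.unique h2, eval_neg, ← coe_evalRingHom, AddMonoidHom.map_trace, Matrix.map_mul,
    ← RingHom.mapMatrix_apply (evalRingHom z) (Matrix.adjugate _), RingHom.map_adjugate]
  have h6 : (evalRingHom z).mapMatrix (1 - (X : ℂ[X]) • A.map C) = 1 - z • A := by
    ext i j
    by_cases hij : i = j <;> simp [hij, mul_comm z]
  have h7 : (A.map C).map (evalRingHom z) = A := by ext i j; simp
  rw [h6, h7, Matrix.trace_neg, mul_neg, ← smul_eq_mul, ← Matrix.trace_smul, ← smul_mul_assoc,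
    Matrix.inv_def, smul_smul, Ring.mul_inverse_cancel _ hu, one_smul]

open Polynomial in
-- Newton's identities. Comparing coefficients in adj(1-XA)(1-XA) = det(1-XA)·1 shows that the j-th
-- coefficient of the adjugate is ∑ c_{j-p}A^p; Jacobi's formula then turns its trace against A into
-- the recurrence.
lemma coeff_charpolyRev_succ (A : Matrix m m ℂ) (n : ℕ) :
    ((n + 1 : ℕ) : ℂ) * A.charpolyRev.coeff (n + 1) =
      -∑ p ∈ Finset.range (n + 1), A.charpolyRev.coeff (n - p) * (A ^ (p + 1)).trace := by
  set B := Matrix.adjugate (1 - (X : ℂ[X]) • A.map C) with hBdef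
  have hB : B = A.charpolyRev • 1 + (X : ℂ[X]) • (B * A.map C) := by
    have h1 : B * (1 - (X : ℂ[X]) • A.map C) = A.charpolyRev • 1 := Matrix.adjugate_mul _
    rw [← h1]
    rw [mul_sub, mul_one, mul_smul_comm, sub_add_cancel]
  have hmul : ∀ j, (B * A.map C).map (fun q => q.coeff j) = B.map (fun q => q.coeff j) * A := by
    intro j
    ext a b
    simp [Matrix.mul_apply, finsetSum_coeff]
  have h0 : B.map (fun q => q.coeff 0) = A.charpolyRev.coeff 0 • 1 := by
    conv_lhs => rw [hB]
    ext a b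
    by_cases hab : a = b <;> simp [hab]
  have hs : ∀ j, B.map (fun q => q.coeff (j + 1)) =
      A.charpolyRev.coeff (j + 1) • 1 + B.map (fun q => q.coeff j) * A := by
    intro j
    conv_lhs => rw [hB]
    rw [← hmul]
    ext a b
    by_cases hab : a = b <;> simp [hab]
  have hj : ∀ j, B.map (fun q => q.coeff j) =
      ∑ p ∈ Finset.range (j + 1), A.charpolyRev.coeff (j - p) • A ^ p := by
    intro j
    induction j with
    | zero => simp [h0]
    | succ j ih =>
      rw [hs, ih, Finset.sum_range_succ' _ (j + 1), Finset.sum_mul, add_comm]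
      simp [pow_succ]
  have h1 := congrArg (fun q => coeff q n) (derivative_charpolyRev A)
  simp only [coeff_derivative, coeff_neg] at h1
  have h2 : (B * A.map C).trace.coeff n = (B.map (fun q => q.coeff n) * A).trace := by
    rw [← hmul]; simp [Matrix.trace, finsetSum_coeff]
  rw [h2, hj, Finset.sum_mul, Matrix.trace_sum] at h1
  push_cast
  rw [mul_comm, h1]
  simp [pow_succ]

/-- The power series of `det (1 - z A) exp (z tr A)`. -/
lemma hasSum_smithiesCoeff_trace (A : Matrix m m ℂ) (z : ℂ) :
    HasSum (fun n => smithiesCoeff (fun p => (A ^ p).trace) n * z ^ n)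
      ((1 - z • A).det * Complex.exp (z * A.trace)) := by
  set t := A.trace with ht
  set f : PowerSeries ℂ := (A.charpolyRev : PowerSeries ℂ) with hf
  set e : PowerSeries ℂ := PowerSeries.mk fun n => t ^ n / n.factorial with he
  set S : PowerSeries ℂ := PowerSeries.mk fun p => (A ^ (p + 1)).trace with hS
  have hdf : PowerSeries.derivative ℂ f = -(S * f) := by
    ext n
    rw [PowerSeries.coeff_derivative, map_neg, PowerSeries.coeff_mul,
      Finset.Nat.sum_antidiagonal_eq_sum_range_succ
        (fun i j => PowerSeries.coeff i S * PowerSeries.coeff j f) n]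
    have := coeff_charpolyRev_succ A n
    push_cast at this
    simp only [hf, Polynomial.coeff_coe, hS, PowerSeries.coeff_mk]
    rw [mul_comm, this]
    simp only [mul_comm]
  have hde : PowerSeries.derivative ℂ e = PowerSeries.C t * e := by
    ext n
    rw [PowerSeries.coeff_derivative, PowerSeries.coeff_C_mul]
    simp only [he, PowerSeries.coeff_mk, Nat.factorial_succ]
    have h5 : (n.factorial : ℂ) ≠ 0 := Nat.cast_ne_zero.mpr (Nat.factorial_ne_zero n)
    have h7 : ((n : ℂ) + 1) ≠ 0 := n.cast_add_one_ne_zero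
    push_cast
    field_simp
    ring
  -- The exponential factor contributes +tr A to the logarithmic derivative, which cancels exactly
  -- the first trace in S. What remains is the Smithies recurrence.
  have hd : PowerSeries.derivative ℂ (f * e) = -((S - PowerSeries.C t) * (f * e)) := by
    rw [Derivation.leibniz, hdf, hde]
    simp only [smul_eq_mul]
    ring
  have hc : ∀ n, PowerSeries.coeff n (f * e) = smithiesCoeff (fun p => (A ^ p).trace) n := by
    refine eq_smithiesCoeff ?_ fun n => ?_
    · rw [PowerSeries.coeff_zero_eq_constantCoeff, map_mul]
      simp [hf, he, Polynomial.coeff_zero_eq_eval_zero]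
    · have h1 := congrArg (PowerSeries.coeff n) hd
      rw [PowerSeries.coeff_derivative, map_neg,
        PowerSeries.coeff_mul n (S - PowerSeries.C t),
        Finset.Nat.sum_antidiagonal_eq_sum_range_succ
          (fun i j => PowerSeries.coeff i (S - PowerSeries.C t) * PowerSeries.coeff j (f * e)) n,
        Finset.sum_range_succ'] at h1
      push_cast
      rw [mul_comm, h1]
      simp [hS, ht]
  have h1 : HasSum (fun n => PowerSeries.coeff n f * z ^ n) ((1 - z • A).det) := by
    rw [← eval_charpolyRev_eq, Polynomial.eval_eq_sum_range]
    have h0 : ∀ n, PowerSeries.coeff n f = A.charpolyRev.coeff n := fun n =>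
      Polynomial.coeff_coe _ _
    simp only [h0]
    apply hasSum_sum_of_ne_finset_zero
    intro b hb
    rw [Polynomial.coeff_eq_zero_of_natDegree_lt (by simpa using hb), zero_mul]
  have h1n : Summable fun n => ‖PowerSeries.coeff n f * z ^ n‖ := h1.summable.norm
  have h2 : HasSum (fun n => PowerSeries.coeff n e * z ^ n) (Complex.exp (z * t)) := by
    rw [Complex.exp_eq_exp_ℂ]
    have h0 : ∀ n, PowerSeries.coeff n e = t ^ n / n.factorial := fun n =>
      PowerSeries.coeff_mk _ _
    simp only [h0]
    refine (NormedSpace.expSeries_div_hasSum_exp (z * t)).congr_fun fun n => ?_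
    rw [mul_pow]
    ring
  have h2n : Summable fun n => ‖PowerSeries.coeff n e * z ^ n‖ := h2.summable.norm
  have h3 := summable_norm_sum_mul_antidiagonal_of_summable_norm h1n h2n
  have h4 := tsum_mul_tsum_eq_tsum_sum_antidiagonal_of_summable_norm h1n h2n
  rw [h1.tsum_eq, h2.tsum_eq] at h4
  rw [h4]
  have h5 : (fun n => smithiesCoeff (fun p => (A ^ p).trace) n * z ^ n) = fun n =>
      ∑ kl ∈ Finset.HasAntidiagonal.antidiagonal n, PowerSeries.coeff kl.1 f * z ^ kl.1 *
        (PowerSeries.coeff kl.2 e * z ^ kl.2) := by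
    ext n
    rw [← hc, PowerSeries.coeff_mul, Finset.sum_mul]
    refine Finset.sum_congr rfl fun kl hkl => ?_
    rw [← Finset.HasAntidiagonal.mem_antidiagonal.mp hkl, pow_add]
    ring
  rw [h5]
  exact h3.of_norm.hasSum

open ComplexOrder in
/-- Carleman's inequality for the regularized determinant. -/
lemma norm_det_one_sub_mul_exp_trace_le (A : Matrix m m ℂ) :
    ‖(1 - A).det * Complex.exp A.trace‖ ≤ Real.exp ((∑ i, ∑ j, ‖A i j‖ ^ 2) / 2) := by
  -- |det(1-A)|² is the product of the eigenvalues λ of B, and ∏λ ≤ exp ∑(λ-1) because x ≤ exp(x-1).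
  -- Here ∑(λ-1) = tr B - tr 1 = -2 Re tr A + ‖A‖²_HS, and the factor exp(tr A) removes the trace
  -- term.
  set B := (1 - A) * (1 - A).conjTranspose with hB
  have hP : B.PosSemidef := Matrix.posSemidef_self_mul_conjTranspose _
  have hdet : ((‖(1 - A).det‖ ^ 2 : ℝ) : ℂ) = ((∏ i, hP.1.eigenvalues i : ℝ) : ℂ) := by
    have h1 : B.det = ∏ i, (hP.1.eigenvalues i : ℂ) := hP.1.det_eq_prod_eigenvalues
    rw [Complex.ofReal_prod]
    rw [← h1, hB, Complex.ofReal_pow, Matrix.det_mul, Matrix.det_conjTranspose, ← Complex.conj_mul', mul_comm]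
    rfl
  have htr : ∑ i, (hP.1.eigenvalues i - 1) = -2 * A.trace.re + ∑ i, ∑ j, ‖A i j‖ ^ 2 := by
    have h1 : B.trace = ∑ i, (hP.1.eigenvalues i : ℂ) := hP.1.trace_eq_sum_eigenvalues
    have h2 : B.trace = Fintype.card m - A.trace - star A.trace + ∑ i, ∑ j, ((‖A i j‖ ^ 2 : ℝ) : ℂ) := by
      have h3 : B = 1 - A - A.conjTranspose + A * A.conjTranspose := by
        rw [hB, Matrix.conjTranspose_sub, Matrix.conjTranspose_one]; noncomm_ring
      rw [h3, Matrix.trace_add, Matrix.trace_sub, Matrix.trace_sub, Matrix.trace_one,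
        Matrix.trace_conjTranspose]
      congr 1
      simp only [Matrix.trace, Matrix.diag, Matrix.mul_apply, Matrix.conjTranspose_apply]
      refine Finset.sum_congr rfl fun i _ => Finset.sum_congr rfl fun j _ => ?_
      rw [Complex.ofReal_pow, ← Complex.conj_mul', mul_comm]; rfl
    have h4 : ((∑ i, hP.1.eigenvalues i : ℝ) : ℂ) =
        ((Fintype.card m - 2 * A.trace.re + ∑ i, ∑ j, ‖A i j‖ ^ 2 : ℝ) : ℂ) := by
      have h5 : A.trace + star A.trace = ((2 * A.trace.re : ℝ) : ℂ) := Complex.add_conj _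
      rw [Complex.ofReal_sum, ← h1, h2, Complex.ofReal_add, Complex.ofReal_sub, ← h5,
        Complex.ofReal_sum]
      simp only [Complex.ofReal_sum, Complex.ofReal_natCast]
      ring
    have h4' := Complex.ofReal_injective h4
    rw [Finset.sum_sub_distrib, h4']
    simp
    ring
  have h5 : ∏ i, hP.1.eigenvalues i ≤ Real.exp (∑ i, (hP.1.eigenvalues i - 1)) := by
    rw [Real.exp_sum]
    refine Finset.prod_le_prod (fun i _ => hP.eigenvalues_nonneg i) fun i _ => ?_
    have := Real.add_one_le_exp (hP.1.eigenvalues i - 1)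
    linarith
  have hdet' : ‖(1 - A).det‖ ^ 2 = ∏ i, hP.1.eigenvalues i := by exact_mod_cast hdet
  refine abs_le_of_sq_le_sq' ?_ (Real.exp_nonneg _) |>.2
  rw [norm_mul, mul_pow, Complex.norm_exp, hdet']
  calc _ ≤ Real.exp (∑ i, (hP.1.eigenvalues i - 1)) * Real.exp A.trace.re ^ 2 := by gcongr
    _ = _ := by
      rw [htr, ← Real.exp_nat_mul, ← Real.exp_nat_mul, ← Real.exp_add]
      congr 1; push_cast; ring

/-- Cauchy's estimate on the circle |z| = r for the entire function det(1-zA)exp(z tr A), bounded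
there by Carleman's inequality applied to zA. The bound does not see the size of A, so it survives
the limit over truncations. -/
lemma norm_smithiesCoeff_trace_mul_pow_le (A : Matrix m m ℂ) {h : ℝ}
    (hA : ∑ i, ∑ j, ‖A i j‖ ^ 2 ≤ h) {r : ℝ} (hr : 0 ≤ r) (n : ℕ) :
    ‖smithiesCoeff (fun p => (A ^ p).trace) n‖ * r ^ n ≤ Real.exp (r ^ 2 * h / 2) := by
  rcases hr.eq_or_lt with rfl | hr
  · rcases n with _ | n <;> simp
  set F : ℂ → ℂ := fun z => (1 - z • A).det * Complex.exp (z * A.trace) with hF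
  have hFd : Differentiable ℂ F := by
    have h1 : (fun z : ℂ => (1 - z • A).det) = fun z => A.charpolyRev.eval z := by
      ext z; rw [eval_charpolyRev_eq]
    refine Differentiable.mul ?_ (by fun_prop)
    rw [h1]
    exact A.charpolyRev.differentiable
  have hs := hasSum_smithiesCoeff_trace A
  set c := smithiesCoeff (fun p => (A ^ p).trace) with hc
  have hp : HasFPowerSeriesOnBall F (FormalMultilinearSeries.ofScalars ℂ c) 0 ⊤ := by
    refine ⟨?_, by simp, fun {y} _ => ?_⟩
    · refine (FormalMultilinearSeries.radius_eq_top_of_summable_norm _ fun ρ => ?_).ge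
      refine (hs ρ).summable.norm.congr fun n => ?_
      simp
    · simpa [FormalMultilinearSeries.ofScalars_apply_eq, mul_comm, hF] using hs y
  have hb : ∀ z ∈ Metric.sphere (0 : ℂ) r, ‖F z‖ ≤ Real.exp (r ^ 2 * h / 2) := by
    intro z hz
    have h1 := norm_det_one_sub_mul_exp_trace_le (z • A)
    rw [Matrix.trace_smul, smul_eq_mul] at h1
    refine h1.trans (Real.exp_le_exp.mpr ?_)
    have h2 : ‖z‖ = r := by simpa using hz
    simp only [Matrix.smul_apply, norm_smul, h2, mul_pow, ← Finset.mul_sum]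
    gcongr
  have hd := Complex.norm_iteratedDeriv_le_of_forall_mem_sphere_norm_le n hr hFd.diffContOnCl hb
  -- Uniqueness of the power series identifies the Smithies coefficients with the Taylor
  -- coefficients.
  have he := hp.hasFPowerSeriesAt.eq_formalMultilinearSeries
    (hp.hasFPowerSeriesAt.analyticAt.hasFPowerSeriesAt)
  have he' := congrFun (FormalMultilinearSeries.ofScalars_series_injective ℂ ℂ he) n
  rw [he', norm_div, Complex.norm_natCast]
  have h5 : (0 : ℝ) < n.factorial := by exact_mod_cast Nat.factorial_pos n
  rw [div_mul_eq_mul_div, div_le_iff₀ h5]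
  rw [le_div_iff₀ (by positivity)] at hd
  linarith

end Matrix

/-! ### Truncations of an operator on a Hilbert space -/

section Hilbert

variable {H : Type*} [NormedAddCommGroup H] [InnerProductSpace ℂ H]
  {ι : Type*} (b : HilbertBasis ι ℂ H)

local notation "⟪" x ", " y "⟫" => inner ℂ x y

lemma hilbertBasis_inner [DecidableEq ι] (i j : ι) : ⟪b i, b j⟫ = if i = j then 1 else 0 :=
  orthonormal_iff_ite.mp b.orthonormal i j

/-- The projection onto the span of finitely many basis vectors. -/
def basisProj (s : Finset ι) : H →L[ℂ] H := ∑ i ∈ s, InnerProductSpace.rankOne ℂ (b i) (b i)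

lemma basisProj_apply (s : Finset ι) (x : H) : basisProj b s x = ∑ i ∈ s, ⟪b i, x⟫ • b i := by
  simp [basisProj]

lemma basisProj_apply_basis_of_mem {s : Finset ι} {i : ι} (hi : i ∈ s) :
    basisProj b s (b i) = b i := by
  classical
  rw [basisProj_apply, Finset.sum_eq_single_of_mem i hi]
  · rw [hilbertBasis_inner, if_pos rfl, one_smul]
  · intro j _ hj; simp [hilbertBasis_inner, hj]

lemma basisProj_apply_basis_of_notMem {s : Finset ι} {i : ι} (hi : i ∉ s) :
    basisProj b s (b i) = 0 := by
  classical
  rw [basisProj_apply, Finset.sum_eq_zero]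
  intro j hj
  have : j ≠ i := by rintro rfl; exact hi hj
  simp [hilbertBasis_inner, this]

lemma inner_basisProj_left (s : Finset ι) (x y : H) :
    ⟪basisProj b s x, y⟫ = ⟪x, basisProj b s y⟫ := by
  rw [basisProj_apply, basisProj_apply, sum_inner, inner_sum]
  refine Finset.sum_congr rfl fun i _ => ?_
  rw [inner_smul_left, inner_smul_right, inner_conj_symm, mul_comm]

lemma norm_basisProj_apply_le (s : Finset ι) (x : H) : ‖basisProj b s x‖ ≤ ‖x‖ := by
  have h1 : basisProj b s (basisProj b s x) = basisProj b s x := by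
    conv_lhs => rw [basisProj_apply b s x, map_sum]
    rw [basisProj_apply]
    exact Finset.sum_congr rfl fun i hi => by rw [map_smul, basisProj_apply_basis_of_mem b hi]
  have h2 : ‖basisProj b s x‖ * ‖basisProj b s x‖ ≤ ‖x‖ * ‖basisProj b s x‖ := by
    rw [← inner_self_eq_norm_mul_norm (𝕜 := ℂ), inner_basisProj_left, h1]
    exact re_inner_le_norm _ _
  rcases (norm_nonneg (basisProj b s x)).eq_or_lt with h | h
  · rw [← h]; exact norm_nonneg _
  · exact le_of_mul_le_mul_right h2 h

lemma tendsto_basisProj (x : H) : Tendsto (fun s => basisProj b s x) atTop (𝓝 x) := by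
  have h := b.hasSum_repr x
  simp only [b.repr_apply_apply] at h
  simpa only [HasSum, basisProj_apply, SummationFilter.unconditional_filter] using h

variable (T : H →L[ℂ] H)

/-- The truncation `P T P` of an operator. -/
def trunc (s : Finset ι) : H →L[ℂ] H := basisProj b s ∘L T ∘L basisProj b s

/-- The matrix of a truncation. -/
def truncMatrix (s : Finset ι) : Matrix s s ℂ := Matrix.of fun i j => ⟪b i, T (b j)⟫

lemma trunc_apply (s : Finset ι) (x : H) :
    trunc b T s x = basisProj b s (T (basisProj b s x)) := rfl

lemma norm_trunc_apply_le (s : Finset ι) (x : H) : ‖trunc b T s x‖ ≤ ‖T‖ * ‖x‖ := by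
  rw [trunc_apply]
  refine (norm_basisProj_apply_le b s _).trans ((T.le_opNorm _).trans ?_)
  gcongr
  exact norm_basisProj_apply_le b s x

lemma norm_trunc_apply_basis_le (s : Finset ι) (i : ι) : ‖trunc b T s (b i)‖ ≤ ‖T (b i)‖ := by
  rw [trunc_apply]
  refine (norm_basisProj_apply_le b s _).trans ?_
  by_cases hi : i ∈ s
  · rw [basisProj_apply_basis_of_mem b hi]
  · rw [basisProj_apply_basis_of_notMem b hi]; simp

lemma norm_trunc_pow_apply_le (s : Finset ι) (n : ℕ) (x : H) :
    ‖(trunc b T s ^ n) x‖ ≤ ‖T‖ ^ n * ‖x‖ := by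
  induction n with
  | zero => simp
  | succ n ih =>
    rw [pow_succ', mul_apply_eq_comp, pow_succ', mul_assoc]
    exact (norm_trunc_apply_le b T s _).trans (by gcongr)

/-- The vector is allowed to vary with the truncation so that strong convergence passes to powers by
induction. -/
lemma tendsto_trunc_apply {x : H} {y : Finset ι → H} (hy : Tendsto y atTop (𝓝 x)) :
    Tendsto (fun s => trunc b T s (y s)) atTop (𝓝 (T x)) := by
  have hP : ∀ {x : H} {y : Finset ι → H}, Tendsto y atTop (𝓝 x) →
      Tendsto (fun s => basisProj b s (y s)) atTop (𝓝 x) := by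
    intro x y hy
    have h1 : Tendsto (fun s => basisProj b s (y s - x)) atTop (𝓝 0) :=
      squeeze_zero_norm (fun s => norm_basisProj_apply_le b s _)
        (tendsto_iff_norm_sub_tendsto_zero.mp hy)
    have h2 := h1.add (tendsto_basisProj b x)
    simpa [map_sub] using h2
  exact hP ((T.continuous.tendsto x).comp (hP hy))

lemma tendsto_trunc_pow_apply (n : ℕ) (x : H) :
    Tendsto (fun s => (trunc b T s ^ n) x) atTop (𝓝 ((T ^ n) x)) := by
  induction n with
  | zero => simp
  | succ n ih =>
    simp only [pow_succ', mul_apply_eq_comp]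
    exact tendsto_trunc_apply b T ih

lemma truncMatrix_pow_apply [DecidableEq ι] (s : Finset ι) (n : ℕ) (i j : s) :
    (truncMatrix b T s ^ n) i j = ⟪b i, (trunc b T s ^ n) (b j)⟫ := by
  induction n generalizing i j with
  | zero =>
    rw [pow_zero, pow_zero, one_apply_eq_self, hilbertBasis_inner, Matrix.one_apply]
    simp only [Subtype.ext_iff]
  | succ n ih =>
    rw [pow_succ, pow_succ, Matrix.mul_apply, mul_apply_eq_comp, trunc_apply b T s (b j),
      basisProj_apply_basis_of_mem b j.2, basisProj_apply, map_sum, inner_sum,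
      ← Finset.sum_coe_sort s]
    refine Finset.sum_congr rfl fun k _ => ?_
    rw [ih, map_smul, inner_smul_right, mul_comm]
    rfl

variable [CompleteSpace H]

lemma inner_trunc_right (s : Finset ι) (x y : H) :
    ⟪x, trunc b T s y⟫ = ⟪trunc b (ContinuousLinearMap.adjoint T) s x, y⟫ := by
  rw [trunc_apply, trunc_apply, ← inner_basisProj_left, inner_basisProj_left _ _ _ y,
    ContinuousLinearMap.adjoint_inner_left]

variable {b T}

/-- Dominated convergence over the basis. With at least two factors, one can be moved to the left of
the inner product as an adjoint, and the general term is then dominated by ‖T‖ⁿ(‖Tb_i‖² + ‖T*b_i‖²),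
which is summable. -/
lemma tendsto_trace_truncMatrix_pow [DecidableEq ι] (hT : Summable fun i => ‖T (b i)‖ ^ 2)
    (hT' : Summable fun i => ‖ContinuousLinearMap.adjoint T (b i)‖ ^ 2) (n : ℕ) :
    Tendsto (fun s => (truncMatrix b T s ^ (n + 2)).trace) atTop
      (𝓝 (∑' i, ⟪b i, (T ^ (n + 2)) (b i)⟫)) := by
  have h1 : ∀ s, (truncMatrix b T s ^ (n + 2)).trace =
      ∑' i, ⟪b i, (trunc b T s ^ (n + 2)) (b i)⟫ := by
    intro s
    rw [tsum_eq_sum (s := s), ← Finset.sum_coe_sort s]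
    · exact Finset.sum_congr rfl fun i _ => truncMatrix_pow_apply b T s _ i i
    · intro i hi
      rw [pow_succ, mul_apply_eq_comp, trunc_apply b T s (b i),
        basisProj_apply_basis_of_notMem b hi]
      simp
  simp only [h1]
  refine tendsto_tsum_of_dominated_convergence
    (bound := fun i => ‖T‖ ^ n * (‖T (b i)‖ ^ 2 + ‖ContinuousLinearMap.adjoint T (b i)‖ ^ 2))
    ((hT.add hT').mul_left _) (fun i => ?_) (Eventually.of_forall fun s i => ?_)
  · exact (tendsto_const_nhds).inner (tendsto_trunc_pow_apply b T _ _)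
  · rw [pow_succ', pow_succ, mul_apply_eq_comp, mul_apply_eq_comp,
      inner_trunc_right]
    calc _ ≤ ‖ContinuousLinearMap.adjoint T (b i)‖ * (‖T‖ ^ n * ‖T (b i)‖) := by
          refine (norm_inner_le_norm _ _).trans ?_
          gcongr
          · exact norm_trunc_apply_basis_le b _ s i
          · refine (norm_trunc_pow_apply_le b T s n _).trans ?_
            gcongr
            exact norm_trunc_apply_basis_le b _ s i
      _ = ‖T‖ ^ n * (‖ContinuousLinearMap.adjoint T (b i)‖ * ‖T (b i)‖) := by ring
      _ ≤ _ := by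
          gcongr
          nlinarith [sq_nonneg (‖ContinuousLinearMap.adjoint T (b i)‖ - ‖T (b i)‖),
            sq_nonneg ‖ContinuousLinearMap.adjoint T (b i)‖, sq_nonneg ‖T (b i)‖]

omit [CompleteSpace H] in
lemma sum_norm_truncMatrix_sq_le (hT : Summable fun i => ‖T (b i)‖ ^ 2) (s : Finset ι) :
    ∑ i, ∑ j, ‖truncMatrix b T s i j‖ ^ 2 ≤ ∑' i, ‖T (b i)‖ ^ 2 := by
  rw [Finset.sum_comm]
  calc _ ≤ ∑ j : s, ‖T (b j)‖ ^ 2 := by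
        refine Finset.sum_le_sum fun j _ => ?_
        have := b.orthonormal.sum_inner_products_le (s := s) (T (b j))
        rwa [← Finset.sum_coe_sort s] at this
    _ = ∑ j ∈ s, ‖T (b j)‖ ^ 2 := Finset.sum_coe_sort s (fun j => ‖T (b j)‖ ^ 2)
    _ ≤ _ := hT.sum_le_tsum s fun i _ => by positivity

lemma tendsto_smithiesCoeff_truncMatrix [DecidableEq ι] (hT : Summable fun i => ‖T (b i)‖ ^ 2)
    (hT' : Summable fun i => ‖ContinuousLinearMap.adjoint T (b i)‖ ^ 2) {ρ : ℕ → ℂ}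
    (hρ : ∀ n, ∑' i, ⟪b i, (T ^ (n + 2)) (b i)⟫ = ρ (n + 2)) (n : ℕ) :
    Tendsto (fun s => smithiesCoeff (fun p => (truncMatrix b T s ^ p).trace) n) atTop
      (𝓝 (smithiesCoeff ρ n)) := by
  have h1 : ∀ σ : ℕ → ℂ, smithiesCoeff σ n = smithiesCoeff (fun p => if 2 ≤ p then σ p else 0) n :=
    fun σ => smithiesCoeff_congr (fun p hp => by simp [hp]) n
  rw [h1 ρ]
  have h2 : (fun s => smithiesCoeff (fun p => (truncMatrix b T s ^ p).trace) n) =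
      fun s => smithiesCoeff (fun p => if 2 ≤ p then (truncMatrix b T s ^ p).trace else 0) n :=
    funext fun s => h1 _
  rw [h2]
  refine ((continuous_smithiesCoeff n).tendsto _).comp (tendsto_pi_nhds.mpr fun p => ?_)
  by_cases hp : 2 ≤ p
  · obtain ⟨q, rfl⟩ : ∃ q, p = q + 2 := ⟨p - 2, by omega⟩
    simp only [hp, if_true]
    rw [← hρ]
    exact tendsto_trace_truncMatrix_pow hT hT' q
  · simp only [hp, if_false]
    exact tendsto_const_nhds

lemma norm_smithiesCoeff_mul_pow_le [DecidableEq ι] (hT : Summable fun i => ‖T (b i)‖ ^ 2)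
    (hT' : Summable fun i => ‖ContinuousLinearMap.adjoint T (b i)‖ ^ 2) {ρ : ℕ → ℂ}
    (hρ : ∀ n, ∑' i, ⟪b i, (T ^ (n + 2)) (b i)⟫ = ρ (n + 2)) {r : ℝ} (hr : 0 ≤ r) (n : ℕ) :
    ‖smithiesCoeff ρ n‖ * r ^ n ≤ Real.exp (r ^ 2 * (∑' i, ‖T (b i)‖ ^ 2) / 2) := by
  refine le_of_tendsto ((tendsto_smithiesCoeff_truncMatrix hT hT' hρ n).norm.mul_const _)
    (Eventually.of_forall fun s => ?_)
  exact norm_smithiesCoeff_trace_mul_pow_le _ (sum_norm_truncMatrix_sq_le hT s) hr n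

/-- A coefficient bound on the circle of radius 2|g| makes the series at g geometric with ratio 1/2:
the majorant for interchanging limit and sum. -/
lemma norm_mul_pow_le_geometric {c g : ℂ} {M : ℝ} {n : ℕ}
    (h : ‖c‖ * (2 * ‖g‖) ^ n ≤ M) : ‖c * g ^ n‖ ≤ M * (1 / 2) ^ n := by
  rw [norm_mul, norm_pow]
  rw [mul_pow] at h
  have h2 : (2 : ℝ) ^ n * (1 / 2) ^ n = 1 := by rw [← mul_pow]; norm_num
  calc ‖c‖ * ‖g‖ ^ n = ‖c‖ * (2 ^ n * ‖g‖ ^ n) * (1 / 2) ^ n := by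
        linear_combination (-(‖c‖ * ‖g‖ ^ n)) * h2
    _ ≤ _ := by gcongr

/-- The Fredholm–Smithies denominator vanishes at the inverse of an eigenvalue. -/
lemma tsum_smithiesCoeff_eq_zero [DecidableEq ι] (hT : Summable fun i => ‖T (b i)‖ ^ 2)
    (hT' : Summable fun i => ‖ContinuousLinearMap.adjoint T (b i)‖ ^ 2) {ρ : ℕ → ℂ}
    (hρ : ∀ n, ∑' i, ⟪b i, (T ^ (n + 2)) (b i)⟫ = ρ (n + 2)) {i₀ : ι} {μ g : ℂ}
    (hi₀ : T (b i₀) = μ • b i₀) (hg : g * μ = 1) :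
    ∑' n, smithiesCoeff ρ n * g ^ n = 0 := by
  set c : Finset ι → ℕ → ℂ := fun s => smithiesCoeff (fun p => (truncMatrix b T s ^ p).trace)
    with hc
  have hlim : ∀ n, Tendsto (fun s => c s n) atTop (𝓝 (smithiesCoeff ρ n)) := fun n =>
    tendsto_smithiesCoeff_truncMatrix hT hT' hρ n
  have hbd : ∀ s n, ‖c s n‖ * (2 * ‖g‖) ^ n ≤
      Real.exp ((2 * ‖g‖) ^ 2 * (∑' i, ‖T (b i)‖ ^ 2) / 2) := fun s n =>
    norm_smithiesCoeff_trace_mul_pow_le _ (sum_norm_truncMatrix_sq_le hT s) (by positivity) n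
  have hsum : ∀ s, ∑' n, c s n * g ^ n = _ := fun s =>
    (hasSum_smithiesCoeff_trace (truncMatrix b T s) g).tsum_eq
  clear_value c
  have h1 : Tendsto (fun s => ∑' n, c s n * g ^ n) atTop (𝓝 (∑' n, smithiesCoeff ρ n * g ^ n)) :=
    tendsto_tsum_of_dominated_convergence
      ((summable_geometric_of_lt_one (by norm_num) (by norm_num : (1 / 2 : ℝ) < 1)).mul_left _)
      (fun n => (hlim n).mul_const _)
      (Eventually.of_forall fun s n => norm_mul_pow_le_geometric (hbd s n))
  refine tendsto_nhds_unique h1 (tendsto_const_nhds.congr' ?_)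
  -- Once the truncation contains the eigenvector, its column in 1-gA is (1-gμ) times a basis
  -- vector, hence zero, and so is the determinant.
  filter_upwards [eventually_ge_atTop {i₀}] with s hs
  have hs' : i₀ ∈ s := hs (Finset.mem_singleton_self _)
  rw [hsum]
  rw [Matrix.det_eq_zero_of_column_eq_zero ⟨i₀, hs'⟩, zero_mul]
  intro i
  simp only [Matrix.sub_apply, Matrix.smul_apply, truncMatrix, Matrix.of_apply, hi₀,
    inner_smul_right, hilbertBasis_inner, Matrix.one_apply, Subtype.ext_iff, smul_eq_mul]
  split_ifs
  · rw [mul_one, hg, sub_self]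
  · simp

omit [CompleteSpace H] in
lemma norm_apply_le_sqrt_tsum (hT : Summable fun i => ‖T (b i)‖ ^ 2) (x : H) :
    ‖T x‖ ≤ √(∑' i, ‖T (b i)‖ ^ 2) * ‖x‖ := by
  have h1 := ((T.continuous.tendsto _).comp (tendsto_basisProj b x)).norm
  refine le_of_tendsto h1 (Eventually.of_forall fun s => ?_)
  simp only [Function.comp, basisProj_apply, map_sum, map_smul]
  calc _ ≤ ∑ i ∈ s, ‖T (b i)‖ * ‖⟪b i, x⟫‖ := by
        refine (norm_sum_le _ _).trans (le_of_eq ?_)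
        exact Finset.sum_congr rfl fun i _ => by rw [norm_smul, mul_comm]
    _ ≤ √(∑ i ∈ s, ‖T (b i)‖ ^ 2) * √(∑ i ∈ s, ‖⟪b i, x⟫‖ ^ 2) :=
        Real.sum_mul_le_sqrt_mul_sqrt _ _ _
    _ ≤ _ := by
        gcongr
        · exact hT.sum_le_tsum s fun i _ => by positivity
        · exact Real.sqrt_le_iff.mpr ⟨norm_nonneg _, b.orthonormal.sum_inner_products_le x⟩

/-- Hilbert–Schmidt operators are compact. -/
lemma isCompactOperator_of_summable (hT : Summable fun i => ‖T (b i)‖ ^ 2) :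
    IsCompactOperator T := by
  have hc : ∀ s, IsCompactOperator (T ∘L basisProj b s) := by
    intro s
    have h1 : IsCompactOperator (basisProj b s) := by
      refine Submodule.sum_mem (compactOperator (RingHom.id ℂ) H H) fun i _ => ?_
      have h2 : IsCompactOperator (innerSL ℂ (b i)) := isCompactOperator_of_locallyCompactSpace_dom _
      exact h2.clm_comp (ContinuousLinearMap.toSpanSingleton ℂ (b i))
    exact h1.clm_comp T
  have ht : Tendsto (fun s => T ∘L basisProj b s) atTop (𝓝 T) := by
    rw [tendsto_iff_norm_sub_tendsto_zero]
    -- T∘P - T kills the basis vectors in s and is -T on the others, so its squared Hilbert–Schmidt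
    -- norm is a tail of a convergent series.
    have hd : ∀ s i, ‖(T ∘L basisProj b s - T) (b i)‖ ^ 2 ≤ ‖T (b i)‖ ^ 2 := by
      intro s i
      by_cases hi : i ∈ s
      · simp [basisProj_apply_basis_of_mem b hi]
      · simp [basisProj_apply_basis_of_notMem b hi]
    have h2 : Tendsto (fun s => ∑' i, ‖(T ∘L basisProj b s - T) (b i)‖ ^ 2) atTop (𝓝 0) := by
      rw [← tsum_zero (α := ℝ) (β := ι)]
      refine tendsto_tsum_of_dominated_convergence hT (fun i => ?_)
        (Eventually.of_forall fun s i => ?_)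
      · refine tendsto_const_nhds.congr' ?_
        filter_upwards [eventually_ge_atTop {i}] with s hs
        have hs' : i ∈ s := hs (Finset.mem_singleton_self _)
        simp [basisProj_apply_basis_of_mem b hs']
      · rw [Real.norm_of_nonneg (by positivity)]
        exact hd s i
    have h3 := (Real.continuous_sqrt.tendsto 0).comp h2
    rw [Real.sqrt_zero] at h3
    refine squeeze_zero (fun s => norm_nonneg _) (fun s => ?_) h3
    refine ContinuousLinearMap.opNorm_le_bound _ (Real.sqrt_nonneg _) fun x => ?_
    exact norm_apply_le_sqrt_tsum (hT.of_nonneg_of_le (fun i => by positivity) (hd s)) x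
  exact isCompactOperator_of_tendsto ht (Eventually.of_forall hc)

end Hilbert

/-! ### Non-vanishing of the Fredholm–Smithies denominator implies invertibility -/

section Fredholm

variable {H : Type*} [NormedAddCommGroup H] [InnerProductSpace ℂ H] [CompleteSpace H]

/-- `T` is a Hilbert–Schmidt operator with squared Hilbert–Schmidt norm `h`, and `ρ n` is the trace
of `T ^ n` for `n ≥ 2`. -/
structure HasTraces (T : H →L[ℂ] H) (h : ℝ) (ρ : ℕ → ℂ) : Prop where
  hasSum : ∀ (w : Set H) (b : HilbertBasis w ℂ H), HasSum (fun i => ‖T (b i)‖ ^ 2) h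
  summable_adjoint : ∀ (w : Set H) (b : HilbertBasis w ℂ H),
    Summable fun i => ‖ContinuousLinearMap.adjoint T (b i)‖ ^ 2
  trace : ∀ (w : Set H) (b : HilbertBasis w ℂ H) (n : ℕ),
    ∑' i, inner ℂ (b i) ((T ^ (n + 2)) (b i)) = ρ (n + 2)

variable {T : H →L[ℂ] H} {h : ℝ} {ρ : ℕ → ℂ}

lemma HasTraces.norm_smithiesCoeff_le (hT : HasTraces T h ρ) {r : ℝ} (hr : 0 ≤ r) (n : ℕ) :
    ‖smithiesCoeff ρ n‖ * r ^ n ≤ Real.exp (r ^ 2 * h / 2) := by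
  obtain ⟨w, b, -⟩ := exists_hilbertBasis ℂ H
  classical
  have h1 := norm_smithiesCoeff_mul_pow_le (hT.hasSum w b).summable (hT.summable_adjoint w b)
    (hT.trace w b) hr n
  rwa [(hT.hasSum w b).tsum_eq] at h1

/-- If the Fredholm–Smithies denominator does not vanish, then `1 - g T` is invertible. -/
lemma HasTraces.isUnit_one_sub (hT : HasTraces T h ρ) {g : ℂ}
    (hg : ∑' n, smithiesCoeff ρ n * g ^ n ≠ 0) : IsUnit (1 - g • T) := by
  rcases eq_or_ne g 0 with rfl | hg0
  · simp
  have hc : IsCompactOperator T := by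
    obtain ⟨w, b, -⟩ := exists_hilbertBasis ℂ H
    exact isCompactOperator_of_summable (hT.hasSum w b).summable
  -- Fredholm alternative: 1/g is either an eigenvalue, excluded because the denominator would
  -- vanish, or in the resolvent set.
  rcases IsCompactOperator.hasEigenvalue_or_mem_resolventSet hc (inv_ne_zero hg0) with he | hr
  · exfalso
    apply hg
    obtain ⟨x, hx⟩ := he.exists_hasEigenvector
    set y : H := ((‖x‖ : ℂ)⁻¹) • x with hy
    have hxn : (‖x‖ : ℂ) ≠ 0 := by simpa using hx.2
    have hyn : ‖y‖ = 1 := by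
      rw [hy, norm_smul]; simp [hx.2]
    have hTy : T y = g⁻¹ • y := by
      rw [hy, map_smul, smul_comm]
      congr 1
      exact hx.apply_eq_smul
    -- The normalized eigenvector is completed to an orthonormal basis. This is where the trace
    -- formulas are needed in an arbitrary basis.
    have ho : Orthonormal ℂ ((↑) : ({y} : Set H) → H) := by
      constructor
      · rintro ⟨z, rfl⟩; exact hyn
      · intro i j hij; exact absurd (Subsingleton.elim i j) hij
    obtain ⟨w, b, hw, hb⟩ := ho.exists_hilbertBasis_extension
    have hyw : y ∈ w := hw rfl
    classical
    refine tsum_smithiesCoeff_eq_zero (hT.hasSum w b).summable (hT.summable_adjoint w b)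
      (hT.trace w b) (i₀ := ⟨y, hyw⟩) (μ := g⁻¹) ?_ (mul_inv_cancel₀ hg0)
    rw [hb]; exact hTy
  · rw [spectrum.mem_resolventSet_iff] at hr
    have h1 : (1 - g • T) = g • (algebraMap ℂ (H →L[ℂ] H) g⁻¹ - T) := by
      rw [smul_sub, Algebra.algebraMap_eq_smul_one, smul_smul, mul_inv_cancel₀ hg0, one_smul]
    rw [h1]
    exact (isUnit_smul_iff (Units.mk0 g hg0) _).mpr hr

end Fredholm

/-! ### Square-integrable kernels -/

section Kernel

open scoped ENNReal ComplexConjugate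

variable {X : Type*} [MeasurableSpace X] {μ : Measure X}

lemma eLpNorm_two_sq {E : Type*} [NormedAddCommGroup E] (f : X → E) :
    eLpNorm f 2 μ ^ 2 = ∫⁻ x, ‖f x‖ₑ ^ 2 ∂μ := by
  have h := eLpNorm_nnreal_pow_eq_lintegral (μ := μ) (f := f) (p := 2) two_ne_zero
  simpa [ENNReal.rpow_two] using h

lemma memLp_two_of_lintegral_lt_top {E : Type*} [NormedAddCommGroup E] {f : X → E}
    (hf : AEStronglyMeasurable f μ) (h : ∫⁻ x, ‖f x‖ₑ ^ 2 ∂μ < ⊤) : MemLp f 2 μ := by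
  refine ⟨hf, ?_⟩
  rw [← eLpNorm_two_sq] at h
  exact (ENNReal.pow_lt_top_iff.mp h).resolve_right two_ne_zero

lemma _root_.MeasureTheory.MemLp.lintegral_enorm_sq_lt_top {E : Type*} [NormedAddCommGroup E]
    {f : X → E} (hf : MemLp f 2 μ) : ∫⁻ x, ‖f x‖ₑ ^ 2 ∂μ < ⊤ := by
  rw [← eLpNorm_two_sq]
  exact ENNReal.pow_lt_top hf.2

lemma norm_Lp_two_sq {E : Type*} [NormedAddCommGroup E] (f : Lp E 2 μ) :
    ‖f‖ ^ 2 = (∫⁻ x, ‖f x‖ₑ ^ 2 ∂μ).toReal := by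
  rw [← eLpNorm_two_sq, ENNReal.toReal_pow, Lp.norm_def]

lemma sq_lintegral_mul_le {f g : X → ℝ≥0∞} (hf : AEMeasurable f μ) (hg : AEMeasurable g μ) :
    (∫⁻ x, f x * g x ∂μ) ^ 2 ≤ (∫⁻ x, f x ^ 2 ∂μ) * ∫⁻ x, g x ^ 2 ∂μ := by
  have h := ENNReal.lintegral_mul_le_Lp_mul_Lq μ Real.HolderConjugate.two_two hf hg
  have h2 : ∀ a : ℝ≥0∞, (a ^ (1 / 2 : ℝ)) ^ 2 = a := fun a => by
    rw [← ENNReal.rpow_natCast, ← ENNReal.rpow_mul]; norm_num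
  calc _ ≤ _ := pow_le_pow_left₀ zero_le h 2
    _ = _ := by rw [mul_pow, h2, h2]; simp

lemma sq_enorm_integral_mul_le {f g : X → ℂ} (hf : AEStronglyMeasurable f μ)
    (hg : AEStronglyMeasurable g μ) :
    ‖∫ x, f x * g x ∂μ‖ₑ ^ 2 ≤ (∫⁻ x, ‖f x‖ₑ ^ 2 ∂μ) * ∫⁻ x, ‖g x‖ₑ ^ 2 ∂μ := by
  refine le_trans ?_ (sq_lintegral_mul_le hf.enorm hg.enorm)
  refine pow_le_pow_left₀ zero_le ((enorm_integral_le_lintegral_enorm _).trans ?_) 2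
  simp

/-- The squared Hilbert–Schmidt norm of a kernel. -/
def hsSq (μ : Measure X) (K : X → X → ℂ) : ℝ≥0∞ := ∫⁻ x, ∫⁻ y, ‖K x y‖ₑ ^ 2 ∂μ ∂μ

/-- Measurable square-integrable kernels. -/
structure IsL2Kernel (μ : Measure X) (K : X → X → ℂ) : Prop where
  measurable : Measurable fun p : X × X => K p.1 p.2
  lt_top : hsSq μ K < ⊤

/-- The action of a kernel on a function. -/
def kernelApply (μ : Measure X) (K : X → X → ℂ) (f : X → ℂ) (x : X) : ℂ := ∫ y, K x y * f y ∂μ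

/-- The composition of two kernels. -/
def kernelComp (μ : Measure X) (K L : X → X → ℂ) (x y : X) : ℂ := ∫ z, K x z * L z y ∂μ

/-- The adjoint kernel. -/
def kernelAdj (K : X → X → ℂ) (x y : X) : ℂ := conj (K y x)

variable {K L : X → X → ℂ}

lemma IsL2Kernel.measurable_row (hK : IsL2Kernel μ K) (x : X) : Measurable (K x) :=
  hK.measurable.comp measurable_prodMk_left

lemma IsL2Kernel.measurable_col (hK : IsL2Kernel μ K) (y : X) : Measurable fun x => K x y :=
  hK.measurable.comp measurable_prodMk_right

variable [SFinite μ]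

lemma hsSq_adj (hK : Measurable fun p : X × X => K p.1 p.2) :
    hsSq μ (kernelAdj K) = hsSq μ K := by
  unfold hsSq kernelAdj
  simp only [RCLike.enorm_conj]
  rw [lintegral_lintegral_swap]
  exact ((hK.comp measurable_swap).enorm.pow_const 2).aemeasurable

lemma IsL2Kernel.adj (hK : IsL2Kernel μ K) : IsL2Kernel μ (kernelAdj K) := by
  refine ⟨?_, ?_⟩
  · exact Complex.continuous_conj.measurable.comp (hK.measurable.comp measurable_swap)
  · rw [hsSq_adj hK.measurable]; exact hK.lt_top

lemma IsL2Kernel.ae_row (hK : IsL2Kernel μ K) : ∀ᵐ x ∂μ, MemLp (K x) 2 μ := by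
  have h1 : Measurable fun x => ∫⁻ y, ‖K x y‖ₑ ^ 2 ∂μ :=
    (hK.measurable.enorm.pow_const 2).lintegral_prod_right'
  filter_upwards [ae_lt_top h1 hK.lt_top.ne] with x hx
  exact memLp_two_of_lintegral_lt_top (hK.measurable_row x).aestronglyMeasurable hx

lemma IsL2Kernel.ae_col (hK : IsL2Kernel μ K) : ∀ᵐ y ∂μ, MemLp (fun x => K x y) 2 μ := by
  filter_upwards [hK.adj.ae_row] with y hy
  refine (hy.norm.congr_norm (hK.measurable_col y).aestronglyMeasurable ?_)
  exact Eventually.of_forall fun x => by simp [kernelAdj]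

lemma IsL2Kernel.lintegral_kernelApply_le (hK : IsL2Kernel μ K) {f : X → ℂ}
    (hf : AEStronglyMeasurable f μ) :
    ∫⁻ x, ‖kernelApply μ K f x‖ₑ ^ 2 ∂μ ≤ hsSq μ K * ∫⁻ x, ‖f x‖ₑ ^ 2 ∂μ := by
  have h1 : Measurable fun x => ∫⁻ y, ‖K x y‖ₑ ^ 2 ∂μ :=
    (hK.measurable.enorm.pow_const 2).lintegral_prod_right'
  rw [hsSq, ← lintegral_mul_const _ h1]
  exact lintegral_mono fun x =>
    sq_enorm_integral_mul_le (hK.measurable_row x).aestronglyMeasurable hf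

lemma IsL2Kernel.memLp_kernelApply (hK : IsL2Kernel μ K) {f : X → ℂ} (hf : MemLp f 2 μ) :
    MemLp (kernelApply μ K f) 2 μ := by
  refine memLp_two_of_lintegral_lt_top ?_ ?_
  · have h1 : AEStronglyMeasurable (fun p : X × X => K p.1 p.2 * f p.2) (μ.prod μ) :=
      hK.measurable.aestronglyMeasurable.mul hf.1.comp_snd
    exact h1.integral_prod_right'
  · exact (hK.lintegral_kernelApply_le hf.1).trans_lt
      (ENNReal.mul_lt_top hK.lt_top hf.lintegral_enorm_sq_lt_top)

/-- The Hilbert–Schmidt operator with a given kernel. -/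
def kernelOp (hK : IsL2Kernel μ K) : Lp ℂ 2 μ →L[ℂ] Lp ℂ 2 μ :=
  LinearMap.mkContinuous
    { toFun := fun f => (hK.memLp_kernelApply (Lp.memLp f)).toLp _
      map_add' := fun f g => by
        rw [← MemLp.toLp_add]
        refine MemLp.toLp_congr _ _ ?_
        filter_upwards [hK.ae_row] with x hx
        have h1 : kernelApply μ K (f + g : Lp ℂ 2 μ) x = ∫ y, K x y * (f y + g y) ∂μ := by
          refine integral_congr_ae ?_
          filter_upwards [Lp.coeFn_add f g] with y hy
          rw [hy, Pi.add_apply]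
        rw [h1, Pi.add_apply]
        simp only [mul_add]
        exact integral_add (hx.integrable_mul (Lp.memLp f)) (hx.integrable_mul (Lp.memLp g))
      map_smul' := fun c f => by
        rw [RingHom.id_apply, ← MemLp.toLp_const_smul]
        refine MemLp.toLp_congr _ _ (Eventually.of_forall fun x => ?_)
        have h1 : kernelApply μ K (c • f : Lp ℂ 2 μ) x = ∫ y, c * (K x y * f y) ∂μ := by
          refine integral_congr_ae ?_
          filter_upwards [Lp.coeFn_smul c f] with y hy
          rw [hy, Pi.smul_apply, smul_eq_mul]; ring
        rw [h1, integral_const_mul]; rfl }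
    √((hsSq μ K).toReal) fun f => by
      refine abs_le_of_sq_le_sq' ?_ (by positivity) |>.2
      rw [mul_pow, Real.sq_sqrt ENNReal.toReal_nonneg, norm_Lp_two_sq, norm_Lp_two_sq,
        ← ENNReal.toReal_mul]
      refine ENNReal.toReal_mono (ENNReal.mul_lt_top hK.lt_top
        (Lp.memLp f).lintegral_enorm_sq_lt_top).ne ?_
      refine le_of_eq_of_le ?_ (hK.lintegral_kernelApply_le (Lp.memLp f).1)
      refine lintegral_congr_ae ?_
      filter_upwards [MemLp.coeFn_toLp (hK.memLp_kernelApply (Lp.memLp f))] with x hx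
      exact congrArg (fun z => ‖z‖ₑ ^ 2) hx

lemma coeFn_kernelOp (hK : IsL2Kernel μ K) (f : Lp ℂ 2 μ) :
    kernelOp hK f =ᵐ[μ] kernelApply μ K f :=
  MemLp.coeFn_toLp (hK.memLp_kernelApply (Lp.memLp f))

lemma norm_kernelOp_le (hK : IsL2Kernel μ K) : ‖kernelOp hK‖ ≤ √((hsSq μ K).toReal) :=
  LinearMap.mkContinuous_norm_le _ (Real.sqrt_nonneg _) _

/-- Cauchy–Schwarz twice, once in each variable. It licenses Fubini in the composition and adjoint
formulas. -/
lemma IsL2Kernel.integrable_mul_mul (hK : IsL2Kernel μ K) {f g : X → ℂ} (hf : MemLp f 2 μ)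
    (hg : MemLp g 2 μ) : Integrable (fun p : X × X => f p.1 * K p.1 p.2 * g p.2) (μ.prod μ) := by
  have hm : AEStronglyMeasurable (fun p : X × X => f p.1 * K p.1 p.2 * g p.2) (μ.prod μ) :=
    (hf.1.comp_fst.mul hK.measurable.aestronglyMeasurable).mul hg.1.comp_snd
  refine ⟨hm, ?_⟩
  rw [HasFiniteIntegral, lintegral_prod _ hm.enorm]
  set a : X → ℝ≥0∞ := fun z => ∫⁻ y, ‖K z y‖ₑ * ‖g y‖ₑ ∂μ with ha
  have ham : AEMeasurable a μ :=
    (hK.measurable.enorm.aemeasurable.mul hg.1.comp_snd.enorm).lintegral_prod_right'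
  have h1 : ∀ z, ∫⁻ y, ‖f z * K z y * g y‖ₑ ∂μ = ‖f z‖ₑ * a z := by
    intro z
    rw [ha, ← lintegral_const_mul' _ _ enorm_ne_top]
    simp [mul_assoc]
  have h2 : ∫⁻ z, a z ^ 2 ∂μ ≤ hsSq μ K * ∫⁻ y, ‖g y‖ₑ ^ 2 ∂μ := by
    have h3 : Measurable fun x => ∫⁻ y, ‖K x y‖ₑ ^ 2 ∂μ :=
      (hK.measurable.enorm.pow_const 2).lintegral_prod_right'
    rw [hsSq, ← lintegral_mul_const _ h3]
    exact lintegral_mono fun z => sq_lintegral_mul_le (hK.measurable_row z).enorm.aemeasurable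
      hg.1.enorm
  have h4 : (∫⁻ z, ‖f z‖ₑ * a z ∂μ) ^ 2 < ⊤ := by
    refine (sq_lintegral_mul_le hf.1.enorm ham).trans_lt
      (ENNReal.mul_lt_top hf.lintegral_enorm_sq_lt_top (h2.trans_lt ?_))
    exact ENNReal.mul_lt_top hK.lt_top hg.lintegral_enorm_sq_lt_top
  simp only [h1]
  exact (ENNReal.pow_lt_top_iff.mp h4).resolve_right two_ne_zero

/-- Cauchy–Schwarz in the intermediate variable separates the integrand into a function of x times a
function of y. -/
lemma hsSq_kernelComp_le (hK : IsL2Kernel μ K) (hL : IsL2Kernel μ L) :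
    hsSq μ (kernelComp μ K L) ≤ hsSq μ K * hsSq μ L := by
  have h1 : ∀ x y, ‖kernelComp μ K L x y‖ₑ ^ 2 ≤
      (∫⁻ z, ‖K x z‖ₑ ^ 2 ∂μ) * ∫⁻ z, ‖kernelAdj L y z‖ₑ ^ 2 ∂μ := by
    intro x y
    refine (sq_enorm_integral_mul_le (hK.measurable_row x).aestronglyMeasurable
      (hL.measurable_col y).aestronglyMeasurable).trans ?_
    simp [kernelAdj]
  calc hsSq μ (kernelComp μ K L) ≤ ∫⁻ x, ∫⁻ y, (∫⁻ z, ‖K x z‖ₑ ^ 2 ∂μ) *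
        ∫⁻ z, ‖kernelAdj L y z‖ₑ ^ 2 ∂μ ∂μ ∂μ :=
        lintegral_mono fun x => lintegral_mono fun y => h1 x y
    _ = hsSq μ K * hsSq μ (kernelAdj L) := by
        have h3 : ∀ {K : X → X → ℂ}, IsL2Kernel μ K →
            Measurable fun x => ∫⁻ y, ‖K x y‖ₑ ^ 2 ∂μ := fun hK =>
          (hK.measurable.enorm.pow_const 2).lintegral_prod_right'
        simp only [lintegral_const_mul _ (h3 hL.adj)]
        exact lintegral_mul_const _ (h3 hK)
    _ = _ := by rw [hsSq_adj hL.measurable]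

lemma IsL2Kernel.comp (hK : IsL2Kernel μ K) (hL : IsL2Kernel μ L) :
    IsL2Kernel μ (kernelComp μ K L) := by
  refine ⟨?_, (hsSq_kernelComp_le hK hL).trans_lt (ENNReal.mul_lt_top hK.lt_top hL.lt_top)⟩
  have h1 : Measurable fun q : (X × X) × X => K q.1.1 q.2 * L q.2 q.1.2 :=
    (hK.measurable.comp ((measurable_fst.comp measurable_fst).prodMk measurable_snd)).mul
      (hL.measurable.comp (measurable_snd.prodMk (measurable_snd.comp measurable_fst)))
  exact (h1.stronglyMeasurable.integral_prod_right').measurable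

lemma kernelApply_kernelComp (hK : IsL2Kernel μ K) (hL : IsL2Kernel μ L) {f : X → ℂ}
    (hf : MemLp f 2 μ) :
    kernelApply μ (kernelComp μ K L) f =ᵐ[μ] kernelApply μ K (kernelApply μ L f) := by
  filter_upwards [hK.ae_row] with x hx
  have hint := hL.integrable_mul_mul hx hf
  calc kernelApply μ (kernelComp μ K L) f x = ∫ y, ∫ z, K x z * L z y * f y ∂μ ∂μ := by
        refine integral_congr_ae (Eventually.of_forall fun y => ?_)
        exact (integral_mul_const _ _).symm
    _ = ∫ z, ∫ y, K x z * L z y * f y ∂μ ∂μ :=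
        (integral_integral_swap (f := fun z y => K x z * L z y * f y) hint).symm
    _ = _ := by
        refine integral_congr_ae (Eventually.of_forall fun z => ?_)
        simp only [mul_assoc]
        exact integral_const_mul _ _

omit [SFinite μ] in
lemma kernelApply_congr {f g : X → ℂ} (h : f =ᵐ[μ] g) : kernelApply μ K f = kernelApply μ K g := by
  ext x
  refine integral_congr_ae ?_
  filter_upwards [h] with y hy
  rw [hy]

lemma kernelOp_comp (hK : IsL2Kernel μ K) (hL : IsL2Kernel μ L) :
    kernelOp (hK.comp hL) = kernelOp hK * kernelOp hL := by
  ext1 f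
  refine Lp.ext ?_
  rw [mul_apply_eq_comp]
  refine (coeFn_kernelOp _ f).trans ((kernelApply_kernelComp hK hL (Lp.memLp f)).trans ?_)
  rw [← kernelApply_congr (coeFn_kernelOp hL f)]
  exact (coeFn_kernelOp hK _).symm

lemma adjoint_kernelOp (hK : IsL2Kernel μ K) :
    ContinuousLinearMap.adjoint (kernelOp hK) = kernelOp hK.adj := by
  symm
  rw [ContinuousLinearMap.eq_adjoint_iff]
  intro f g
  rw [L2.inner_def, L2.inner_def]
  have hf := (Lp.memLp f).star
  have hint := hK.integrable_mul_mul hf (Lp.memLp g)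
  calc ∫ x, inner ℂ (kernelOp hK.adj f x) (g x) ∂μ
      = ∫ x, ∫ y, conj (f y) * K y x * g x ∂μ ∂μ := by
        refine integral_congr_ae ?_
        filter_upwards [coeFn_kernelOp hK.adj f] with x hx
        rw [hx, RCLike.inner_apply, kernelApply, ← integral_conj, ← integral_const_mul]
        refine integral_congr_ae (Eventually.of_forall fun y => ?_)
        simp [kernelAdj]
        ring
    _ = ∫ y, ∫ x, conj (f y) * K y x * g x ∂μ ∂μ :=
        (integral_integral_swap (f := fun y x => conj (f y) * K y x * g x) hint).symm
    _ = _ := by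
        refine integral_congr_ae ?_
        filter_upwards [coeFn_kernelOp hK g] with y hy
        rw [hy, RCLike.inner_apply, kernelApply, mul_comm, ← integral_const_mul]
        simp only [mul_assoc]

/-- The trace of a product of two kernels. -/
def kernelTrace (μ : Measure X) (K L : X → X → ℂ) : ℂ := ∫ x, ∫ z, K x z * L z x ∂μ ∂μ

lemma IsL2Kernel.memLp_prod (hK : IsL2Kernel μ K) :
    MemLp (fun p : X × X => K p.1 p.2) 2 (μ.prod μ) := by
  refine memLp_two_of_lintegral_lt_top hK.measurable.aestronglyMeasurable ?_
  rw [lintegral_prod _ (hK.measurable.enorm.pow_const 2).aemeasurable]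
  exact hK.lt_top

lemma integrable_mul_swap (hK : IsL2Kernel μ K) (hL : IsL2Kernel μ L) :
    Integrable (fun p : X × X => K p.1 p.2 * L p.2 p.1) (μ.prod μ) := by
  refine hK.memLp_prod.integrable_mul ((hL.adj.memLp_prod).congr_norm ?_ ?_)
  · exact (hL.measurable.comp measurable_swap).aestronglyMeasurable
  · exact Eventually.of_forall fun p => by simp [kernelAdj]

/-- Distinct basis vectors lie at distance √2, so balls of radius 1/2 around them are disjoint.
Countability is needed to interchange sums over the basis with integrals and almost-everywhere
statements. -/
lemma _root_.HilbertBasis.countable {H : Type*} [NormedAddCommGroup H] [InnerProductSpace ℂ H]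
    [TopologicalSpace.SeparableSpace H] {ι : Type*} (b : HilbertBasis ι ℂ H) : Countable ι := by
  classical
  refine Pairwise.countable_of_isOpen_disjoint (s := fun i => Metric.ball (b i) (1 / 2)) ?_
    (fun i => Metric.isOpen_ball) (fun i => ⟨b i, by simp⟩)
  intro i j hij
  refine Metric.ball_disjoint_ball ?_
  have h1 : ‖b i - b j‖ * ‖b i - b j‖ = 2 := by
    rw [@norm_sub_mul_self ℂ, hilbertBasis_inner, if_neg hij, b.orthonormal.1, b.orthonormal.1]
    norm_num
  rw [dist_eq_norm]
  nlinarith [norm_nonneg (b i - b j)]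

omit [SFinite μ] in
lemma inner_toLp_eq {u : X → ℂ} (hu : MemLp u 2 μ) (f : Lp ℂ 2 μ) :
    inner ℂ (hu.toLp u) f = ∫ x, conj (u x) * f x ∂μ := by
  rw [L2.inner_def]
  refine integral_congr_ae ?_
  filter_upwards [hu.coeFn_toLp] with x hx
  rw [hx, RCLike.inner_apply, mul_comm]

omit [SFinite μ] in
lemma inner_toLp_right_eq {u : X → ℂ} (hu : MemLp u 2 μ) (f : Lp ℂ 2 μ) :
    inner ℂ f (hu.toLp u) = ∫ x, u x * conj (f x) ∂μ := by
  rw [L2.inner_def]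
  refine integral_congr_ae ?_
  filter_upwards [hu.coeFn_toLp] with x hx
  rw [hx, RCLike.inner_apply]

variable [MeasurableSpace.CountablyGenerated X] {ι : Type*} (b : HilbertBasis ι ℂ (Lp ℂ 2 μ))

/-- Parseval's identity for the Hilbert–Schmidt norm. -/
lemma hasSum_norm_kernelOp_sq (hK : IsL2Kernel μ K) :
    HasSum (fun i => ‖kernelOp hK (b i)‖ ^ 2) (hsSq μ K).toReal := by
  have : Fact ((2 : ℝ≥0∞) ≠ ⊤) := ⟨ENNReal.ofNat_ne_top⟩
  have : Countable ι := b.countable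
  have h1 : ∑' i, ∫⁻ x, ‖kernelApply μ K (b i) x‖ₑ ^ 2 ∂μ = hsSq μ K := by
    rw [← lintegral_tsum fun i => (hK.memLp_kernelApply (Lp.memLp (b i))).1.enorm.pow_const 2]
    refine lintegral_congr_ae ?_
    filter_upwards [hK.ae_row] with x hx
    -- For almost every x, the numbers (K b_i)(x) are inner products of the conjugated row of K with
    -- the basis; Parseval sums their squares, and integrating over x gives the claim.
    have hx' := hx.star
    have h2 : ∀ i, kernelApply μ K (b i) x = inner ℂ (hx'.toLp _) (b i) := fun i => by
      rw [inner_toLp_eq]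
      simp [kernelApply]
    have h3 : HasSum (fun i => ‖kernelApply μ K (b i) x‖ ^ 2) (‖hx'.toLp _‖ ^ 2) := by
      have h4 := Complex.hasSum_re (b.hasSum_inner_mul_inner (hx'.toLp _) (hx'.toLp _))
      rw [← inner_self_eq_norm_sq (𝕜 := ℂ)]
      refine h4.congr_fun fun i => ?_
      rw [h2, ← inner_conj_symm (b i), Complex.mul_conj']
      norm_cast
    have h5 : ∀ i, ‖kernelApply μ K (b i) x‖ₑ ^ 2 =
        ENNReal.ofReal (‖kernelApply μ K (b i) x‖ ^ 2) := fun i => by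
      rw [ENNReal.ofReal_pow (norm_nonneg _), ofReal_norm]
    simp only [h5]
    rw [← ENNReal.ofReal_tsum_of_nonneg (fun i => by positivity) h3.summable, h3.tsum_eq,
      norm_Lp_two_sq, ENNReal.ofReal_toReal (Lp.memLp _).lintegral_enorm_sq_lt_top.ne]
    refine lintegral_congr_ae ?_
    filter_upwards [hx'.coeFn_toLp] with y hy
    rw [hy]
    simp
  have h6 : ∀ i, ‖kernelOp hK (b i)‖ ^ 2 =
      (∫⁻ x, ‖kernelApply μ K (b i) x‖ₑ ^ 2 ∂μ).toReal := fun i => by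
    rw [norm_Lp_two_sq]
    congr 1
    refine lintegral_congr_ae ?_
    filter_upwards [coeFn_kernelOp hK (b i)] with x hx
    rw [hx]
  simp only [h6]
  have h7 : ∀ i, ∫⁻ x, ‖kernelApply μ K (b i) x‖ₑ ^ 2 ∂μ ≠ ⊤ := fun i =>
    (hK.memLp_kernelApply (Lp.memLp (b i))).lintegral_enorm_sq_lt_top.ne
  rw [← h1, ENNReal.tsum_toReal_eq h7]
  exact (ENNReal.summable_toReal (h1.symm ▸ hK.lt_top.ne)).hasSum

/-- The trace of a product of two Hilbert–Schmidt operators. -/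
lemma tsum_inner_kernelOp (hK : IsL2Kernel μ K) (hL : IsL2Kernel μ L) :
    ∑' i, inner ℂ (b i) (kernelOp hK (kernelOp hL (b i))) = kernelTrace μ K L := by
  have : Fact ((2 : ℝ≥0∞) ≠ ⊤) := ⟨ENNReal.ofNat_ne_top⟩
  have : Countable ι := b.countable
  -- Moving K to the left as its adjoint writes each term as an integral of F i, whose L¹ norm is at
  -- most ‖K*b_i‖² + ‖Lb_i‖². This is summable over the basis, so the sum can be taken under the
  -- integral.
  set F : ι → X → ℂ := fun i z => inner ℂ (kernelOp hK.adj (b i) z) (kernelOp hL (b i) z) with hF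
  have h1 : ∀ i, inner ℂ (b i) (kernelOp hK (kernelOp hL (b i))) = ∫ z, F i z ∂μ := fun i => by
    rw [← ContinuousLinearMap.adjoint_inner_left, adjoint_kernelOp, L2.inner_def]
  have hFi : ∀ i, Integrable (F i) μ := fun i => L2.integrable_inner _ _
  have hn : ∀ i, ∫ z, ‖F i z‖ ∂μ ≤ ‖kernelOp hK.adj (b i)‖ ^ 2 + ‖kernelOp hL (b i)‖ ^ 2 := by
    intro i
    have h2 : ∀ f : Lp ℂ 2 μ, Integrable (fun z => ‖f z‖ ^ 2) μ ∧ ∫ z, ‖f z‖ ^ 2 ∂μ = ‖f‖ ^ 2 := by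
      intro f
      refine ⟨(memLp_two_iff_integrable_sq_norm (Lp.memLp f).1).mp (Lp.memLp f), ?_⟩
      rw [norm_Lp_two_sq, integral_eq_lintegral_of_nonneg_ae (f := fun z => ‖f z‖ ^ 2)
        (Eventually.of_forall fun z => by positivity) ((Lp.memLp f).1.norm.pow 2)]
      congr 1
      refine lintegral_congr fun z => ?_
      rw [ENNReal.ofReal_pow (norm_nonneg _), ofReal_norm]
    rw [← (h2 _).2, ← (h2 (kernelOp hL (b i))).2, ← integral_add (h2 _).1 (h2 _).1]
    refine integral_mono (hFi i).norm ((h2 _).1.add (h2 _).1) fun z => ?_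
    refine (norm_inner_le_norm _ _).trans ?_
    nlinarith [sq_nonneg (‖kernelOp hK.adj (b i) z‖ - ‖kernelOp hL (b i) z‖),
      sq_nonneg ‖kernelOp hK.adj (b i) z‖, sq_nonneg ‖kernelOp hL (b i) z‖]
  have hs : Summable fun i => ∫ z, ‖F i z‖ ∂μ :=
    Summable.of_nonneg_of_le (fun i => integral_nonneg fun z => norm_nonneg _) hn
      ((hasSum_norm_kernelOp_sq b hK.adj).summable.add (hasSum_norm_kernelOp_sq b hL).summable)
  simp only [h1]
  rw [(hasSum_integral_of_summable_integral_norm hFi hs).tsum_eq]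
  have h3 : kernelTrace μ K L = ∫ z, ∫ x, K x z * L z x ∂μ ∂μ :=
    integral_integral_swap (f := fun x z => K x z * L z x) (integrable_mul_swap hK hL)
  rw [h3]
  refine integral_congr_ae ?_
  have h4 : ∀ᵐ z ∂μ, ∀ i, kernelOp hK.adj (b i) z = kernelApply μ (kernelAdj K) (b i) z ∧
      kernelOp hL (b i) z = kernelApply μ L (b i) z := by
    rw [ae_all_iff]
    intro i
    filter_upwards [coeFn_kernelOp hK.adj (b i), coeFn_kernelOp hL (b i)] with z h5 h6
    exact ⟨h5, h6⟩
  filter_upwards [h4, hK.ae_col, hL.ae_row] with z hz hKz hLz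
  have hLz' := hLz.star
  -- For fixed z, summing F i z over the basis is Parseval's identity between the conjugated row
  -- L(z,·) and the column K(·,z).
  have h5 := (b.hasSum_inner_mul_inner (hLz'.toLp _) (hKz.toLp _)).tsum_eq
  rw [inner_toLp_eq] at h5
  have h6 : ∫ x, K x z * L z x ∂μ = ∫ x, conj ((star (L z)) x) * (hKz.toLp _ : Lp ℂ 2 μ) x ∂μ := by
    refine integral_congr_ae ?_
    filter_upwards [hKz.coeFn_toLp] with x hx
    rw [hx]
    simp [mul_comm]
  rw [h6, ← h5]
  refine tsum_congr fun i => ?_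
  rw [hF]
  dsimp only
  rw [(hz i).1, (hz i).2, RCLike.inner_apply, inner_toLp_eq, inner_toLp_right_eq]
  congr 1
  · simp [kernelApply]
  · rw [kernelApply, ← integral_conj]
    simp [kernelAdj]

end Kernel

/-! ### Iterated kernels, the Fredholm–Smithies denominator and its continuity -/

section Kernel

open scoped ENNReal ComplexConjugate

variable {X : Type*} [MeasurableSpace X] {μ : Measure X} {K L : X → X → ℂ}

/-- The kernel of the `(n+1)`-st power, with respect to the measure `μ`. -/
def iterKernel (μ : Measure X) (K : X → X → ℂ) : ℕ → X → X → ℂ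
  | 0 => K
  | n + 1 => kernelComp μ (iterKernel μ K n) K

/-- The trace of the `n`-th power of the operator with kernel `K` (for `n ≥ 2`). -/
def powTrace (μ : Measure X) (K : X → X → ℂ) (n : ℕ) : ℂ := ∫ x, iterKernel μ K (n - 1) x x ∂μ

/-- The Fredholm–Smithies denominator of a kernel. -/
def fredholmDenominator (μ : Measure X) (K : X → X → ℂ) (g : ℂ) : ℂ :=
  ∑' n, smithiesCoeff (powTrace μ K) n * g ^ n

lemma powTrace_add_two (n : ℕ) : powTrace μ K (n + 2) = kernelTrace μ (iterKernel μ K n) K := rfl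

variable [SFinite μ]

lemma IsL2Kernel.iter (hK : IsL2Kernel μ K) (n : ℕ) : IsL2Kernel μ (iterKernel μ K n) := by
  induction n with
  | zero => exact hK
  | succ n ih => exact ih.comp hK

lemma kernelOp_iter (hK : IsL2Kernel μ K) (n : ℕ) :
    kernelOp (hK.iter n) = kernelOp hK ^ (n + 1) := by
  induction n with
  | zero => rw [zero_add, pow_one]; rfl
  | succ n ih => rw [pow_succ, ← ih]; exact kernelOp_comp (hK.iter n) hK

lemma IsL2Kernel.hasTraces [MeasurableSpace.CountablyGenerated X] (hK : IsL2Kernel μ K) :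
    HasTraces (kernelOp hK) (hsSq μ K).toReal (powTrace μ K) where
  hasSum w b := hasSum_norm_kernelOp_sq b hK
  summable_adjoint w b := by
    rw [adjoint_kernelOp]
    exact (hasSum_norm_kernelOp_sq b hK.adj).summable
  trace w b n := by
    rw [powTrace_add_two, ← tsum_inner_kernelOp b (hK.iter n) hK, kernelOp_iter]
    · simp only [pow_succ, mul_apply_eq_comp]
    · exact hK

/-- If the Fredholm–Smithies denominator does not vanish, then `1 - g K` is invertible. -/
lemma IsL2Kernel.isUnit_one_sub [MeasurableSpace.CountablyGenerated X] (hK : IsL2Kernel μ K)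
    {g : ℂ} (hg : fredholmDenominator μ K g ≠ 0) : IsUnit (1 - g • kernelOp hK) :=
  hK.hasTraces.isUnit_one_sub hg

/-- The coefficient bound with r = 4|g| gives |a_n| ≤ e^{1/2}4⁻ⁿ. The terms with n ≥ 1 then add up
to at most e^{1/2}/3 < 1 and cannot cancel the leading 1. -/
lemma fredholmDenominator_ne_zero [MeasurableSpace.CountablyGenerated X]
    (hK : IsL2Kernel μ K) {g : ℂ} (h : ‖g‖ ^ 2 * (hsSq μ K).toReal ≤ 1 / 16) :
    fredholmDenominator μ K g ≠ 0 := by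
  set a : ℕ → ℂ := fun n => smithiesCoeff (powTrace μ K) n * g ^ n with ha
  have hb : ∀ n, ‖a n‖ ≤ Real.exp (1 / 2) * (1 / 4) ^ n := by
    intro n
    have h1 := hK.hasTraces.norm_smithiesCoeff_le (r := 4 * ‖g‖) (by positivity) n
    have h2 : Real.exp ((4 * ‖g‖) ^ 2 * (hsSq μ K).toReal / 2) ≤ Real.exp (1 / 2) := by
      refine Real.exp_le_exp.mpr ?_
      linarith
    have h3 : (4 : ℝ) ^ n * (1 / 4) ^ n = 1 := by rw [← mul_pow]; norm_num
    rw [mul_pow] at h1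
    rw [ha, norm_mul, norm_pow]
    calc _ = ‖smithiesCoeff (powTrace μ K) n‖ * (4 ^ n * ‖g‖ ^ n) * (1 / 4) ^ n := by
          linear_combination (-(‖smithiesCoeff (powTrace μ K) n‖ * ‖g‖ ^ n)) * h3
      _ ≤ _ := by gcongr; exact h1.trans h2
  have hgeo : Summable fun n : ℕ => Real.exp (1 / 2) * (1 / 4 : ℝ) ^ n :=
    (summable_geometric_of_lt_one (by norm_num) (by norm_num)).mul_left _
  have hs : Summable a := Summable.of_norm_bounded hgeo hb
  have h1 : fredholmDenominator μ K g = 1 + ∑' n, a (n + 1) := by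
    rw [fredholmDenominator, hs.tsum_eq_zero_add]
    simp [ha]
  have h2 : ‖∑' n, a (n + 1)‖ ≤ Real.exp (1 / 2) / 3 := by
    have h3 : HasSum (fun n : ℕ => Real.exp (1 / 2) * (1 / 4 : ℝ) ^ (n + 1))
        (Real.exp (1 / 2) / 3) := by
      have h4 := (hasSum_geometric_of_lt_one (r := (1 / 4 : ℝ)) (by norm_num)
        (by norm_num)).mul_left (Real.exp (1 / 2) * (1 / 4))
      rw [show Real.exp (1 / 2) / 3 = Real.exp (1 / 2) * (1 / 4) * (1 - 1 / 4)⁻¹ by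
        norm_num; ring]
      exact h4.congr_fun fun n => by rw [pow_succ]; ring
    exact tsum_of_norm_bounded h3 fun n => hb (n + 1)
  have h3 : Real.exp (1 / 2) < 3 := by
    calc Real.exp (1 / 2) ≤ Real.exp 1 := Real.exp_le_exp.mpr (by norm_num)
      _ < 3 := by linarith [Real.exp_one_lt_d9]
  intro h0
  rw [h1] at h0
  have h4 : ‖∑' n, a (n + 1)‖ = 1 := by
    rw [show ∑' n, a (n + 1) = -1 by linear_combination h0]; simp
  linarith

/-- Dominated convergence of kernels. -/
structure DominatedConvergence (μ : Measure X) (A : ℕ → X → X → ℂ) (A₀ B : X → X → ℂ) : Prop where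
  isL2 : ∀ j, IsL2Kernel μ (A j)
  isL2_lim : IsL2Kernel μ A₀
  isL2_bound : IsL2Kernel μ B
  ae : ∀ᵐ p ∂μ.prod μ, (∀ j, ‖A j p.1 p.2‖ ≤ ‖B p.1 p.2‖) ∧
    Tendsto (fun j => A j p.1 p.2) atTop (𝓝 (A₀ p.1 p.2))

variable {A C : ℕ → X → X → ℂ} {A₀ B C₀ D : X → X → ℂ}

omit [SFinite μ] in
lemma IsL2Kernel.norm (hK : IsL2Kernel μ K) : IsL2Kernel μ fun x y => (‖K x y‖ : ℂ) := by
  refine ⟨Complex.measurable_ofReal.comp hK.measurable.norm, ?_⟩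
  have := hK.lt_top
  simpa [hsSq, ← ofReal_norm] using this

lemma ae_prod_swap {p : X × X → Prop} (h : ∀ᵐ z ∂μ.prod μ, p z) :
    ∀ᵐ z ∂μ.prod μ, p z.swap := by
  rw [← Measure.prod_swap] at h
  exact ae_of_ae_map measurable_swap.aemeasurable h

/-- For almost every (x,y) the row of B at x and the column of D at y are square integrable, so
their product dominates the inner integral. The new majorant composes absolute values, since B and D
themselves might cancel. -/
lemma DominatedConvergence.comp (hA : DominatedConvergence μ A A₀ B)
    (hC : DominatedConvergence μ C C₀ D) :
    DominatedConvergence μ (fun j => kernelComp μ (A j) (C j)) (kernelComp μ A₀ C₀)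
      (kernelComp μ (fun x y => (‖B x y‖ : ℂ)) (fun x y => (‖D x y‖ : ℂ))) := by
  refine ⟨fun j => (hA.isL2 j).comp (hC.isL2 j), hA.isL2_lim.comp hC.isL2_lim,
    hA.isL2_bound.norm.comp hC.isL2_bound.norm, ?_⟩
  have h1 := Measure.ae_ae_of_ae_prod hA.ae
  have h2 := Measure.ae_ae_of_ae_prod (ae_prod_swap hC.ae)
  have h3 := Measure.quasiMeasurePreserving_fst (μ := μ) (ν := μ) |>.ae (h1.and hA.isL2_bound.ae_row)
  have h4 := Measure.quasiMeasurePreserving_snd (μ := μ) (ν := μ) |>.ae (h2.and hC.isL2_bound.ae_col)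
  filter_upwards [h3, h4] with p ⟨hp1, hp2⟩ ⟨hp3, hp4⟩
  have hint : Integrable (fun z => ‖B p.1 z‖ * ‖D z p.2‖) μ := hp2.norm.integrable_mul hp4.norm
  have hb : ∀ j, ∀ᵐ z ∂μ, ‖A j p.1 z * C j z p.2‖ ≤ ‖B p.1 z‖ * ‖D z p.2‖ := by
    intro j
    filter_upwards [hp1, hp3] with z hz1 hz2
    rw [norm_mul]
    exact mul_le_mul (hz1.1 j) (hz2.1 j) (norm_nonneg _) (norm_nonneg _)
  refine ⟨fun j => ?_, ?_⟩
  · have h5 : kernelComp μ (fun x y => (‖B x y‖ : ℂ)) (fun x y => (‖D x y‖ : ℂ)) p.1 p.2 =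
        ((∫ z, ‖B p.1 z‖ * ‖D z p.2‖ ∂μ : ℝ) : ℂ) := by
      rw [kernelComp, ← integral_complex_ofReal]
      simp
    rw [h5, Complex.norm_real, Real.norm_of_nonneg (integral_nonneg fun z => by positivity)]
    exact norm_integral_le_of_norm_le hint (hb j)
  · refine tendsto_integral_of_dominated_convergence _ (fun j => ?_) hint hb ?_
    · exact (((hA.isL2 j).measurable_row _).mul ((hC.isL2 j).measurable_col _)).aestronglyMeasurable
    · filter_upwards [hp1, hp3] with z hz1 hz2
      exact hz1.2.mul hz2.2

lemma DominatedConvergence.iter (hA : DominatedConvergence μ A A₀ B) (n : ℕ) :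
    ∃ D, DominatedConvergence μ (fun j => iterKernel μ (A j) n) (iterKernel μ A₀ n) D := by
  induction n with
  | zero => exact ⟨B, hA⟩
  | succ n ih =>
    obtain ⟨D, hD⟩ := ih
    exact ⟨_, hD.comp hA⟩

lemma kernelTrace_eq_integral_prod (hK : IsL2Kernel μ K) (hL : IsL2Kernel μ L) :
    kernelTrace μ K L = ∫ p, K p.1 p.2 * L p.2 p.1 ∂μ.prod μ :=
  (integral_prod _ (integrable_mul_swap hK hL)).symm

lemma DominatedConvergence.tendsto_kernelTrace (hA : DominatedConvergence μ A A₀ B)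
    (hC : DominatedConvergence μ C C₀ D) :
    Tendsto (fun j => kernelTrace μ (A j) (C j)) atTop (𝓝 (kernelTrace μ A₀ C₀)) := by
  simp only [kernelTrace_eq_integral_prod hA.isL2_lim hC.isL2_lim,
    fun j => kernelTrace_eq_integral_prod (hA.isL2 j) (hC.isL2 j)]
  refine tendsto_integral_of_dominated_convergence
    (fun p => ‖B p.1 p.2 * D p.2 p.1‖) (fun j => ?_)
    (integrable_mul_swap hA.isL2_bound hC.isL2_bound).norm (fun j => ?_) ?_
  · exact (integrable_mul_swap (hA.isL2 j) (hC.isL2 j)).1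
  · filter_upwards [hA.ae, ae_prod_swap hC.ae] with p h1 h2
    rw [norm_mul, norm_mul]
    exact mul_le_mul (h1.1 j) (h2.1 j) (norm_nonneg _) (norm_nonneg _)
  · filter_upwards [hA.ae, ae_prod_swap hC.ae] with p h1 h2
    exact h1.2.mul h2.2

lemma DominatedConvergence.hsSq_le (hA : DominatedConvergence μ A A₀ B) (j : ℕ) :
    hsSq μ (A j) ≤ hsSq μ B := by
  refine lintegral_mono_ae ?_
  filter_upwards [Measure.ae_ae_of_ae_prod hA.ae] with x hx
  refine lintegral_mono_ae ?_
  filter_upwards [hx] with y hy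
  gcongr
  exact enorm_le_iff_norm_le.mpr (hy.1 j)

/-- Each coefficient is a polynomial in finitely many convergent traces, and all are bounded
uniformly in j through the Hilbert–Schmidt norm of the majorant; dominated convergence then applies
to the series. -/
lemma DominatedConvergence.tendsto_fredholmDenominator [MeasurableSpace.CountablyGenerated X]
    (hA : DominatedConvergence μ A A₀ B) (g : ℂ) :
    Tendsto (fun j => fredholmDenominator μ (A j) g) atTop (𝓝 (fredholmDenominator μ A₀ g)) := by
  have hlim : ∀ n, Tendsto (fun j => smithiesCoeff (powTrace μ (A j)) n) atTop
      (𝓝 (smithiesCoeff (powTrace μ A₀) n)) := by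
    intro n
    have h1 : ∀ σ : ℕ → ℂ,
        smithiesCoeff σ n = smithiesCoeff (fun p => if 2 ≤ p then σ p else 0) n :=
      fun σ => smithiesCoeff_congr (fun p hp => by simp [hp]) n
    rw [h1 (powTrace μ A₀)]
    simp only [fun j => h1 (powTrace μ (A j))]
    refine ((continuous_smithiesCoeff n).tendsto _).comp (tendsto_pi_nhds.mpr fun p => ?_)
    by_cases hp : 2 ≤ p
    · obtain ⟨q, rfl⟩ : ∃ q, p = q + 2 := ⟨p - 2, by omega⟩
      simp only [hp, if_true, powTrace_add_two]
      obtain ⟨D, hD⟩ := hA.iter q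
      exact hD.tendsto_kernelTrace hA
    · simp only [hp, if_false]
      exact tendsto_const_nhds
  have hbd : ∀ j n, ‖smithiesCoeff (powTrace μ (A j)) n‖ * (2 * ‖g‖) ^ n ≤
      Real.exp ((2 * ‖g‖) ^ 2 * (hsSq μ B).toReal / 2) := by
    intro j n
    refine ((hA.isL2 j).hasTraces.norm_smithiesCoeff_le (by positivity) n).trans ?_
    have := ENNReal.toReal_mono hA.isL2_bound.lt_top.ne (hA.hsSq_le j)
    gcongr
  exact tendsto_tsum_of_dominated_convergence
    ((summable_geometric_of_lt_one (by norm_num) (by norm_num : (1 / 2 : ℝ) < 1)).mul_left _)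
    (fun n => (hlim n).mul_const _)
    (Eventually.of_forall fun j n => norm_mul_pow_le_geometric (hbd j n))

lemma IsL2Kernel.sub (hK : IsL2Kernel μ K) (hL : IsL2Kernel μ L) :
    IsL2Kernel μ fun x y => K x y - L x y := by
  refine ⟨hK.measurable.sub hL.measurable, ?_⟩
  have h := (hK.memLp_prod.sub hL.memLp_prod).lintegral_enorm_sq_lt_top
  rwa [lintegral_prod] at h
  exact ((hK.measurable.sub hL.measurable).enorm.pow_const 2).aemeasurable

lemma kernelOp_sub (hK : IsL2Kernel μ K) (hL : IsL2Kernel μ L) :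
    kernelOp (hK.sub hL) = kernelOp hK - kernelOp hL := by
  ext1 f
  refine Lp.ext ?_
  rw [sub_apply]
  filter_upwards [coeFn_kernelOp (hK.sub hL) f, coeFn_kernelOp hK f, coeFn_kernelOp hL f,
    Lp.coeFn_sub (kernelOp hK f) (kernelOp hL f), hK.ae_row, hL.ae_row] with x h1 h2 h3 h4 h5 h6
  rw [h1, h4, Pi.sub_apply, h2, h3, kernelApply, kernelApply, kernelApply]
  simp only [sub_mul]
  exact integral_sub (h5.integrable_mul (Lp.memLp f)) (h6.integrable_mul (Lp.memLp f))

/-- The kernels converge in L² of the product, with majorant (2|B|)², and the Hilbert–Schmidt norm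
dominates the operator norm. -/
lemma DominatedConvergence.tendsto_kernelOp (hA : DominatedConvergence μ A A₀ B) :
    Tendsto (fun j => kernelOp (hA.isL2 j)) atTop (𝓝 (kernelOp hA.isL2_lim)) := by
  have h1 : Tendsto (fun j => ∫⁻ p, ‖A j p.1 p.2 - A₀ p.1 p.2‖ₑ ^ 2 ∂μ.prod μ) atTop (𝓝 0) := by
    rw [← lintegral_zero (μ := μ.prod μ)]
    refine tendsto_lintegral_of_dominated_convergence
      (fun p => (2 * ‖B p.1 p.2‖ₑ) ^ 2) (fun j => ?_) (fun j => ?_) ?_ ?_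
    · exact ((hA.isL2 j).measurable.sub hA.isL2_lim.measurable).enorm.pow_const 2
    · filter_upwards [hA.ae] with p hp
      have h2 : ‖A₀ p.1 p.2‖ ≤ ‖B p.1 p.2‖ :=
        le_of_tendsto hp.2.norm (Eventually.of_forall hp.1)
      gcongr
      rw [two_mul]
      refine (enorm_sub_le).trans (add_le_add ?_ ?_)
      · exact enorm_le_iff_norm_le.mpr (hp.1 j)
      · exact enorm_le_iff_norm_le.mpr h2
    · simp only [mul_pow]
      rw [lintegral_const_mul' _ _ (by simp)]
      exact (ENNReal.mul_lt_top (by simp) hA.isL2_bound.memLp_prod.lintegral_enorm_sq_lt_top).ne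
    · filter_upwards [hA.ae] with p hp
      have h2 := (ENNReal.continuous_pow 2).tendsto _ |>.comp
        (hp.2.sub_const (A₀ p.1 p.2)).enorm
      simpa [Function.comp_def] using h2
  have h2 : ∀ j, ∫⁻ p, ‖A j p.1 p.2 - A₀ p.1 p.2‖ₑ ^ 2 ∂μ.prod μ =
      hsSq μ (fun x y => A j x y - A₀ x y) := fun j =>
    lintegral_prod _
      (((hA.isL2 j).measurable.sub hA.isL2_lim.measurable).enorm.pow_const 2).aemeasurable
  simp only [h2] at h1
  have h3 := (ENNReal.tendsto_toReal ENNReal.zero_ne_top).comp h1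
  have h4 := (Real.continuous_sqrt.tendsto _).comp h3
  rw [ENNReal.toReal_zero, Real.sqrt_zero] at h4
  rw [tendsto_iff_norm_sub_tendsto_zero]
  refine squeeze_zero (fun j => norm_nonneg _) (fun j => ?_) h4
  rw [← kernelOp_sub]
  exact norm_kernelOp_le _

end Kernel

/-! ### Spherical coordinates around an axis -/

section Spherical

open scoped ENNReal Real

lemma lintegral_eq_lintegral_polar {f : ℝ × ℝ → ℝ≥0∞} (hf : Measurable f) :
    ∫⁻ p, f p = ∫⁻ r in Ioi (0 : ℝ), ∫⁻ θ in Ioo (-π) π,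
      ENNReal.ofReal r * f (r * Real.cos θ, r * Real.sin θ) := by
  rw [← lintegral_comp_polarCoord_symm, polarCoord_target, Measure.volume_eq_prod,
    ← Measure.prod_restrict, lintegral_prod]
  · rfl
  · refine Measurable.aemeasurable ?_
    have h1 : Measurable fun p : ℝ × ℝ => polarCoord.symm p := by
      have : (fun p : ℝ × ℝ => polarCoord.symm p) =
          fun p => (p.1 * Real.cos p.2, p.1 * Real.sin p.2) := rfl
      rw [this]
      fun_prop
    exact (ENNReal.measurable_ofReal.comp measurable_fst).mul (hf.comp h1)

lemma lintegral_sin_mul_comp_cos (f : ℝ → ℝ≥0∞) :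
    ∫⁻ θ in Ioo 0 π, ENNReal.ofReal (Real.sin θ) * f (Real.cos θ) =
      ∫⁻ t in Ioo (-1 : ℝ) 1, f t := by
  have himg : Real.cos '' Ioo 0 π = Ioo (-1 : ℝ) 1 := by
    ext t
    constructor
    · rintro ⟨θ, hθ, rfl⟩
      have h1 := Real.strictAntiOn_cos (left_mem_Icc.mpr Real.pi_pos.le) (Ioo_subset_Icc_self hθ) hθ.1
      have h2 := Real.strictAntiOn_cos (Ioo_subset_Icc_self hθ) (right_mem_Icc.mpr Real.pi_pos.le) hθ.2
      rw [Real.cos_zero] at h1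
      rw [Real.cos_pi] at h2
      exact ⟨h2, h1⟩
    · intro ht
      exact ⟨Real.arccos t, ⟨Real.arccos_pos.mpr ht.2, Real.arccos_lt_pi.mpr ht.1⟩,
        Real.cos_arccos ht.1.le ht.2.le⟩
  rw [← himg, lintegral_image_eq_lintegral_abs_deriv_mul measurableSet_Ioo
    (fun θ _ => (Real.hasDerivAt_cos θ).hasDerivWithinAt)
    (Real.injOn_cos.mono Ioo_subset_Icc_self)]
  refine setLIntegral_congr_fun measurableSet_Ioo fun θ hθ => ?_
  rw [abs_neg, abs_of_pos (Real.sin_pos_of_mem_Ioo hθ)]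

lemma lintegral_E3_eq (G : E3 → ℝ≥0∞) (hG : Measurable G) :
    ∫⁻ z, G z = ∫⁻ a : ℝ, ∫⁻ p : ℝ × ℝ, G (WithLp.toLp 2 ![a, p.1, p.2]) := by
  have hm : Measurable fun v : Fin 3 → ℝ => G (WithLp.toLp 2 v) :=
    hG.comp (PiLp.volume_preserving_toLp (Fin 3)).measurable
  have e := (volume_preserving_piFinSuccAbove (fun _ : Fin 3 => ℝ) 0).symm
  have e' := (volume_preserving_piFinTwo (fun _ : Fin 2 => ℝ)).symm
  have hm2 : Measurable fun q : ℝ × (Fin 2 → ℝ) =>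
      G (WithLp.toLp 2 ((MeasurableEquiv.piFinSuccAbove (fun _ : Fin 3 => ℝ) 0).symm q)) :=
    hm.comp (MeasurableEquiv.measurable _)
  rw [← (PiLp.volume_preserving_toLp (Fin 3)).lintegral_comp hG, ← e.lintegral_comp hm]
  refine (lintegral_prod _ hm2.aemeasurable).trans (lintegral_congr fun a => ?_)
  refine (e'.lintegral_comp (hm2.comp (measurable_prodMk_left (x := a)))).symm.trans
    (lintegral_congr fun p => ?_)
  simp only [Function.comp_apply]
  congr 2
  ext i
  fin_cases i <;> rfl

/-- Integration in spherical coordinates around the first axis. -/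
lemma lintegral_E3_axis {F : ℝ × ℝ → ℝ≥0∞} (hF : Measurable F) :
    ∫⁻ z : E3, F (‖z‖, z 0 / ‖z‖) = ENNReal.ofReal (2 * π) *
      ∫⁻ r in Ioi (0 : ℝ), ENNReal.ofReal (r ^ 2) * ∫⁻ t in Ioo (-1 : ℝ) 1, F (r, t) := by
  have hcoord : Measurable fun z : E3 => z 0 := by fun_prop
  have hG : Measurable fun z : E3 => F (‖z‖, z 0 / ‖z‖) :=
    hF.comp (measurable_norm.prodMk (hcoord.div measurable_norm))
  have hn : ∀ a b c : ℝ, ‖(WithLp.toLp 2 ![a, b, c] : E3)‖ = √(a ^ 2 + (b ^ 2 + c ^ 2)) := by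
    intro a b c
    rw [EuclideanSpace.norm_eq, Fin.sum_univ_three]
    simp [add_assoc]
  set H : ℝ → ℝ → ℝ≥0∞ := fun a ρ => F (√(a ^ 2 + ρ ^ 2), a / √(a ^ 2 + ρ ^ 2)) with hH
  have hHm : Measurable fun p : ℝ × ℝ => H p.1 p.2 := by
    refine hF.comp ?_
    fun_prop
  -- Polar coordinates in the plane orthogonal to the axis: the integrand does not depend on the
  -- azimuth, which yields 2π.
  have h1 : ∀ a : ℝ, ∫⁻ p : ℝ × ℝ, F (√(a ^ 2 + (p.1 ^ 2 + p.2 ^ 2)),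
      a / √(a ^ 2 + (p.1 ^ 2 + p.2 ^ 2))) =
      ENNReal.ofReal (2 * π) * ∫⁻ ρ in Ioi (0 : ℝ), ENNReal.ofReal ρ * H a ρ := by
    intro a
    have hm : Measurable fun p : ℝ × ℝ => F (√(a ^ 2 + (p.1 ^ 2 + p.2 ^ 2)),
        a / √(a ^ 2 + (p.1 ^ 2 + p.2 ^ 2))) := hF.comp (by fun_prop)
    rw [lintegral_eq_lintegral_polar hm, ← lintegral_const_mul]
    · refine lintegral_congr fun ρ => ?_
      have h2 : ∀ θ : ℝ, (ρ * Real.cos θ) ^ 2 + (ρ * Real.sin θ) ^ 2 = ρ ^ 2 := fun θ => by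
        linear_combination ρ ^ 2 * Real.sin_sq_add_cos_sq θ
      simp only [h2, lintegral_const, Measure.restrict_apply_univ, Real.volume_Ioo, hH]
      rw [mul_comm]
      congr 2
      ring
    · exact ENNReal.measurable_ofReal.mul (hHm.comp measurable_prodMk_left)
  -- Polar coordinates once more, in the half-plane ρ > 0 of (a,ρ). The indicator confines the angle
  -- to (0,π), the factors combine to r·(r sin θ), and t = cos θ absorbs sin θ.
  have h3 : ∫⁻ a : ℝ, ∫⁻ ρ in Ioi (0 : ℝ), ENNReal.ofReal ρ * H a ρ =
      ∫⁻ r in Ioi (0 : ℝ), ENNReal.ofReal (r ^ 2) * ∫⁻ t in Ioo (-1 : ℝ) 1, F (r, t) := by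
    have h4 : ∀ a, ∫⁻ ρ in Ioi (0 : ℝ), ENNReal.ofReal ρ * H a ρ =
        ∫⁻ ρ, (Ioi (0 : ℝ)).indicator (fun ρ => ENNReal.ofReal ρ * H a ρ) ρ := fun a =>
      (lintegral_indicator measurableSet_Ioi _).symm
    have hm : Measurable fun p : ℝ × ℝ =>
        (Ioi (0 : ℝ)).indicator (fun ρ => ENNReal.ofReal ρ * H p.1 ρ) p.2 := by
      have : (fun p : ℝ × ℝ => (Ioi (0 : ℝ)).indicator (fun ρ => ENNReal.ofReal ρ * H p.1 ρ) p.2) =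
          (Prod.snd ⁻¹' Ioi (0 : ℝ)).indicator fun p : ℝ × ℝ => ENNReal.ofReal p.2 * H p.1 p.2 := by
        ext p; simp [indicator]
      rw [this]
      exact ((ENNReal.measurable_ofReal.comp measurable_snd).mul hHm).indicator
        (measurable_snd measurableSet_Ioi)
    simp only [h4]
    rw [← lintegral_prod (μ := volume) (ν := volume)
      (fun p : ℝ × ℝ => (Ioi (0 : ℝ)).indicator (fun ρ => ENNReal.ofReal ρ * H p.1 ρ) p.2)
      hm.aemeasurable, ← Measure.volume_eq_prod, lintegral_eq_lintegral_polar hm]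
    refine setLIntegral_congr_fun measurableSet_Ioi fun r (hr : 0 < r) => ?_
    dsimp only
    rw [← lintegral_sin_mul_comp_cos, ← lintegral_const_mul' _ _ ENNReal.ofReal_ne_top,
      ← lintegral_indicator measurableSet_Ioo, ← lintegral_indicator measurableSet_Ioo]
    refine lintegral_congr fun θ => ?_
    by_cases hθ : θ ∈ Ioo 0 π
    · have hθ' : θ ∈ Ioo (-π) π := ⟨by linarith [hθ.1, Real.pi_pos], hθ.2⟩
      have hs := Real.sin_pos_of_mem_Ioo hθ
      rw [indicator_of_mem hθ', indicator_of_mem hθ, indicator_of_mem (mem_Ioi.mpr (mul_pos hr hs))]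
      have h5 : √((r * Real.cos θ) ^ 2 + (r * Real.sin θ) ^ 2) = r := by
        rw [show (r * Real.cos θ) ^ 2 + (r * Real.sin θ) ^ 2 = r ^ 2 by
          linear_combination r ^ 2 * Real.sin_sq_add_cos_sq θ, Real.sqrt_sq hr.le]
      simp only [hH, h5, mul_div_cancel_left₀ _ hr.ne']
      rw [← mul_assoc, ← mul_assoc, ← ENNReal.ofReal_mul hr.le, ← ENNReal.ofReal_mul (by positivity)]
      congr 2
      ring
    · rw [indicator_of_notMem hθ]
      by_cases hθ' : θ ∈ Ioo (-π) π
      · rw [indicator_of_mem hθ', indicator_of_notMem, mul_zero]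
        rw [mem_Ioi, not_lt]
        have h6 : θ ≤ 0 := by
          by_contra h; exact hθ ⟨not_le.mp h, hθ'.2⟩
        exact mul_nonpos_of_nonneg_of_nonpos hr.le
          (Real.sin_nonpos_of_nonpos_of_neg_pi_le h6 hθ'.1.le)
      · rw [indicator_of_notMem hθ']
  rw [lintegral_E3_eq _ hG, ← h3, ← lintegral_const_mul]
  · refine lintegral_congr fun a => ?_
    rw [← h1]
    refine lintegral_congr fun p => ?_
    rw [hn]
    simp
  · exact ((ENNReal.measurable_ofReal.comp measurable_snd).mul hHm).lintegral_prod_right'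

/-- Integration in spherical coordinates around the axis spanned by `x`. -/
lemma lintegral_E3_spherical {F : ℝ × ℝ → ℝ≥0∞} (hF : Measurable F) {x : E3} (hx : x ≠ 0) :
    ∫⁻ y : E3, F (‖y‖, inner ℝ x y / (‖x‖ * ‖y‖)) = ENNReal.ofReal (2 * π) *
      ∫⁻ r in Ioi (0 : ℝ), ENNReal.ofReal (r ^ 2) * ∫⁻ t in Ioo (-1 : ℝ) 1, F (r, t) := by
  have hx' : ‖x‖ ≠ 0 := norm_ne_zero_iff.mpr hx
  -- x/‖x‖ is taken as first vector of an orthonormal basis; the coordinate isometry preserves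
  -- volume and carries the axis x to the first axis.
  have ho : Orthonormal ℝ (({0} : Set (Fin 3)).domRestrict fun _ => (‖x‖⁻¹ • x : E3)) := by
    constructor
    · intro i
      change ‖‖x‖⁻¹ • x‖ = 1
      rw [norm_smul, norm_inv, norm_norm, inv_mul_cancel₀ hx']
    · intro i j hij
      exact absurd (Subsingleton.elim i j) hij
  obtain ⟨b, hb⟩ := ho.exists_orthonormalBasis_extension_of_card_eq (by simp)
  have hb0 : b 0 = ‖x‖⁻¹ • x := hb 0 rfl
  have hcoord : Measurable fun z : E3 => z 0 := by fun_prop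
  have hG : Measurable fun z : E3 => F (‖z‖, z 0 / ‖z‖) :=
    hF.comp (measurable_norm.prodMk (hcoord.div measurable_norm))
  rw [← lintegral_E3_axis hF, ← b.measurePreserving_repr.lintegral_comp hG]
  refine lintegral_congr fun y => ?_
  rw [b.repr.norm_map, b.repr_apply_apply, hb0, real_inner_smul_left]
  congr 2
  rw [mul_comm ‖x‖⁻¹, div_mul_eq_div_div, ← div_eq_mul_inv]

end Spherical

/-! ### The weighted space and the partial potential -/

section Weighted

open scoped ENNReal Real

/-- The density of `weightedMeasure`. -/
def density (ε α R : ℝ) : ℝ := weight ε R * Real.exp (2 * α * R)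

lemma weight_pos (ε : ℝ) {R : ℝ} (hR : 0 < R) : 0 < weight ε R := by
  unfold weight; positivity

lemma density_pos (ε α : ℝ) {R : ℝ} (hR : 0 < R) : 0 < density ε α R :=
  mul_pos (weight_pos ε hR) (Real.exp_pos _)

lemma measurable_density (ε α : ℝ) : Measurable (density ε α) := by
  unfold density weight
  fun_prop

instance (ε α : ℝ) : SFinite (weightedMeasure ε α) := by
  unfold weightedMeasure; infer_instance

lemma lintegral_weightedMeasure (ε α : ℝ) (f : ℝ → ℝ≥0∞) :
    ∫⁻ R, f R ∂weightedMeasure ε α =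
      ∫⁻ R in Ioi (0 : ℝ), ENNReal.ofReal (density ε α R) * f R := by
  have h : Measurable fun R => ENNReal.ofReal (density ε α R) :=
    (measurable_density ε α).ennreal_ofReal
  exact lintegral_withDensity_eq_lintegral_mul_non_measurable _ h
    (Eventually.of_forall fun _ => ENNReal.ofReal_lt_top) f

lemma integral_weightedMeasure (ε α : ℝ) (f : ℝ → ℂ) :
    ∫ R, f R ∂weightedMeasure ε α = ∫ R in Ioi (0 : ℝ), (density ε α R : ℂ) * f R := by
  have h : Measurable fun R => ENNReal.ofReal (density ε α R) :=
    (measurable_density ε α).ennreal_ofReal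
  refine (integral_withDensity_eq_integral_toReal_smul h
    (Eventually.of_forall fun _ => ENNReal.ofReal_lt_top) f).trans ?_
  refine setIntegral_congr_fun measurableSet_Ioi fun R hR => ?_
  rw [ENNReal.toReal_ofReal (density_pos ε α hR).le, Complex.real_smul]

lemma ae_weightedMeasure_iff (ε α : ℝ) {p : ℝ → Prop} :
    (∀ᵐ R ∂weightedMeasure ε α, p R) ↔ ∀ᵐ R ∂volume.restrict (Ioi (0 : ℝ)), p R := by
  have h : Measurable fun R => ENNReal.ofReal (density ε α R) :=
    (measurable_density ε α).ennreal_ofReal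
  refine (ae_withDensity_iff h).trans ?_
  rw [ae_restrict_iff' measurableSet_Ioi, ae_restrict_iff' measurableSet_Ioi]
  refine eventually_congr (Eventually.of_forall fun R => ?_)
  refine forall_congr' fun hR => ?_
  simp [density_pos ε α hR]

lemma ae_weightedMeasure_pos (ε α : ℝ) : ∀ᵐ R ∂weightedMeasure ε α, 0 < R := by
  rw [ae_weightedMeasure_iff]
  exact ae_restrict_mem measurableSet_Ioi

lemma exists_abs_legendreP_le (l : ℕ) :
    ∃ M, 0 ≤ M ∧ ∀ t ∈ Icc (-1 : ℝ) 1, |(legendreP l).eval t| ≤ M := by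
  obtain ⟨M, hM⟩ := isCompact_Icc.exists_bound_of_continuousOn
    (f := fun t => (legendreP l).eval t) (s := Icc (-1 : ℝ) 1) (by fun_prop)
  exact ⟨M, (norm_nonneg _).trans (hM 0 (by norm_num)), hM⟩

variable {ε α : ℝ} {V : ℝ → ℝ → ℝ → ℝ}

lemma IsNonlocalPotential.measurable_partialPotential (hV : IsNonlocalPotential ε α V) (l : ℕ) :
    Measurable fun p : ℝ × ℝ => partialPotential V l p.1 p.2 := by
  have h1 : Measurable fun q : (ℝ × ℝ) × ℝ => V q.1.1 q.1.2 q.2 * (legendreP l).eval q.2 := by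
    refine (hV.measurable.comp (by fun_prop : Measurable fun q : (ℝ × ℝ) × ℝ =>
      (q.1.1, q.1.2, q.2))).mul ?_
    exact (legendreP l).continuous.measurable.comp measurable_snd
  have h2 : Measurable fun p : ℝ × ℝ =>
      ∫ t in (-1 : ℝ)..1, V p.1 p.2 t * (legendreP l).eval t := by
    simp only [intervalIntegral.integral_of_le (show (-1 : ℝ) ≤ 1 by norm_num)]
    exact (h1.stronglyMeasurable.integral_prod_right').measurable
  unfold partialPotential
  fun_prop

/-- Spherical coordinates are used for y around the axis x, then for x itself, whose remaining
integrand is radial. Angular constants are at least 1 and are dropped. -/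
lemma IsNonlocalPotential.lintegral_radial_lt_top (hV : IsNonlocalPotential ε α V) :
    ∫⁻ s in Ioi (0 : ℝ), ENNReal.ofReal (s ^ 2) * ∫⁻ r in Ioi (0 : ℝ), ENNReal.ofReal (r ^ 2) *
      ∫⁻ t in Ioo (-1 : ℝ) 1,
        ENNReal.ofReal (density ε α s * density ε α r * V s r t ^ 2) < ⊤ := by
  set F : ℝ × ℝ × ℝ → ℝ≥0∞ := fun p =>
    ENNReal.ofReal (density ε α p.1 * density ε α p.2.1 * V p.1 p.2.1 p.2.2 ^ 2) with hF
  have hFm : Measurable F := by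
    have := measurable_density ε α
    refine Measurable.ennreal_ofReal ?_
    exact ((this.comp measurable_fst).mul (this.comp (measurable_fst.comp measurable_snd))).mul
      (hV.measurable.pow_const 2)
  set Φ : ℝ → ℝ≥0∞ := fun s => ∫⁻ r in Ioi (0 : ℝ), ENNReal.ofReal (r ^ 2) *
      ∫⁻ t in Ioo (-1 : ℝ) 1, F (s, r, t) with hΦ
  have hΦm : Measurable Φ := by
    have h1 : Measurable fun q : (ℝ × ℝ) × ℝ => F (q.1.1, q.1.2, q.2) :=
      hFm.comp (by fun_prop)
    have h2 : Measurable fun q : ℝ × ℝ => ENNReal.ofReal (q.2 ^ 2) *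
        ∫⁻ t in Ioo (-1 : ℝ) 1, F (q.1, q.2, t) :=
      (measurable_snd.pow_const 2).ennreal_ofReal.mul h1.lintegral_prod_right'
    exact h2.lintegral_prod_right'
  have h3 : ∫⁻ x : E3, ENNReal.ofReal (2 * π) * Φ ‖x‖ < ⊤ := by
    refine lt_of_eq_of_lt ?_ hV.finite
    refine lintegral_congr_ae ?_
    have : ∀ᵐ x : E3, x ≠ 0 := by simp [ae_iff]
    filter_upwards [this] with x hx
    exact (lintegral_E3_spherical (F := fun q => F (‖x‖, q.1, q.2)) (hFm.comp (by fun_prop)) hx).symm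
  have h4 := lintegral_E3_axis (F := fun q => ENNReal.ofReal (2 * π) * Φ q.1)
    ((hΦm.comp measurable_fst).const_mul _)
  dsimp only at h4
  rw [h4] at h3
  refine lt_of_le_of_lt ?_ (ENNReal.lt_top_of_mul_ne_top_right h3.ne (by simp [Real.pi_pos]))
  refine lintegral_mono fun s => ?_
  refine mul_le_mul_right ?_ _
  change Φ s ≤ _
  rw [lintegral_const, Measure.restrict_apply_univ, Real.volume_Ioo]
  have h5 : (1 : ℝ≥0∞) ≤ ENNReal.ofReal (2 * π) * ENNReal.ofReal (1 - -1) := by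
    rw [← ENNReal.ofReal_mul (by positivity), ENNReal.one_le_ofReal]
    linarith [Real.pi_gt_three]
  calc Φ s = 1 * Φ s := (one_mul _).symm
    _ ≤ (ENNReal.ofReal (2 * π) * ENNReal.ofReal (1 - -1)) * Φ s := by gcongr
    _ = _ := by ring

/-- Cauchy–Schwarz in t against the constant function; 8π²M² is (2π)²·M²·2, the 2 being the length
of [-1,1]. The factor RR' in V_ℓ supplies the radial parts s² and r² of the two volume elements. -/
lemma enorm_partialPotential_sq_le (hV : IsNonlocalPotential ε α V) {l : ℕ} {M : ℝ} (hM0 : 0 ≤ M)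
    (hM : ∀ t ∈ Icc (-1 : ℝ) 1, |(legendreP l).eval t| ≤ M) (s r : ℝ) :
    ‖(partialPotential V l s r : ℂ)‖ₑ ^ 2 ≤ ENNReal.ofReal (8 * π ^ 2 * M ^ 2) *
      (ENNReal.ofReal (s ^ 2) * (ENNReal.ofReal (r ^ 2) *
        ∫⁻ t in Ioo (-1 : ℝ) 1, ENNReal.ofReal (V s r t ^ 2))) := by
  have hVm : Measurable fun t => V s r t := 
    hV.measurable.comp (by fun_prop : Measurable fun t : ℝ => (s, r, t))
  have e1 : ∀ x : ℝ, ‖(x : ℂ)‖ₑ ^ 2 = ENNReal.ofReal (x ^ 2) := fun x => by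
    rw [← ofReal_norm, ← ENNReal.ofReal_pow (norm_nonneg _), Complex.norm_real, Real.norm_eq_abs,
      sq_abs]
  have e2 : ∀ x : ℝ, ‖x‖ₑ ^ 2 = ENNReal.ofReal (x ^ 2) := fun x => by
    rw [← ofReal_norm, ← ENNReal.ofReal_pow (norm_nonneg _), Real.norm_eq_abs, sq_abs]
  have h1 : ‖∫ t in (-1 : ℝ)..1, V s r t * (legendreP l).eval t‖ₑ ≤
      ENNReal.ofReal M * ∫⁻ t in Ioo (-1 : ℝ) 1, ‖V s r t‖ₑ * 1 := by
    rw [intervalIntegral.integral_of_le (by norm_num), ← restrict_Ioo_eq_restrict_Ioc,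
      ← lintegral_const_mul' _ _ ENNReal.ofReal_ne_top]
    refine (enorm_integral_le_lintegral_enorm _).trans ?_
    refine setLIntegral_mono' measurableSet_Ioo fun t ht => ?_
    rw [enorm_mul, mul_one, mul_comm]
    gcongr
    rw [← ofReal_norm]
    exact ENNReal.ofReal_le_ofReal (hM t (Ioo_subset_Icc_self ht))
  have h2 : (∫⁻ t in Ioo (-1 : ℝ) 1, ‖V s r t‖ₑ * 1) ^ 2 ≤
      (∫⁻ t in Ioo (-1 : ℝ) 1, ENNReal.ofReal (V s r t ^ 2)) * ENNReal.ofReal 2 := by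
    refine (sq_lintegral_mul_le hVm.enorm.aemeasurable aemeasurable_const).trans ?_
    simp only [e2, one_pow, lintegral_const, Measure.restrict_apply_univ, Real.volume_Ioo, one_mul]
    gcongr
    norm_num
  rw [partialPotential, e1, mul_pow, ENNReal.ofReal_mul (by positivity), ← e2 (∫ _ in _.._, _)]
  calc _ ≤ ENNReal.ofReal ((2 * π * s * r) ^ 2) * (ENNReal.ofReal M ^ 2 *
        ((∫⁻ t in Ioo (-1 : ℝ) 1, ENNReal.ofReal (V s r t ^ 2)) * ENNReal.ofReal 2)) := by
        gcongr
        refine (pow_le_pow_left₀ zero_le h1 2).trans ?_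
        rw [mul_pow]
        gcongr
    _ = _ := by
        rw [show 8 * π ^ 2 * M ^ 2 = (4 * π ^ 2) * (M ^ 2 * 2) by ring,
          show (2 * π * s * r) ^ 2 = (4 * π ^ 2) * (s ^ 2 * r ^ 2) by ring,
          ENNReal.ofReal_mul (p := 4 * π ^ 2) (q := s ^ 2 * r ^ 2) (by positivity),
          ENNReal.ofReal_mul (p := 4 * π ^ 2) (q := M ^ 2 * 2) (by positivity),
          ENNReal.ofReal_mul (p := s ^ 2) (by positivity),
          ENNReal.ofReal_mul (p := M ^ 2) (by positivity),
          ENNReal.ofReal_pow hM0]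
        ring

/-- The partial potential is a square-integrable kernel on the weighted space. -/
lemma IsNonlocalPotential.isL2Kernel (hV : IsNonlocalPotential ε α V) (l : ℕ) :
    IsL2Kernel (weightedMeasure ε α) fun R R' => (partialPotential V l R R' : ℂ) := by
  refine ⟨Complex.measurable_ofReal.comp (hV.measurable_partialPotential l), ?_⟩
  obtain ⟨M, hM0, hM⟩ := exists_abs_legendreP_le l
  have h := ENNReal.mul_lt_top (a := ENNReal.ofReal (8 * π ^ 2 * M ^ 2)) ENNReal.ofReal_lt_top
    hV.lintegral_radial_lt_top
  refine lt_of_le_of_lt ?_ h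
  rw [hsSq, lintegral_weightedMeasure, ← lintegral_const_mul' _ _ ENNReal.ofReal_ne_top]
  refine setLIntegral_mono' measurableSet_Ioi fun s hs => ?_
  rw [lintegral_weightedMeasure, ← lintegral_const_mul' _ _ ENNReal.ofReal_ne_top,
    ← lintegral_const_mul' _ _ ENNReal.ofReal_ne_top,
    ← lintegral_const_mul' _ _ ENNReal.ofReal_ne_top]
  refine setLIntegral_mono' measurableSet_Ioi fun r hr => ?_
  have h1 : ∫⁻ t in Ioo (-1 : ℝ) 1, ENNReal.ofReal (density ε α s * density ε α r * V s r t ^ 2) =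
      ENNReal.ofReal (density ε α s) * (ENNReal.ofReal (density ε α r) *
        ∫⁻ t in Ioo (-1 : ℝ) 1, ENNReal.ofReal (V s r t ^ 2)) := by
    rw [← lintegral_const_mul' _ _ ENNReal.ofReal_ne_top,
      ← lintegral_const_mul' _ _ ENNReal.ofReal_ne_top]
    refine lintegral_congr fun t => ?_
    rw [← ENNReal.ofReal_mul (density_pos ε α hr).le, ← ENNReal.ofReal_mul (density_pos ε α hs).le,
      mul_assoc]
  rw [h1]
  refine (mul_le_mul_right (mul_le_mul_right (enorm_partialPotential_sq_le hV hM0 hM s r) _) _).trans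
    (le_of_eq ?_)
  ring

end Weighted

/-! ### Spherical Bessel and Hankel functions, and the Green function -/

section Bessel

open Polynomial

lemma norm_exp_I_mul_le (z : ℂ) {t : ℝ} (ht : |t| ≤ 1) :
    ‖Complex.exp (Complex.I * z * (t : ℂ))‖ ≤ Real.exp |z.im| := by
  rw [Complex.norm_exp, Real.exp_le_exp]
  have h1 : (Complex.I * z * (t : ℂ)).re = -(z.im * t) := by simp
  rw [h1]
  calc -(z.im * t) ≤ |z.im * t| := neg_le_abs _
    _ = |z.im| * |t| := abs_mul _ _
    _ ≤ |z.im| * 1 := by gcongr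
    _ = _ := mul_one _

lemma norm_integral_exp_mul_le (z : ℂ) {f : ℝ → ℂ} {M : ℝ} (hM : ∀ t ∈ Icc (-1 : ℝ) 1, ‖f t‖ ≤ M) :
    ‖∫ t in (-1 : ℝ)..1, Complex.exp (Complex.I * z * (t : ℂ)) * f t‖ ≤
      2 * M * Real.exp |z.im| := by
  have h := intervalIntegral.norm_integral_le_of_norm_le_const (a := (-1 : ℝ)) (b := 1)
    (f := fun t : ℝ => Complex.exp (Complex.I * z * (t : ℂ)) * f t)
    (C := Real.exp |z.im| * M) fun t ht => by
      rw [uIoc_of_le (by norm_num)] at ht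
      rw [norm_mul]
      exact mul_le_mul (norm_exp_I_mul_le z (abs_le.mpr ⟨ht.1.le, ht.2⟩))
        (hM t (Ioc_subset_Icc_self ht)) (norm_nonneg _) (Real.exp_pos _).le
  refine h.trans (le_of_eq ?_)
  norm_num
  ring

lemma mul_integral_exp_mul_eval (z : ℂ) (p : ℂ[X]) :
    z * ∫ t in (-1 : ℝ)..1, Complex.exp (Complex.I * z * (t : ℂ)) * p.eval (t : ℂ) =
      -Complex.I * (Complex.exp (Complex.I * z) * p.eval 1 -
        Complex.exp (-(Complex.I * z)) * p.eval (-1)) +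
      Complex.I * ∫ t in (-1 : ℝ)..1,
        Complex.exp (Complex.I * z * (t : ℂ)) * p.derivative.eval (t : ℂ) := by
  have hd : ∀ t : ℝ, HasDerivAt (fun t : ℝ => Complex.exp (Complex.I * z * (t : ℂ)) * p.eval (t : ℂ))
      (Complex.I * z * (Complex.exp (Complex.I * z * (t : ℂ)) * p.eval (t : ℂ)) +
        Complex.exp (Complex.I * z * (t : ℂ)) * p.derivative.eval (t : ℂ)) t := by
    intro t
    have h1 : HasDerivAt (fun w : ℂ => Complex.exp (Complex.I * z * w)) _ (t : ℂ) :=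
      ((hasDerivAt_id (t : ℂ)).const_mul (Complex.I * z)).cexp
    refine (h1.mul (p.hasDerivAt (t : ℂ))).comp_ofReal.congr_deriv ?_
    simp only [id, mul_one]
    ring
  have c1 : Continuous fun t : ℝ => Complex.exp (Complex.I * z * (t : ℂ)) * p.eval (t : ℂ) := by
    fun_prop
  have c2 : Continuous fun t : ℝ =>
      Complex.exp (Complex.I * z * (t : ℂ)) * p.derivative.eval (t : ℂ) := by
    fun_prop
  have h := intervalIntegral.integral_eq_sub_of_hasDerivAt (a := (-1 : ℝ)) (b := 1)
    (fun t _ => hd t) (((c1.const_mul _).add c2).intervalIntegrable _ _)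
  rw [intervalIntegral.integral_add ((c1.intervalIntegrable _ _).const_mul _)
    (c2.intervalIntegrable _ _), intervalIntegral.integral_const_mul] at h
  push_cast at h
  rw [mul_one, mul_neg, mul_one] at h
  rw [← h]
  linear_combination (z * ∫ t in (-1 : ℝ)..1,
    Complex.exp (Complex.I * z * (t : ℂ)) * p.eval (t : ℂ)) * Complex.I_mul_I

lemma exists_norm_eval_le (p : ℂ[X]) : ∃ M, ∀ t ∈ Icc (-1 : ℝ) 1, ‖p.eval (t : ℂ)‖ ≤ M :=
  isCompact_Icc.exists_bound_of_continuousOn (by fun_prop)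

/-- Each integration by parts trades one power of z for a derivative. The zeros of (1-t²)^l at ±1
kill the boundary terms in the first l steps, and in the last one they are bounded by exp|Im z|. -/
lemma exists_norm_pow_mul_integral_le (l : ℕ) (p : ℂ[X]) (hp : (1 - X ^ 2) ^ l ∣ p) :
    ∃ C, ∀ z : ℂ, ‖z ^ (l + 1) *
      ∫ t in (-1 : ℝ)..1, Complex.exp (Complex.I * z * (t : ℂ)) * p.eval (t : ℂ)‖ ≤
        C * Real.exp |z.im| := by
  induction l generalizing p with
  | zero =>
    obtain ⟨M, hM⟩ := exists_norm_eval_le p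
    obtain ⟨M', hM'⟩ := exists_norm_eval_le p.derivative
    refine ⟨2 * M + 2 * M', fun z => ?_⟩
    have h1 := norm_exp_I_mul_le z (t := 1) (by simp)
    have h2 := norm_exp_I_mul_le z (t := -1) (by simp)
    have h3 := hM 1 (by norm_num)
    have h4 := hM (-1) (by norm_num)
    push_cast at h1 h2 h3 h4
    rw [mul_one] at h1
    rw [mul_neg, mul_one] at h2
    rw [zero_add, pow_one, mul_integral_exp_mul_eval]
    refine (norm_add_le _ _).trans ?_
    have h5 : ‖-Complex.I * (Complex.exp (Complex.I * z) * p.eval 1 -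
        Complex.exp (-(Complex.I * z)) * p.eval (-1))‖ ≤ 2 * M * Real.exp |z.im| := by
      rw [norm_mul, norm_neg, Complex.norm_I, one_mul]
      refine (norm_sub_le _ _).trans ?_
      rw [norm_mul, norm_mul]
      have := mul_le_mul h1 h3 (norm_nonneg _) (Real.exp_pos _).le
      have := mul_le_mul h2 h4 (norm_nonneg _) (Real.exp_pos _).le
      linarith
    have h6 := norm_integral_exp_mul_le z hM'
    rw [norm_mul Complex.I, Complex.norm_I, one_mul]
    linarith
  | succ l ih =>
    have hd : (1 - X ^ 2) ^ l ∣ p.derivative := by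
      simpa using pow_sub_one_dvd_derivative_of_pow_dvd hp
    obtain ⟨C, hC⟩ := ih _ hd
    refine ⟨C, fun z => ?_⟩
    obtain ⟨q, rfl⟩ := hp
    rw [pow_succ, mul_assoc, mul_integral_exp_mul_eval]
    have h1 : ((1 - X ^ 2) ^ (l + 1) * q).eval 1 = 0 := by simp
    have h2 : ((1 - X ^ 2) ^ (l + 1) * q).eval (-1) = 0 := by simp
    rw [h1, h2, mul_zero, mul_zero, sub_zero, mul_zero, zero_add, mul_left_comm, norm_mul,
      Complex.norm_I, one_mul]
    exact hC z

/-- The entire function `∫_{-1}^{1} e^(izt) (1-t²)^l dt`. -/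
def poissonIntegral (l : ℕ) (z : ℂ) : ℂ :=
  ∫ t in (-1 : ℝ)..1, Complex.exp (Complex.I * z * (t : ℂ)) * (1 - (t : ℂ) ^ 2) ^ l

lemma sphericalBessel_eq (l : ℕ) (z : ℂ) :
    sphericalBessel l z = z ^ l / (2 ^ (l + 1) * (l.factorial : ℂ)) * poissonIntegral l z := rfl

lemma continuous_poissonIntegral (l : ℕ) : Continuous (poissonIntegral l) := by
  refine intervalIntegral.continuous_parametric_intervalIntegral_of_continuous' ?_ _ _
  simp only [Function.uncurry_def]
  fun_prop

lemma continuous_sphericalBessel (l : ℕ) : Continuous (sphericalBessel l) := by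
  have := continuous_poissonIntegral l
  simp only [funext (sphericalBessel_eq l)]
  fun_prop

lemma norm_besselCoeff_le (l : ℕ) : ‖(2 ^ (l + 1) * (l.factorial : ℂ))⁻¹‖ ≤ 1 / 2 := by
  rw [norm_inv, norm_mul, norm_pow, RCLike.norm_ofNat, RCLike.norm_natCast, one_div]
  refine inv_anti₀ two_pos ?_
  have h1 : (1 : ℝ) ≤ l.factorial := by exact_mod_cast l.factorial_pos
  have h2 : (1 : ℝ) ≤ 2 ^ l := one_le_pow₀ (by norm_num)
  rw [pow_succ]
  nlinarith

lemma norm_sphericalBessel_le (l : ℕ) (z : ℂ) :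
    ‖sphericalBessel l z‖ ≤ ‖z‖ ^ l * Real.exp |z.im| := by
  have h1 : ‖poissonIntegral l z‖ ≤ 2 * 1 * Real.exp |z.im| := by
    refine norm_integral_exp_mul_le z fun t ht => ?_
    rw [norm_pow]
    refine pow_le_one₀ (norm_nonneg _) ?_
    have h2 : (1 - (t : ℂ) ^ 2) = ((1 - t ^ 2 : ℝ) : ℂ) := by push_cast; ring
    rw [h2, Complex.norm_real, Real.norm_eq_abs, abs_le]
    constructor <;> nlinarith [ht.1, ht.2]
  rw [sphericalBessel_eq, div_eq_mul_inv, norm_mul, norm_mul, norm_pow]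
  calc _ ≤ ‖z‖ ^ l * (1 / 2) * (2 * 1 * Real.exp |z.im|) := by
        gcongr
        exact norm_besselCoeff_le l
    _ = _ := by ring

lemma exists_norm_mul_sphericalBessel_le (l : ℕ) :
    ∃ C, 1 ≤ C ∧ ∀ z : ℂ, ‖z * sphericalBessel l z‖ ≤ C * Real.exp |z.im| := by
  obtain ⟨C, hC⟩ := exists_norm_pow_mul_integral_le l ((1 - X ^ 2) ^ l) dvd_rfl
  refine ⟨max C 1, le_max_right _ _, fun z => ?_⟩
  have h1 := hC z
  simp only [eval_pow, eval_sub, eval_one, eval_X] at h1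
  change ‖_ * poissonIntegral l z‖ ≤ _ at h1
  have h2 : z * sphericalBessel l z =
      (2 ^ (l + 1) * (l.factorial : ℂ))⁻¹ * (z ^ (l + 1) * poissonIntegral l z) := by
    rw [sphericalBessel_eq]; ring
  rw [h2, norm_mul]
  calc _ ≤ 1 * (C * Real.exp |z.im|) :=
        mul_le_mul ((norm_besselCoeff_le l).trans (by norm_num)) h1 (norm_nonneg _) zero_le_one
    _ ≤ _ := by rw [one_mul]; gcongr; exact le_max_left _ _

/-- The polynomial factor of the spherical Hankel function. -/
def hankelPoly (l : ℕ) (z : ℂ) : ℂ :=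
  ∑ m ∈ Finset.range (l + 1), Complex.I ^ m / ((m.factorial : ℂ) * 2 ^ m) *
    (((l + m).factorial : ℂ) / ((l - m).factorial : ℂ)) * z ^ (l - m)

lemma continuous_hankelPoly (l : ℕ) : Continuous (hankelPoly l) := by
  unfold hankelPoly; fun_prop

lemma hankelPoly_zero (l : ℕ) :
    hankelPoly l 0 = Complex.I ^ l / ((l.factorial : ℂ) * 2 ^ l) * ((2 * l).factorial : ℂ) := by
  rw [hankelPoly, Finset.sum_eq_single l]
  · simp [two_mul]
  · intro m hm hml
    have : l - m ≠ 0 := by have := Finset.mem_range.mp hm; omega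
    simp [this]
  · simp

/-- Isolates the pole z^{-(l+1)}, which cancels against z^l in j_l and the factor k in the Green
function. -/
lemma sphericalHankel_eq (l : ℕ) {z : ℂ} (hz : z ≠ 0) :
    sphericalHankel l z =
      (-Complex.I) ^ (l + 1) * Complex.exp (Complex.I * z) * hankelPoly l z / z ^ (l + 1) := by
  have h1 : ∑ m ∈ Finset.range (l + 1), Complex.I ^ m / ((m.factorial : ℂ) * (2 * z) ^ m) *
        (((l + m).factorial : ℂ) / ((l - m).factorial : ℂ)) = hankelPoly l z / z ^ l := by
    rw [hankelPoly, Finset.sum_div]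
    refine Finset.sum_congr rfl fun m hm => ?_
    have h2 : z ^ l = z ^ m * z ^ (l - m) := by
      rw [← pow_add]; congr 1; have := Finset.mem_range.mp hm; omega
    rw [h2, mul_pow]
    have := pow_ne_zero m hz
    have := pow_ne_zero (l - m) hz
    have : (m.factorial : ℂ) ≠ 0 := by exact_mod_cast m.factorial_ne_zero
    have : ((l - m).factorial : ℂ) ≠ 0 := by exact_mod_cast (l - m).factorial_ne_zero
    field_simp
  rw [sphericalHankel, h1, pow_succ z l]
  have := pow_ne_zero l hz
  field_simp

lemma exists_norm_hankelPoly_le (l : ℕ) :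
    ∃ C, 1 ≤ C ∧ ∀ z : ℂ, ‖hankelPoly l z‖ ≤ C * (1 + ‖z‖) ^ l := by
  refine ⟨max (∑ m ∈ Finset.range (l + 1), ‖Complex.I ^ m / ((m.factorial : ℂ) * 2 ^ m) *
    (((l + m).factorial : ℂ) / ((l - m).factorial : ℂ))‖) 1, le_max_right _ _, fun z => ?_⟩
  have h1 : (1 : ℝ) ≤ 1 + ‖z‖ := by linarith [norm_nonneg z]
  refine le_trans ?_ (mul_le_mul_of_nonneg_right (le_max_left _ _) (by positivity))
  rw [Finset.sum_mul]
  refine norm_sum_le_of_le _ fun m _ => ?_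
  rw [norm_mul, norm_pow]
  gcongr
  calc ‖z‖ ^ (l - m) ≤ (1 + ‖z‖) ^ (l - m) := by gcongr; linarith
    _ ≤ (1 + ‖z‖) ^ l := pow_le_pow_right₀ h1 (Nat.sub_le _ _)

/-- Integrates the derivative of t(1-t²)^{l+1}, which vanishes at both endpoints. -/
lemma poissonIntegral_zero_succ (l : ℕ) :
    (2 * (l : ℂ) + 3) * poissonIntegral (l + 1) 0 = 2 * ((l : ℂ) + 1) * poissonIntegral l 0 := by
  have hd : ∀ t : ℝ, HasDerivAt (fun t : ℝ => (t : ℂ) * (1 - (t : ℂ) ^ 2) ^ (l + 1))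
      ((2 * (l : ℂ) + 3) * (1 - (t : ℂ) ^ 2) ^ (l + 1) -
        2 * ((l : ℂ) + 1) * (1 - (t : ℂ) ^ 2) ^ l) t := by
    intro t
    have h1 : HasDerivAt (fun w : ℂ => w * (1 - w ^ 2) ^ (l + 1)) _ (t : ℂ) :=
      (hasDerivAt_id (t : ℂ)).mul ((((hasDerivAt_id (t : ℂ)).pow 2).const_sub 1).pow (l + 1))
    refine h1.comp_ofReal.congr_deriv ?_
    simp only [id, Pi.pow_apply]
    push_cast
    simp
    ring
  have c1 : ∀ n : ℕ, Continuous fun t : ℝ => (1 - (t : ℂ) ^ 2) ^ n := fun n => by fun_prop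
  have h := intervalIntegral.integral_eq_sub_of_hasDerivAt (a := (-1 : ℝ)) (b := 1)
    (fun t _ => hd t)
    ((((c1 _).const_mul _).sub ((c1 _).const_mul _)).intervalIntegrable _ _)
  rw [intervalIntegral.integral_sub (((c1 _).intervalIntegrable _ _).const_mul _)
    (((c1 _).intervalIntegrable _ _).const_mul _), intervalIntegral.integral_const_mul,
    intervalIntegral.integral_const_mul] at h
  simp [poissonIntegral] at h ⊢
  linear_combination h

lemma poissonIntegral_zero (l : ℕ) :
    poissonIntegral l 0 * ((2 * l + 1).factorial : ℂ) =
      2 ^ (2 * l + 1) * (l.factorial : ℂ) ^ 2 := by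
  induction l with
  | zero => simp [poissonIntegral]; norm_num
  | succ l ih =>
    have h := poissonIntegral_zero_succ l
    have h1 : ((2 * (l + 1) + 1).factorial : ℂ) =
        (2 * (l : ℂ) + 3) * ((2 * (l : ℂ) + 2) * ((2 * l + 1).factorial : ℂ)) := by
      rw [show 2 * (l + 1) + 1 = (2 * l + 1) + 1 + 1 by ring, Nat.factorial_succ, Nat.factorial_succ]
      push_cast; ring
    have h2 : ((l + 1).factorial : ℂ) = ((l : ℂ) + 1) * (l.factorial : ℂ) := by
      rw [Nat.factorial_succ]; push_cast; ring
    rw [h1, h2, show 2 * (l + 1) + 1 = (2 * l + 1) + 2 by ring, pow_add]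
    linear_combination (2 * (l : ℂ) + 2) * ((2 * l + 1).factorial : ℂ) * h +
      2 * ((l : ℂ) + 1) * (2 * (l : ℂ) + 2) * ih

/-- A formula for the Green function which is uniform in `k`. -/
lemma green_eq (l : ℕ) (k : ℂ) {R : ℝ} (hR : 0 < R) (R' : ℝ) :
    green l k R R' = -Complex.I * (-Complex.I) ^ (l + 1) / (2 ^ (l + 1) * (l.factorial : ℂ)) *
      (((min R R' : ℝ) : ℂ) ^ (l + 1) / ((max R R' : ℝ) : ℂ) ^ l) *
      poissonIntegral l (k * ((min R R' : ℝ) : ℂ)) *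
      (Complex.exp (Complex.I * (k * ((max R R' : ℝ) : ℂ))) *
        hankelPoly l (k * ((max R R' : ℝ) : ℂ))) := by
  have hb : ((max R R' : ℝ) : ℂ) ≠ 0 := by
    exact_mod_cast (lt_max_of_lt_left hR).ne'
  have hab : (R : ℂ) * (R' : ℂ) = ((min R R' : ℝ) : ℂ) * ((max R R' : ℝ) : ℂ) := by
    rw [← Complex.ofReal_mul, ← Complex.ofReal_mul, min_mul_max]
  unfold green
  set a := ((min R R' : ℝ) : ℂ)
  set b := ((max R R' : ℝ) : ℂ)
  have hf : (l.factorial : ℂ) ≠ 0 := by exact_mod_cast l.factorial_ne_zero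
  -- At k = 0 the claim is an identity of constants, settled by the values of the Poisson integral
  -- and of `hankelPoly` at 0; otherwise the powers of k cancel.
  split_ifs with hk
  · have h1 := poissonIntegral_zero l
    have h2 : ((2 * l + 1).factorial : ℂ) = (2 * (l : ℂ) + 1) * ((2 * l).factorial : ℂ) := by
      rw [Nat.factorial_succ]; push_cast; ring
    have h3 : (2 * (l : ℂ) + 1) ≠ 0 := by exact_mod_cast (by omega : 2 * l + 1 ≠ 0)
    rw [hk, zero_mul, zero_mul, mul_zero, Complex.exp_zero, one_mul, hankelPoly_zero]
    rw [h2] at h1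
    have h4 : (-Complex.I) * (-Complex.I) ^ (l + 1) * Complex.I ^ l = -1 := by
      have h5 : (-Complex.I) ^ l * Complex.I ^ l = 1 := by
        rw [← mul_pow, neg_mul, Complex.I_mul_I, neg_neg, one_pow]
      rw [pow_succ]
      linear_combination (Complex.I * Complex.I) * h5 + Complex.I_mul_I
    have hb' := pow_ne_zero l hb
    calc -a ^ (l + 1) / ((2 * (l : ℂ) + 1) * b ^ l)
        = (-Complex.I * (-Complex.I) ^ (l + 1) * Complex.I ^ l) *
          (poissonIntegral l 0 * ((2 * (l : ℂ) + 1) * ((2 * l).factorial : ℂ))) *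
          (a ^ (l + 1) / b ^ l) /
          (2 ^ (2 * l + 1) * (l.factorial : ℂ) ^ 2 * (2 * (l : ℂ) + 1)) := by
          rw [h4, h1]; field_simp
      _ = _ := by
          rw [show 2 * l + 1 = (l + 1) + l by ring, pow_add 2 (l + 1) l]
          field_simp
  · have hkb : k * b ≠ 0 := mul_ne_zero hk hb
    have h0 : -Complex.I * k * (R : ℂ) * (R' : ℂ) = -Complex.I * k * (a * b) := by
      rw [← hab]; ring
    rw [h0, sphericalHankel_eq l hkb, sphericalBessel_eq]
    field_simp
    ring

lemma measurable_green (l : ℕ) (k : ℂ) : Measurable fun p : ℝ × ℝ => green l k p.1 p.2 := by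
  unfold green
  split_ifs
  · fun_prop
  · have h1 := (continuous_sphericalBessel l).measurable
    have h2 : Measurable (sphericalHankel l) := by unfold sphericalHankel; fun_prop
    fun_prop

lemma continuous_green (l : ℕ) {R : ℝ} (hR : 0 < R) (R' : ℝ) :
    Continuous fun k => green l k R R' := by
  have h1 := continuous_poissonIntegral l
  have h2 := continuous_hankelPoly l
  simp only [fun k => green_eq l k hR R']
  fun_prop

/-- Used with x = |k|min(R,R') and y = |k|max(R,R'): the Bessel bound min(1,x^{l+1}) compensates the
Hankel growth (1+y)^l/y^l. For y ≥ 1 one has 1+y ≤ 2y; for y ≤ 1 one has x^l ≤ y^l. -/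
lemma min_mul_le {l : ℕ} {x y : ℝ} (hx : 0 ≤ x) (hxy : x ≤ y) (hy : 0 < y) :
    min 1 (x ^ (l + 1)) * (1 + y) ^ l ≤ 2 ^ l * min 1 x * y ^ l := by
  have hm : 0 ≤ min 1 x := le_min zero_le_one hx
  have hm1 : min 1 (x ^ (l + 1)) ≤ min 1 x := by
    rcases le_total x 1 with h | h
    · rw [min_eq_right h, min_eq_right (pow_le_one₀ hx h)]
      exact pow_le_of_le_one hx h (Nat.succ_ne_zero l)
    · rw [min_eq_left h]; exact min_le_left _ _
  rcases le_total 1 y with h | h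
  · calc min 1 (x ^ (l + 1)) * (1 + y) ^ l ≤ min 1 x * (2 * y) ^ l := by gcongr; linarith
      _ = _ := by rw [mul_pow]; ring
  · rw [min_eq_right (hxy.trans h)]
    calc min 1 (x ^ (l + 1)) * (1 + y) ^ l ≤ x ^ (l + 1) * 2 ^ l := by
          gcongr
          · exact min_le_right _ _
          · linarith
      _ = 2 ^ l * x * x ^ l := by ring
      _ ≤ _ := by gcongr

/-- Both bounds come from |k||G| ≤ C·min(1,|k|min(R,R'))·e^{|Im k|(R+R')}: the second entry of the
minimum gives uniformity near k = 0, the first gives decay in k. -/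
lemma exists_norm_green_le (l : ℕ) : ∃ C, 1 ≤ C ∧ ∀ (k : ℂ) {R R' : ℝ}, 0 < R → 0 < R' →
    ‖green l k R R'‖ ≤ C * min R R' * Real.exp (|k.im| * (R + R')) ∧
    ‖k‖ * ‖green l k R R'‖ ≤ C * Real.exp (|k.im| * (R + R')) := by
  obtain ⟨C₁, hC₁, h₁⟩ := exists_norm_mul_sphericalBessel_le l
  obtain ⟨C₂, hC₂, h₂⟩ := exists_norm_hankelPoly_le l
  have hC1 : (1 : ℝ) ≤ C₁ * (C₂ * 2 ^ l) :=
    one_le_mul_of_one_le_of_one_le hC₁ (one_le_mul_of_one_le_of_one_le hC₂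
      (one_le_pow₀ (by norm_num)))
  refine ⟨C₁ * (C₂ * 2 ^ l), hC1, fun k R R' hR hR' => ?_⟩
  have ha : 0 < min R R' := lt_min hR hR'
  have hab : min R R' ≤ max R R' := min_le_max
  by_cases hk : k = 0
  · subst hk
    simp only [norm_zero, zero_mul, Complex.zero_im, abs_zero, Real.exp_zero, mul_one]
    refine ⟨?_, by linarith⟩
    refine le_trans ?_ (le_mul_of_one_le_left ha.le hC1)
    rw [green, if_pos rfl, norm_div, norm_neg, norm_pow, norm_mul, norm_pow, Complex.norm_real,
      Complex.norm_real, Real.norm_of_nonneg ha.le, Real.norm_of_nonneg (ha.le.trans hab)]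
    have hb : 0 < max R R' := ha.trans_le hab
    have h3 : (1 : ℝ) ≤ ‖2 * (l : ℂ) + 1‖ := by
      rw [show (2 * (l : ℂ) + 1) = ((2 * l + 1 : ℕ) : ℂ) by push_cast; ring, RCLike.norm_natCast]
      exact_mod_cast (by omega : 1 ≤ 2 * l + 1)
    rw [div_le_iff₀ (by positivity), pow_succ, mul_comm]
    gcongr
    calc (min R R') ^ l ≤ 1 * (max R R') ^ l := by rw [one_mul]; gcongr
      _ ≤ _ := by gcongr
  have hk0 : 0 < ‖k‖ := norm_pos_iff.mpr hk
  have hb : 0 < max R R' := ha.trans_le hab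
  have hRR : R * R' = min R R' * max R R' := (min_mul_max R R').symm
  have hsum : R + R' = min R R' + max R R' := (min_add_max R R').symm
  rw [hsum]
  have hG : ‖k‖ * ‖green l k R R'‖ * (‖k‖ * max R R') ^ l =
      ‖(k * (min R R' : ℝ)) * sphericalBessel l (k * (min R R' : ℝ))‖ *
      (‖Complex.exp (Complex.I * (k * (max R R' : ℝ)))‖ * ‖hankelPoly l (k * (max R R' : ℝ))‖) := by
    have hkb : k * ((max R R' : ℝ) : ℂ) ≠ 0 := mul_ne_zero hk (by exact_mod_cast hb.ne')
    have h0 : -Complex.I * k * (R : ℂ) * (R' : ℂ) =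
        -Complex.I * k * ((min R R' : ℝ) * (max R R' : ℝ) : ℂ) := by
      rw [← Complex.ofReal_mul, ← hRR]; push_cast; ring
    have hkbn : ‖k * ((max R R' : ℝ) : ℂ)‖ = ‖k‖ * max R R' := by
      rw [norm_mul, Complex.norm_real, Real.norm_of_nonneg hb.le]
    rw [green, if_neg hk, h0, sphericalHankel_eq l hkb, ← hkbn]
    simp only [norm_mul, norm_div, norm_pow, norm_neg, Complex.norm_I, one_pow, one_mul]
    rw [← norm_mul]
    have := norm_pos_iff.mpr hkb
    rw [norm_mul] at this ⊢
    field_simp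
    ring
  generalize min R R' = a at *
  generalize max R R' = b at *
  have hka : ‖k * (a : ℂ)‖ = ‖k‖ * a := by
    rw [norm_mul, Complex.norm_real, Real.norm_of_nonneg ha.le]
  have hkb : ‖k * (b : ℂ)‖ = ‖k‖ * b := by
    rw [norm_mul, Complex.norm_real, Real.norm_of_nonneg hb.le]
  have hia : |(k * (a : ℂ)).im| = |k.im| * a := by
    rw [Complex.im_mul_ofReal, abs_mul, abs_of_pos ha]
  have hib : |(k * (b : ℂ)).im| = |k.im| * b := by
    rw [Complex.im_mul_ofReal, abs_mul, abs_of_pos hb]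
  have hx : 0 ≤ ‖k‖ * a := by positivity
  have hxy : ‖k‖ * a ≤ ‖k‖ * b := by gcongr
  have hy : 0 < ‖k‖ * b := by positivity
  -- The power bound for j_l serves small arguments, the integration-by-parts bound serves large
  -- ones.
  have hB : ‖(k * (a : ℂ)) * sphericalBessel l (k * (a : ℂ))‖ ≤
      C₁ * min 1 ((‖k‖ * a) ^ (l + 1)) * Real.exp (|k.im| * a) := by
    rcases le_total 1 ((‖k‖ * a) ^ (l + 1)) with h | h
    · rw [min_eq_left h, mul_one, ← hia]
      exact h₁ _
    · rw [min_eq_right h, norm_mul, hka, pow_succ, ← hia]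
      have h4 := norm_sphericalBessel_le l (k * (a : ℂ))
      rw [hka] at h4
      calc ‖k‖ * a * ‖sphericalBessel l (k * (a : ℂ))‖
          ≤ ‖k‖ * a * ((‖k‖ * a) ^ l * Real.exp |(k * (a : ℂ)).im|) := by gcongr
        _ = 1 * ((‖k‖ * a) ^ l * (‖k‖ * a)) * Real.exp |(k * (a : ℂ)).im| := by ring
        _ ≤ _ := by gcongr
  have hE : ‖Complex.exp (Complex.I * (k * (b : ℂ)))‖ ≤ Real.exp (|k.im| * b) := by
    have h5 := norm_exp_I_mul_le (k * (b : ℂ)) (t := 1) (by simp)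
    rw [Complex.ofReal_one, mul_one, hib] at h5
    exact h5
  have hP := h₂ (k * (b : ℂ))
  rw [hkb] at hP
  have hmain : ‖k‖ * ‖green l k R R'‖ ≤
      C₁ * (C₂ * 2 ^ l) * min 1 (‖k‖ * a) * Real.exp (|k.im| * (a + b)) := by
    refine le_of_mul_le_mul_right ?_ (pow_pos hy l)
    rw [hG]
    calc _ ≤ (C₁ * min 1 ((‖k‖ * a) ^ (l + 1)) * Real.exp (|k.im| * a)) *
          (Real.exp (|k.im| * b) * (C₂ * (1 + ‖k‖ * b) ^ l)) := by gcongr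
      _ = C₁ * C₂ * Real.exp (|k.im| * (a + b)) *
          (min 1 ((‖k‖ * a) ^ (l + 1)) * (1 + ‖k‖ * b) ^ l) := by
          rw [mul_add, Real.exp_add]; ring
      _ ≤ C₁ * C₂ * Real.exp (|k.im| * (a + b)) *
          (2 ^ l * min 1 (‖k‖ * a) * (‖k‖ * b) ^ l) := by
          exact mul_le_mul_of_nonneg_left (min_mul_le hx hxy hy) (by positivity)
      _ = _ := by ring
  have hC0 : 0 ≤ C₁ * (C₂ * 2 ^ l) := zero_le_one.trans hC1
  constructor
  · refine le_of_mul_le_mul_left (hmain.trans ?_) hk0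
    calc _ ≤ C₁ * (C₂ * 2 ^ l) * (‖k‖ * a) * Real.exp (|k.im| * (a + b)) := by
          gcongr; exact min_le_right _ _
      _ = _ := by ring
  · refine hmain.trans ?_
    calc _ ≤ C₁ * (C₂ * 2 ^ l) * 1 * Real.exp (|k.im| * (a + b)) := by
          gcongr; exact min_le_left _ _
      _ = _ := by ring

end Bessel

/-! ### The scattering operators on the weighted space -/

section Scattering

open scoped ENNReal

/-- The integral `∫_0^∞ (1 + R) / w(R) dR`. -/
def weightIntegral (ε : ℝ) : ℝ≥0∞ := ∫⁻ R in Ioi (0 : ℝ), ENNReal.ofReal ((1 + R) / weight ε R)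

/-- The growth allowed for functions that pair with the weighted space. -/
def growth (α R : ℝ) : ℝ := √(1 + R) * Real.exp (α * R)

lemma growth_nonneg (α R : ℝ) : 0 ≤ growth α R := by unfold growth; positivity

lemma measurable_growth (α : ℝ) : Measurable (growth α) := by unfold growth; fun_prop

variable {ε α : ℝ}

/-- The quotient is R^{ε-1}(1+R)^{-2ε}: integrable at 0 because ε > 0, and at most R^{-1-ε} for R >
1. This is what the shape of w provides. -/
lemma weightIntegral_lt_top (hε : 0 < ε) : weightIntegral ε < ⊤ := by
  have h1 : ∀ R : ℝ, 0 < R → (1 + R) / weight ε R = R ^ (ε - 1) * (1 + R) ^ (-2 * ε) := by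
    intro R hR
    have hR' : 0 < 1 + R := by linarith
    rw [weight, show ε - 1 = -(1 - ε) by ring, Real.rpow_neg hR.le,
      show -2 * ε = 1 - (1 + 2 * ε) by ring, Real.rpow_sub hR', Real.rpow_one]
    field_simp
  have i1 : IntegrableOn (fun R : ℝ => R ^ (ε - 1)) (Ioc 0 1) := by
    rw [← intervalIntegrable_iff_integrableOn_Ioc_of_le zero_le_one]
    exact intervalIntegral.intervalIntegrable_rpow' (by linarith)
  have i2 : IntegrableOn (fun R : ℝ => R ^ (-1 - ε)) (Ioi 1) :=
    integrableOn_Ioi_rpow_of_lt (by linarith) one_pos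
  rw [weightIntegral, ← Ioc_union_Ioi_eq_Ioi (zero_le_one' ℝ),
    lintegral_union measurableSet_Ioi (Ioc_disjoint_Ioi le_rfl)]
  refine ENNReal.add_lt_top.mpr ⟨?_, ?_⟩
  · refine lt_of_le_of_lt (setLIntegral_mono' measurableSet_Ioc fun R hR => ?_)
      i1.lintegral_lt_top
    rw [h1 R hR.1]
    refine ENNReal.ofReal_le_ofReal ?_
    refine mul_le_of_le_one_right (Real.rpow_nonneg hR.1.le _) ?_
    exact Real.rpow_le_one_of_one_le_of_nonpos (by linarith [hR.1]) (by linarith)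
  · refine lt_of_le_of_lt (setLIntegral_mono' measurableSet_Ioi fun R hR => ?_)
      i2.lintegral_lt_top
    have hR0 : 0 < R := lt_trans one_pos hR
    rw [h1 R hR0]
    refine ENNReal.ofReal_le_ofReal ?_
    rw [show -1 - ε = (ε - 1) + (-2 * ε) by ring, Real.rpow_add hR0]
    exact mul_le_mul_of_nonneg_left ((Real.rpow_le_rpow_iff_of_neg (by linarith) hR0
      (by linarith)).mpr (by linarith)) (Real.rpow_nonneg hR0.le _)

/-- The growth function is calibrated so that its square divided by the density is exactly
(1+R)/w(R). -/
lemma lintegral_div_density_le {c : ℝ} {u : ℝ → ℂ} (hu : ∀ R, 0 < R → ‖u R‖ ≤ c * growth α R) :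
    ∫⁻ R, ‖u R / (density ε α R : ℂ)‖ₑ ^ 2 ∂weightedMeasure ε α ≤
      ENNReal.ofReal (c ^ 2) * weightIntegral ε := by
  rw [lintegral_weightedMeasure, weightIntegral, ← lintegral_const_mul' _ _ ENNReal.ofReal_ne_top]
  refine setLIntegral_mono' measurableSet_Ioi fun R (hR : 0 < R) => ?_
  have hd := density_pos ε α hR
  have hw := weight_pos ε hR
  rw [← ofReal_norm, ← ENNReal.ofReal_pow (norm_nonneg _), ← ENNReal.ofReal_mul hd.le,
    ← ENNReal.ofReal_mul (sq_nonneg c), norm_div, Complex.norm_real, Real.norm_of_nonneg hd.le]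
  refine ENNReal.ofReal_le_ofReal ?_
  have h1 : ‖u R‖ ^ 2 ≤ (c * growth α R) ^ 2 := by
    gcongr
    exact hu R hR
  have h2 : growth α R ^ 2 * weight ε R = (1 + R) * density ε α R := by
    rw [growth, density, mul_pow, Real.sq_sqrt (by linarith), ← Real.exp_nat_mul]
    push_cast
    rw [← mul_assoc 2 α R]
    ring
  calc density ε α R * (‖u R‖ / density ε α R) ^ 2 = ‖u R‖ ^ 2 / density ε α R := by field_simp
    _ ≤ (c * growth α R) ^ 2 / density ε α R := by gcongr
    _ = c ^ 2 * (growth α R ^ 2 * weight ε R) / (density ε α R * weight ε R) := by field_simp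
    _ = _ := by rw [h2]; field_simp

lemma memLp_div_density (hε : 0 < ε) {c : ℝ} {u : ℝ → ℂ} (hm : Measurable u)
    (hu : ∀ R, 0 < R → ‖u R‖ ≤ c * growth α R) :
    MemLp (fun R => u R / (density ε α R : ℂ)) 2 (weightedMeasure ε α) := by
  refine memLp_two_of_lintegral_lt_top ?_ ((lintegral_div_density_le hu).trans_lt
    (ENNReal.mul_lt_top ENNReal.ofReal_lt_top (weightIntegral_lt_top hε)))
  exact (hm.div (Complex.measurable_ofReal.comp (measurable_density ε α))).aestronglyMeasurable

lemma hsSq_div_density_le {A : ℝ} {G : ℝ → ℝ → ℂ}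
    (hG : ∀ R R', 0 < R → 0 < R' → ‖G R R'‖ ≤ A * (growth α R * growth α R')) :
    hsSq (weightedMeasure ε α)
      (fun R R' => G R R' / ((density ε α R : ℂ) * (density ε α R' : ℂ))) ≤
        ENNReal.ofReal (A ^ 2) * weightIntegral ε * weightIntegral ε := by
  have h1 : ∀ᵐ R ∂weightedMeasure ε α,
      ∫⁻ R', ‖G R R' / ((density ε α R : ℂ) * (density ε α R' : ℂ))‖ₑ ^ 2 ∂weightedMeasure ε α ≤
        ‖((A * growth α R : ℝ) : ℂ) / (density ε α R : ℂ)‖ₑ ^ 2 * weightIntegral ε := by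
    filter_upwards [ae_weightedMeasure_pos ε α] with R hR
    have hd := density_pos ε α hR
    have h2 : ∀ R', 0 < R' → ‖G R R' / (density ε α R : ℂ)‖ ≤
        (A * growth α R / density ε α R) * growth α R' := by
      intro R' hR'
      rw [norm_div, Complex.norm_real, Real.norm_of_nonneg hd.le, div_mul_eq_mul_div, mul_assoc]
      gcongr
      exact hG R R' hR hR'
    simp only [div_mul_eq_div_div]
    refine (lintegral_div_density_le h2).trans (le_of_eq ?_)
    rw [← Complex.ofReal_div, ← ofReal_norm, Complex.norm_real, ← ENNReal.ofReal_pow (norm_nonneg _),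
      Real.norm_eq_abs, sq_abs]
  refine (lintegral_mono_ae h1).trans ?_
  have hm : Measurable fun R => ‖((A * growth α R : ℝ) : ℂ) / (density ε α R : ℂ)‖ₑ ^ 2 := by
    have := measurable_growth α
    have := measurable_density ε α
    fun_prop
  rw [lintegral_mul_const _ hm]
  gcongr
  have h3 : ∀ R, 0 < R → ‖((A * growth α R : ℝ) : ℂ)‖ ≤ |A| * growth α R := fun R _ => by
    rw [Complex.norm_real, norm_mul, Real.norm_of_nonneg (growth_nonneg α R), Real.norm_eq_abs]
  simpa using lintegral_div_density_le (ε := ε) h3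

/-- The kernel of the Green operator with respect to the weighted measure. -/
def greenKernel (ε α : ℝ) (l : ℕ) (k : ℂ) (R R' : ℝ) : ℂ :=
  green l k R R' / ((density ε α R : ℂ) * (density ε α R' : ℂ))

lemma exists_norm_green_le_growth (α : ℝ) (l : ℕ) : ∃ C, 0 ≤ C ∧
    ∀ k ∈ strip α, ∀ R R', 0 < R → 0 < R' → ‖green l k R R'‖ ≤ C / (1 + ‖k‖) * (growth α R * growth α R') := by
  obtain ⟨C, hC, h⟩ := exists_norm_green_le l
  refine ⟨2 * C, by linarith, fun k hk R R' hR hR' => ?_⟩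
  obtain ⟨h1, h2⟩ := h k hR hR'
  have hk' : |k.im| < α := hk
  have h3 : Real.exp (|k.im| * (R + R')) ≤ Real.exp (α * R) * Real.exp (α * R') := by
    rw [← Real.exp_add, ← mul_add]
    gcongr
  -- min(R,R') is at most the geometric mean, so the Green bound splits into a product of
  -- one-variable growths; adding the bounds for |G| and |k||G| then produces the factor 1+|k|.
  have h4 : min R R' ≤ √(1 + R) * √(1 + R') := by
    rw [← Real.sqrt_mul (by linarith)]
    refine Real.le_sqrt_of_sq_le ?_
    have := min_le_left R R'
    have := min_le_right R R'
    have := lt_min hR hR'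
    nlinarith
  have h5 : 1 ≤ √(1 + R) * √(1 + R') :=
    one_le_mul_of_one_le_of_one_le (Real.one_le_sqrt.mpr (by linarith))
      (Real.one_le_sqrt.mpr (by linarith))
  have h6 : ‖green l k R R'‖ ≤ C * (growth α R * growth α R') := by
    calc _ ≤ C * min R R' * Real.exp (|k.im| * (R + R')) := h1
      _ ≤ C * (√(1 + R) * √(1 + R')) * (Real.exp (α * R) * Real.exp (α * R')) := by gcongr
      _ = _ := by unfold growth; ring
  have h7 : ‖k‖ * ‖green l k R R'‖ ≤ C * (growth α R * growth α R') := by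
    calc _ ≤ C * 1 * Real.exp (|k.im| * (R + R')) := by rw [mul_one]; exact h2
      _ ≤ C * (√(1 + R) * √(1 + R')) * (Real.exp (α * R) * Real.exp (α * R')) := by gcongr
      _ = _ := by unfold growth; ring
  have hk1 : 0 < 1 + ‖k‖ := by positivity
  rw [div_mul_eq_mul_div, le_div_iff₀ hk1]
  linarith

lemma isL2Kernel_of_growth (hε : 0 < ε) {A : ℝ} {G : ℝ → ℝ → ℂ}
    (hm : Measurable fun p : ℝ × ℝ => G p.1 p.2)
    (hG : ∀ R R', 0 < R → 0 < R' → ‖G R R'‖ ≤ A * (growth α R * growth α R')) :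
    IsL2Kernel (weightedMeasure ε α)
      (fun R R' => G R R' / ((density ε α R : ℂ) * (density ε α R' : ℂ))) := by
  refine ⟨?_, (hsSq_div_density_le hG).trans_lt ?_⟩
  · have := measurable_density ε α
    fun_prop
  · have := weightIntegral_lt_top hε
    exact ENNReal.mul_lt_top (ENNReal.mul_lt_top ENNReal.ofReal_lt_top this) this

lemma isL2Kernel_greenKernel (hε : 0 < ε) (l : ℕ) {k : ℂ} (hk : k ∈ strip α) :
    IsL2Kernel (weightedMeasure ε α) (greenKernel ε α l k) := by
  obtain ⟨C, -, h⟩ := exists_norm_green_le_growth α l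
  exact isL2Kernel_of_growth hε (measurable_green l k) (h k hk)

lemma dominatedConvergence_greenKernel (hε : 0 < ε) (l : ℕ) {k : ℕ → ℂ} {k₀ : ℂ}
    (hk : ∀ j, k j ∈ strip α) (hk₀ : k₀ ∈ strip α) (h : Tendsto k atTop (𝓝 k₀)) :
    ∃ B, DominatedConvergence (weightedMeasure ε α) (fun j => greenKernel ε α l (k j))
      (greenKernel ε α l k₀) B := by
  obtain ⟨C, hC0, hC⟩ := exists_norm_green_le_growth α l
  have hgm := measurable_growth α
  have hb : ∀ R R', ‖((C * (growth α R * growth α R') : ℝ) : ℂ)‖ = C * (growth α R * growth α R') := by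
    intro R R'
    rw [Complex.norm_real, Real.norm_of_nonneg]
    exact mul_nonneg hC0 (mul_nonneg (growth_nonneg _ _) (growth_nonneg _ _))
  refine ⟨fun R R' => ((C * (growth α R * growth α R') : ℝ) : ℂ) /
    ((density ε α R : ℂ) * (density ε α R' : ℂ)), fun j => isL2Kernel_greenKernel hε l (hk j),
    isL2Kernel_greenKernel hε l hk₀, isL2Kernel_of_growth hε ?_ fun R R' _ _ => (hb R R').le, ?_⟩
  · fun_prop
  · have h1 := Measure.quasiMeasurePreserving_fst (μ := weightedMeasure ε α)
      (ν := weightedMeasure ε α) |>.ae (ae_weightedMeasure_pos ε α)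
    have h2 := Measure.quasiMeasurePreserving_snd (μ := weightedMeasure ε α)
      (ν := weightedMeasure ε α) |>.ae (ae_weightedMeasure_pos ε α)
    filter_upwards [h1, h2] with p hp1 hp2
    refine ⟨fun j => ?_, ?_⟩
    · rw [greenKernel, norm_div, norm_div, hb]
      gcongr
      refine (hC _ (hk j) _ _ hp1 hp2).trans ?_
      have := mul_nonneg (growth_nonneg α p.1) (growth_nonneg α p.2)
      gcongr
      exact div_le_self hC0 (by linarith [norm_nonneg (k j)])
    · exact (((continuous_green l hp1 p.2).tendsto k₀).comp h).div_const _

variable {V : ℝ → ℝ → ℝ → ℝ}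

/-- The kernel of `L_ℓ(k)` with respect to the weighted measure. -/
def scatteringKernel (ε α : ℝ) (V : ℝ → ℝ → ℝ → ℝ) (l : ℕ) (k : ℂ) : ℝ → ℝ → ℂ :=
  kernelComp (weightedMeasure ε α) (fun R R' => (partialPotential V l R R' : ℂ))
    (greenKernel ε α l k)

/-- The density of the measure cancels the density divided out of each kernel; traces, compositions
and pairings in X thereby become the unweighted integrals of the definitions. -/
lemma density_mul_mul_div (a b : ℂ) {R : ℝ} (hR : 0 < R) :
    (density ε α R : ℂ) * (a / (density ε α R : ℂ) * b) = a * b := by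
  have : (density ε α R : ℂ) ≠ 0 := by exact_mod_cast (density_pos ε α hR).ne'
  field_simp

lemma scatteringKernel_eq (l : ℕ) (k : ℂ) (R R' : ℝ) :
    scatteringKernel ε α V l k R R' = kernelL V l k R R' / (density ε α R' : ℂ) := by
  rw [scatteringKernel, kernelComp, integral_weightedMeasure, kernelL, ← integral_div]
  refine setIntegral_congr_fun measurableSet_Ioi fun r hr => ?_
  have h := density_mul_mul_div (ε := ε) (α := α) (green l k r R')
    ((partialPotential V l R r : ℂ) / (density ε α R' : ℂ)) hr
  rw [greenKernel, div_mul_eq_div_div]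
  linear_combination h

lemma iterKernel_scatteringKernel (l : ℕ) (k : ℂ) (n : ℕ) (R R' : ℝ) :
    iterKernel (weightedMeasure ε α) (scatteringKernel ε α V l k) n R R' =
      iteratedKernel (kernelL V l k) n R R' / (density ε α R' : ℂ) := by
  induction n generalizing R' with
  | zero => exact scatteringKernel_eq l k R R'
  | succ n ih =>
    rw [iterKernel, kernelComp, integral_weightedMeasure, iteratedKernel, ← integral_div]
    refine setIntegral_congr_fun measurableSet_Ioi fun r hr => ?_
    rw [ih, scatteringKernel_eq, density_mul_mul_div _ _ hr, mul_div_assoc]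

lemma powTrace_scatteringKernel (l : ℕ) (k : ℂ) :
    powTrace (weightedMeasure ε α) (scatteringKernel ε α V l k) =
      traceOfPower (kernelL V l k) := by
  ext n
  rw [powTrace, integral_weightedMeasure, traceOfPower]
  refine setIntegral_congr_fun measurableSet_Ioi fun r hr => ?_
  have h := density_mul_mul_div (ε := ε) (α := α) (iteratedKernel (kernelL V l k) (n - 1) r r) 1 hr
  rw [mul_one, mul_one] at h
  rw [iterKernel_scatteringKernel, h]

lemma sigma_eq (ε α : ℝ) (l : ℕ) (k g : ℂ) :
    sigma V l k g = fredholmDenominator (weightedMeasure ε α) (scatteringKernel ε α V l k) g := by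
  rw [fredholmDenominator, powTrace_scatteringKernel]
  rfl

lemma kernelApply_scatteringKernel (l : ℕ) (k : ℂ) (f : ℝ → ℂ) (R : ℝ) :
    kernelApply (weightedMeasure ε α) (scatteringKernel ε α V l k) f R =
      ∫ R' in Ioi (0 : ℝ), kernelL V l k R R' * f R' := by
  rw [kernelApply, integral_weightedMeasure]
  refine setIntegral_congr_fun measurableSet_Ioi fun r hr => ?_
  rw [scatteringKernel_eq, density_mul_mul_div _ _ hr]

/-- The Riccati–Bessel function `k R j_ℓ(kR)`. -/
def riccatiBessel (l : ℕ) (k : ℂ) (R : ℝ) : ℂ := k * (R : ℂ) * sphericalBessel l (k * (R : ℂ))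

lemma measurable_riccatiBessel (l : ℕ) (k : ℂ) : Measurable (riccatiBessel l k) := by
  have := continuous_sphericalBessel l
  unfold riccatiBessel
  fun_prop

lemma sourceTerm_eq (l : ℕ) (k : ℂ) (R : ℝ) :
    sourceTerm V l k R = kernelApply (weightedMeasure ε α)
      (fun R R' => (partialPotential V l R R' : ℂ))
      (fun R => riccatiBessel l k R / (density ε α R : ℂ)) R := by
  rw [kernelApply, integral_weightedMeasure, sourceTerm]
  refine setIntegral_congr_fun measurableSet_Ioi fun r hr => ?_
  have h := density_mul_mul_div (ε := ε) (α := α) (riccatiBessel l k r)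
    (partialPotential V l R r : ℂ) hr
  rw [riccatiBessel] at *
  linear_combination -h

/-- The extra factor k completes the Riccati–Bessel function, symmetrically with the source term;
the price is a separate argument at k = 0. -/
lemma mul_amplitude (l : ℕ) (k g : ℂ) :
    k * amplitude ε α V l k g = -g * ∫ R, riccatiBessel l k R / (density ε α R : ℂ) *
      solution ε α V l k g R ∂weightedMeasure ε α := by
  rw [amplitude, integral_weightedMeasure, mul_left_comm, ← integral_const_mul]
  congr 1
  refine setIntegral_congr_fun measurableSet_Ioi fun r hr => ?_
  rw [density_mul_mul_div _ _ hr, riccatiBessel]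
  ring

end Scattering

/-! ### Well-posedness and bounds on the amplitude -/

section Amplitude

open scoped ENNReal

lemma norm_toLp_two_sq {X : Type*} [MeasurableSpace X] {μ : Measure X} {f : X → ℂ}
    (hf : MemLp f 2 μ) : ‖hf.toLp f‖ ^ 2 = (∫⁻ x, ‖f x‖ₑ ^ 2 ∂μ).toReal := by
  rw [norm_Lp_two_sq]
  congr 1
  refine lintegral_congr_ae ?_
  filter_upwards [hf.coeFn_toLp] with x hx
  rw [hx]

lemma norm_integral_mul_le_norm_toLp {X : Type*} [MeasurableSpace X] {μ : Measure X} {f g : X → ℂ}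
    (hf : MemLp f 2 μ) (hg : MemLp g 2 μ) :
    ‖∫ x, f x * g x ∂μ‖ ≤ ‖hf.toLp f‖ * ‖hg.toLp g‖ := by
  refine (abs_le_of_sq_le_sq' ?_ (by positivity)).2
  have h := ENNReal.toReal_mono (ENNReal.mul_lt_top hf.lintegral_enorm_sq_lt_top
    hg.lintegral_enorm_sq_lt_top).ne (sq_enorm_integral_mul_le hf.1 hg.1)
  rw [mul_pow, norm_toLp_two_sq, norm_toLp_two_sq, ← ENNReal.toReal_mul]
  simpa using h

variable {ε α : ℝ} {V : ℝ → ℝ → ℝ → ℝ}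

lemma isL2Kernel_scatteringKernel (hε : 0 < ε) (hV : IsNonlocalPotential ε α V) (l : ℕ) {k : ℂ}
    (hk : k ∈ strip α) : IsL2Kernel (weightedMeasure ε α) (scatteringKernel ε α V l k) :=
  (hV.isL2Kernel l).comp (isL2Kernel_greenKernel hε l hk)

lemma exists_norm_riccatiBessel_le (α : ℝ) (l : ℕ) : ∃ C, 0 ≤ C ∧ ∀ k ∈ strip α, ∀ R, 0 < R →
    ‖riccatiBessel l k R‖ ≤ C * growth α R := by
  obtain ⟨C, hC, h⟩ := exists_norm_mul_sphericalBessel_le l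
  refine ⟨C, by linarith, fun k hk R hR => (h _).trans ?_⟩
  have hk' : |k.im| < α := hk
  have h1 : 1 ≤ √(1 + R) := Real.one_le_sqrt.mpr (by linarith)
  rw [Complex.im_mul_ofReal, abs_mul, abs_of_pos hR, growth]
  calc C * Real.exp (|k.im| * R) ≤ C * (1 * Real.exp (α * R)) := by rw [one_mul]; gcongr
    _ ≤ _ := by gcongr

/-- Half of the exponential weight controls e^{|Im k|R}. The other half absorbs R^{l+1} through
xⁿ/n! ≤ e^x at x = αR/2, whence the constant. -/
lemma exists_norm_riccatiBessel_le_pow (hα : 0 < α) (l : ℕ) : ∃ C, 0 ≤ C ∧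
    ∀ k : ℂ, |k.im| ≤ α / 2 → ∀ R, 0 < R →
      ‖riccatiBessel l k R‖ ≤ C * ‖k‖ ^ (l + 1) * growth α R := by
  refine ⟨(2 / α) ^ (l + 1) * (l + 1).factorial, by positivity, fun k hk R hR => ?_⟩
  have hz : ‖k * (R : ℂ)‖ = ‖k‖ * R := by
    rw [norm_mul, Complex.norm_real, Real.norm_of_nonneg hR.le]
  have h1 := norm_sphericalBessel_le l (k * (R : ℂ))
  rw [Complex.im_mul_ofReal, abs_mul, abs_of_pos hR, hz] at h1
  have h2 : R ^ (l + 1) ≤ (2 / α) ^ (l + 1) * (l + 1).factorial * Real.exp (α / 2 * R) := by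
    have h3 := Real.pow_div_factorial_le_exp (α / 2 * R) (by positivity) (l + 1)
    rw [div_le_iff₀ (by positivity)] at h3
    calc R ^ (l + 1) = (2 / α) ^ (l + 1) * (α / 2 * R) ^ (l + 1) := by
          rw [← mul_pow]; congr 1; field_simp
      _ ≤ (2 / α) ^ (l + 1) * (Real.exp (α / 2 * R) * (l + 1).factorial) := by gcongr
      _ = _ := by ring
  have h4 : 1 ≤ √(1 + R) := Real.one_le_sqrt.mpr (by linarith)
  rw [riccatiBessel, norm_mul, hz]
  calc ‖k‖ * R * ‖sphericalBessel l (k * (R : ℂ))‖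
      ≤ ‖k‖ * R * ((‖k‖ * R) ^ l * Real.exp (|k.im| * R)) := by gcongr
    _ = ‖k‖ ^ (l + 1) * R ^ (l + 1) * Real.exp (|k.im| * R) := by ring
    _ ≤ ‖k‖ ^ (l + 1) * ((2 / α) ^ (l + 1) * (l + 1).factorial * Real.exp (α / 2 * R)) *
        Real.exp (α / 2 * R) := by gcongr
    _ = (2 / α) ^ (l + 1) * (l + 1).factorial * ‖k‖ ^ (l + 1) * (1 * Real.exp (α * R)) := by
        rw [show α * R = α / 2 * R + α / 2 * R by ring, Real.exp_add]; ring
    _ ≤ _ := by unfold growth; gcongr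

lemma memLp_riccatiBessel (hε : 0 < ε) (l : ℕ) {k : ℂ} (hk : k ∈ strip α) :
    MemLp (fun R => riccatiBessel l k R / (density ε α R : ℂ)) 2 (weightedMeasure ε α) := by
  obtain ⟨C, -, h⟩ := exists_norm_riccatiBessel_le α l
  exact memLp_div_density hε (measurable_riccatiBessel l k) (h k hk)

/-- The density is positive on (0,∞), so both measures have the same null sets and the pointwise
equation becomes an equation in L². -/
lemma isSolution_iff (hε : 0 < ε) (hV : IsNonlocalPotential ε α V) (l : ℕ) {k : ℂ}
    (hk : k ∈ strip α) (g : ℂ) {v : ℝ → ℂ} (hv : MemLp v 2 (weightedMeasure ε α)) :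
    IsSolution ε α V l k g v ↔
      (1 - g • kernelOp (isL2Kernel_scatteringKernel hε hV l hk)) (hv.toLp v) =
        kernelOp (hV.isL2Kernel l) ((memLp_riccatiBessel hε l hk).toLp _) := by
  set T := kernelOp (isL2Kernel_scatteringKernel hε hV l hk)
  set f := hv.toLp v
  rw [Lp.ext_iff]
  have h1 : (1 - g • T) f = f - g • T f := rfl
  have h2 : ∀ᵐ R ∂weightedMeasure ε α, ((1 - g • T) f) R =
      v R - g * ∫ R' in Ioi (0 : ℝ), kernelL V l k R R' * v R' := by
    rw [h1]
    filter_upwards [Lp.coeFn_sub f (g • T f), Lp.coeFn_smul g (T f),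
      coeFn_kernelOp (isL2Kernel_scatteringKernel hε hV l hk) f, hv.coeFn_toLp] with R a b c d
    rw [a, Pi.sub_apply, b, Pi.smul_apply, c, d, kernelApply_congr hv.coeFn_toLp,
      kernelApply_scatteringKernel, smul_eq_mul]
  have h3 : ∀ᵐ R ∂weightedMeasure ε α, (kernelOp (hV.isL2Kernel l)
      ((memLp_riccatiBessel hε l hk).toLp _)) R = sourceTerm V l k R := by
    filter_upwards [coeFn_kernelOp (hV.isL2Kernel l) ((memLp_riccatiBessel hε l hk).toLp _)] with R a
    rw [a, kernelApply_congr (memLp_riccatiBessel hε l hk).coeFn_toLp, ← sourceTerm_eq]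
  rw [IsSolution, ← ae_weightedMeasure_iff ε α]
  constructor
  · rintro ⟨-, h⟩
    filter_upwards [h, h2, h3] with R a b c
    rw [b, c, a]
  · intro h
    refine ⟨hv, ?_⟩
    filter_upwards [h, h2, h3] with R a b c
    rw [← b, ← c, a]

lemma isWellPosed_of_isUnit (hε : 0 < ε) (hV : IsNonlocalPotential ε α V) (l : ℕ) {k : ℂ}
    (hk : k ∈ strip α) {g : ℂ}
    (h : IsUnit (1 - g • kernelOp (isL2Kernel_scatteringKernel hε hV l hk))) :
    IsWellPosed ε α V l k g := by
  obtain ⟨u, hu⟩ := h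
  set b := kernelOp (hV.isL2Kernel l) ((memLp_riccatiBessel hε l hk).toLp _) with hb
  set f := (↑u⁻¹ : Lp ℂ 2 (weightedMeasure ε α) →L[ℂ] Lp ℂ 2 (weightedMeasure ε α)) b with hf
  have hinv : ∀ x : Lp ℂ 2 (weightedMeasure ε α),
      (↑u⁻¹ : Lp ℂ 2 (weightedMeasure ε α) →L[ℂ] Lp ℂ 2 (weightedMeasure ε α))
        ((u : Lp ℂ 2 (weightedMeasure ε α) →L[ℂ] Lp ℂ 2 (weightedMeasure ε α)) x) = x :=
    fun x => congrArg (fun A : Lp ℂ 2 (weightedMeasure ε α) →L[ℂ] Lp ℂ 2 (weightedMeasure ε α) =>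
      A x) u.inv_mul
  have hinv' : ∀ x : Lp ℂ 2 (weightedMeasure ε α),
      (u : Lp ℂ 2 (weightedMeasure ε α) →L[ℂ] Lp ℂ 2 (weightedMeasure ε α))
        ((↑u⁻¹ : Lp ℂ 2 (weightedMeasure ε α) →L[ℂ] Lp ℂ 2 (weightedMeasure ε α)) x) = x :=
    fun x => congrArg (fun A : Lp ℂ 2 (weightedMeasure ε α) →L[ℂ] Lp ℂ 2 (weightedMeasure ε α) =>
      A x) u.mul_inv
  refine ⟨f, ?_, fun v' hv' => ?_⟩
  · rw [isSolution_iff hε hV l hk g (Lp.memLp f), Lp.toLp_coeFn, ← hu]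
    exact hinv' b
  · have h1 := (isSolution_iff hε hV l hk g hv'.1).mp hv'
    rw [← hu, ← hb] at h1
    have h2 : hv'.1.toLp v' = f := by rw [hf, ← h1, hinv]
    have h3 := hv'.1.coeFn_toLp
    rw [h2] at h3
    exact (ae_weightedMeasure_iff ε α).mp h3.symm

lemma isSolution_solution {l : ℕ} {k g : ℂ} (h : IsWellPosed ε α V l k g) :
    IsSolution ε α V l k g (solution ε α V l k g) := by
  obtain ⟨v, hv, -⟩ := h
  exact Classical.epsilon_spec ⟨v, hv⟩

/-- The Riccati–Bessel function occurs in the source and again in the final pairing, hence c². The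
other factors of D are |g|, ‖V_ℓ‖ and ∫(1+R)/w. -/
lemma exists_mul_norm_amplitude_le (hε : 0 < ε) (hV : IsNonlocalPotential ε α V) (l : ℕ) (g : ℂ) :
    ∃ D, 0 ≤ D ∧ ∀ (k : ℂ) (hk : k ∈ strip α) (N c : ℝ), 0 ≤ N → 0 ≤ c →
      IsWellPosed ε α V l k g →
      (∀ f, ‖f‖ ≤ N * ‖(1 - g • kernelOp (isL2Kernel_scatteringKernel hε hV l hk)) f‖) →
      (∀ R, 0 < R → ‖riccatiBessel l k R‖ ≤ c * growth α R) →
      ‖k‖ * ‖amplitude ε α V l k g‖ ≤ D * N * c ^ 2 := by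
  refine ⟨‖g‖ * ‖kernelOp (hV.isL2Kernel l)‖ * (weightIntegral ε).toReal, by positivity,
    fun k hk N c hN hc hw hNf hcR => ?_⟩
  set u := (memLp_riccatiBessel hε l hk).toLp _ with hu_def
  have hu : ‖u‖ ^ 2 ≤ c ^ 2 * (weightIntegral ε).toReal := by
    rw [hu_def, norm_toLp_two_sq, ← ENNReal.toReal_ofReal (sq_nonneg c), ← ENNReal.toReal_mul]
    exact ENNReal.toReal_mono (ENNReal.mul_lt_top ENNReal.ofReal_lt_top
      (weightIntegral_lt_top hε)).ne (lintegral_div_density_le hcR)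
  have hs := isSolution_solution hw
  have h1 := (isSolution_iff hε hV l hk g hs.1).mp hs
  have h2 : ‖hs.1.toLp _‖ ≤ N * (‖kernelOp (hV.isL2Kernel l)‖ * ‖u‖) := by
    refine (hNf _).trans ?_
    rw [h1]
    gcongr
    exact ContinuousLinearMap.le_opNorm _ _
  have h3 := norm_integral_mul_le_norm_toLp (memLp_riccatiBessel hε l hk) hs.1
  rw [← norm_mul, mul_amplitude, norm_mul, norm_neg]
  calc _ ≤ ‖g‖ * (‖u‖ * (N * (‖kernelOp (hV.isL2Kernel l)‖ * ‖u‖))) := by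
        gcongr
        exact h3.trans (by gcongr)
    _ = ‖g‖ * ‖kernelOp (hV.isL2Kernel l)‖ * N * ‖u‖ ^ 2 := by ring
    _ ≤ ‖g‖ * ‖kernelOp (hV.isL2Kernel l)‖ * N * (c ^ 2 * (weightIntegral ε).toReal) := by gcongr
    _ = _ := by ring

/-- At k = 0 the source vanishes, so uniqueness forces the solution to be zero almost everywhere. -/
lemma amplitude_zero {l : ℕ} {g : ℂ} (h : IsWellPosed ε α V l 0 g) : amplitude ε α V l 0 g = 0 := by
  have h0 : IsSolution ε α V l 0 g 0 := by
    refine ⟨MemLp.zero, Eventually.of_forall fun R => ?_⟩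
    simp [sourceTerm]
  obtain ⟨v, hv, hun⟩ := id h
  have h1 := (hun _ (isSolution_solution h)).trans (hun _ h0).symm
  rw [amplitude]
  have h2 : ∫ R in Ioi (0 : ℝ), (R : ℂ) * sphericalBessel l (0 * (R : ℂ)) *
      solution ε α V l 0 g R = ∫ R in Ioi (0 : ℝ), (0 : ℂ) := by
    refine integral_congr_ae ?_
    filter_upwards [h1] with R hR
    rw [hR, Pi.zero_apply, mul_zero]
  rw [h2, integral_zero, mul_zero]

lemma exists_hsSq_scatteringKernel_le (hε : 0 < ε) (hV : IsNonlocalPotential ε α V) (l : ℕ) :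
    ∃ H, 0 ≤ H ∧ ∀ k ∈ strip α,
      (hsSq (weightedMeasure ε α) (scatteringKernel ε α V l k)).toReal ≤ H / (1 + ‖k‖) ^ 2 := by
  obtain ⟨C, hC0, hC⟩ := exists_norm_green_le_growth α l
  have hJ := weightIntegral_lt_top hε
  have hVt := (hV.isL2Kernel l).lt_top
  refine ⟨(hsSq (weightedMeasure ε α) fun R R' => (partialPotential V l R R' : ℂ)).toReal *
    (C ^ 2 * (weightIntegral ε).toReal * (weightIntegral ε).toReal), by positivity,
    fun k hk => ?_⟩
  have h1 := (hsSq_kernelComp_le (hV.isL2Kernel l) (isL2Kernel_greenKernel hε l hk)).trans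
    (mul_le_mul_right (hsSq_div_density_le (hC k hk)) _)
  refine (ENNReal.toReal_mono (ENNReal.mul_lt_top hVt (ENNReal.mul_lt_top
    (ENNReal.mul_lt_top ENNReal.ofReal_lt_top hJ) hJ)).ne h1).trans (le_of_eq ?_)
  rw [ENNReal.toReal_mul, ENNReal.toReal_mul, ENNReal.toReal_mul,
    ENNReal.toReal_ofReal (sq_nonneg _), div_pow]
  ring

lemma norm_le_two_mul_of_norm_le {E : Type*} [NormedAddCommGroup E] [NormedSpace ℂ E]
    {T : E →L[ℂ] E} (h : ‖T‖ ≤ 1 / 2) (f : E) : ‖f‖ ≤ 2 * ‖(1 - T) f‖ := by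
  have h1 : ‖f‖ ≤ ‖f - T f‖ + ‖T f‖ := norm_le_norm_sub_add f (T f)
  have h2 : ‖T f‖ ≤ 1 / 2 * ‖f‖ := T.le_of_opNorm_le h f
  have h3 : (1 - T) f = f - T f := rfl
  rw [h3]
  linarith

end Amplitude

/-! ### Behaviour at infinity in the strip -/

section Infinity

variable {ε α : ℝ} {V : ℝ → ℝ → ℝ → ℝ}

lemma eventually_atInftyInStrip (α M : ℝ) : ∀ᶠ k in atInftyInStrip α, k ∈ strip α ∧ M ≤ ‖k‖ := by
  refine eventually_inf_principal.mpr ?_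
  filter_upwards [tendsto_norm_cobounded_atTop.eventually_ge_atTop M] with k hk hs
  exact ⟨hs, hk⟩

lemma exists_bound_atInfty (hε : 0 < ε) (hV : IsNonlocalPotential ε α V) (l : ℕ) (g : ℂ) :
    ∃ M D : ℝ, ∀ k ∈ strip α, M ≤ ‖k‖ → (sigma V l k g ≠ 0 ∧ IsWellPosed ε α V l k g) ∧
      ‖k‖ * ‖amplitude ε α V l k g‖ ≤ D := by
  obtain ⟨H, hH0, hH⟩ := exists_hsSq_scatteringKernel_le hε hV l
  obtain ⟨D, -, hD⟩ := exists_mul_norm_amplitude_le hε hV l g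
  obtain ⟨C, hC0, hC⟩ := exists_norm_riccatiBessel_le α l
  -- Since (1+|k|)² ≥ |k|, this threshold makes |g|² times the squared Hilbert–Schmidt norm at most
  -- 1/16: enough for σ ≠ 0, and for ‖gL‖ ≤ 1/2, so that the inverse has norm at most 2.
  refine ⟨16 * (‖g‖ ^ 2 * H), D * 2 * C ^ 2, fun k hk hM => ?_⟩
  set K := isL2Kernel_scatteringKernel hε hV l hk
  have h1 : ‖g‖ ^ 2 * (hsSq (weightedMeasure ε α) (scatteringKernel ε α V l k)).toReal ≤
      1 / 16 := by
    refine (mul_le_mul_of_nonneg_left (hH k hk) (by positivity)).trans ?_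
    rw [mul_div_assoc', div_le_iff₀ (by positivity)]
    nlinarith [norm_nonneg k]
  have h2 := fredholmDenominator_ne_zero K h1
  have h3 := isWellPosed_of_isUnit hε hV l hk (K.isUnit_one_sub h2)
  refine ⟨⟨by rwa [sigma_eq ε α], h3⟩, hD k hk 2 C zero_le_two hC0 h3 ?_ (hC k hk)⟩
  refine fun f => norm_le_two_mul_of_norm_le ?_ f
  rw [norm_smul]
  refine (mul_le_mul_of_nonneg_left (norm_kernelOp_le K) (norm_nonneg g)).trans ?_
  refine (abs_le_of_sq_le_sq' ?_ (by norm_num)).2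
  rw [mul_pow, Real.sq_sqrt ENNReal.toReal_nonneg]
  linarith

lemma eventually_isWellPosed_atInfty (hε : 0 < ε) (hV : IsNonlocalPotential ε α V) (l : ℕ) (g : ℂ) :
    ∀ᶠ k in atInftyInStrip α, sigma V l k g ≠ 0 ∧ IsWellPosed ε α V l k g := by
  obtain ⟨M, D, h⟩ := exists_bound_atInfty hε hV l g
  filter_upwards [eventually_atInftyInStrip α M] with k hk
  exact (h k hk.1 hk.2).1

lemma amplitude_isBigO_atInfty (hε : 0 < ε) (hV : IsNonlocalPotential ε α V) (l : ℕ) (g : ℂ) :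
    (fun k : ℂ => amplitude ε α V l k g) =O[atInftyInStrip α] fun k : ℂ => 1 / k := by
  obtain ⟨M, D, h⟩ := exists_bound_atInfty hε hV l g
  refine IsBigO.of_bound D ?_
  filter_upwards [eventually_atInftyInStrip α (max M 1)] with k hk
  have h1 := (h k hk.1 ((le_max_left _ _).trans hk.2)).2
  have h2 : 0 < ‖k‖ := zero_lt_one.trans_le ((le_max_right _ _).trans hk.2)
  rw [norm_div, norm_one, mul_one_div, le_div_iff₀ h2, mul_comm]
  exact h1

lemma tendsto_scatteringFn_atInfty (hε : 0 < ε) (hV : IsNonlocalPotential ε α V) (l : ℕ) (g : ℂ) :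
    Tendsto (fun k => scatteringFn ε α V l k g) (atInftyInStrip α) (𝓝 1) := by
  have h1 : Tendsto (fun k : ℂ => 1 / k) (atInftyInStrip α) (𝓝 0) := by
    simp only [one_div]
    exact tendsto_inv₀_cobounded.mono_left inf_le_left
  have h2 := (amplitude_isBigO_atInfty hε hV l g).trans_tendsto h1
  simpa [scatteringFn] using (h2.const_mul (2 * Complex.I)).const_add 1

lemma exp_two_I_mul_log_div {s : ℂ} (hs : s ≠ 0) :
    Complex.exp (2 * Complex.I * (Complex.log s / (2 * Complex.I))) = s := by
  rw [mul_div_cancel₀ _ (by simp), Complex.exp_log hs]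

lemma mk_eq_of_exp_two_I_mul_eq {a b : ℂ}
    (h : Complex.exp (2 * Complex.I * a) = Complex.exp (2 * Complex.I * b)) :
    (QuotientAddGroup.mk a : ℂ ⧸ AddSubgroup.zmultiples (Real.pi : ℂ)) = QuotientAddGroup.mk b := by
  obtain ⟨n, hn⟩ := Complex.exp_eq_exp_iff_exists_int.mp h
  rw [QuotientAddGroup.eq, AddSubgroup.mem_zmultiples_iff]
  refine ⟨-n, ?_⟩
  have h2 : (2 * Complex.I) ≠ 0 := by simp
  have h3 : a = b + n * Real.pi := mul_left_cancel₀ h2 (by rw [hn]; ring)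
  rw [h3, zsmul_eq_mul]
  push_cast
  ring

/-- log S/(2i) is one phase shift and tends to 0, as S → 1 and the logarithm is continuous there.
Any other choice differs from it by a multiple of π. -/
lemma phaseShift_atInfty (hε : 0 < ε) (hV : IsNonlocalPotential ε α V) (l : ℕ) (g : ℂ) :
    (∀ᶠ k in atInftyInStrip α, ∃ d : ℂ, IsPhaseShift ε α V l k g d) ∧
      ∀ δ : ℂ → ℂ, (∀ᶠ k in atInftyInStrip α, IsPhaseShift ε α V l k g (δ k)) →
        Tendsto (fun k => (QuotientAddGroup.mk (δ k) :
          ℂ ⧸ AddSubgroup.zmultiples (Real.pi : ℂ))) (atInftyInStrip α) (𝓝 0) := by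
  have h1 := tendsto_scatteringFn_atInfty hε hV l g
  have h2 : ∀ᶠ k in atInftyInStrip α, scatteringFn ε α V l k g ≠ 0 :=
    h1.eventually_ne one_ne_zero
  refine ⟨?_, fun δ hδ => ?_⟩
  · filter_upwards [h2] with k hk
    exact ⟨_, (exp_two_I_mul_log_div hk).symm⟩
  · have h3 : Tendsto (fun k => Complex.log (scatteringFn ε α V l k g) / (2 * Complex.I))
        (atInftyInStrip α) (𝓝 0) := by
      have h4 := (h1.clog (by simp)).div_const (2 * Complex.I)
      simpa using h4
    have h5 := (QuotientAddGroup.continuous_mk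
      (N := AddSubgroup.zmultiples (Real.pi : ℂ))).tendsto 0 |>.comp h3
    refine Tendsto.congr' ?_ h5
    filter_upwards [h2, hδ] with k hk hd
    exact mk_eq_of_exp_two_I_mul_eq ((exp_two_I_mul_log_div hk).trans hd)

end Infinity

/-! ### Threshold behaviour -/

section Threshold

variable {ε α : ℝ} {V : ℝ → ℝ → ℝ → ℝ}

lemma dominatedConvergence_scatteringKernel (hε : 0 < ε) (hV : IsNonlocalPotential ε α V) (l : ℕ)
    {k : ℕ → ℂ} {k₀ : ℂ} (hk : ∀ j, k j ∈ strip α) (hk₀ : k₀ ∈ strip α)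
    (h : Tendsto k atTop (𝓝 k₀)) :
    ∃ B, DominatedConvergence (weightedMeasure ε α) (fun j => scatteringKernel ε α V l (k j))
      (scatteringKernel ε α V l k₀) B := by
  obtain ⟨B, hB⟩ := dominatedConvergence_greenKernel hε l hk hk₀ h
  have hK := hV.isL2Kernel l
  have hc : DominatedConvergence (weightedMeasure ε α)
      (fun _ => fun R R' => (partialPotential V l R R' : ℂ))
      (fun R R' => (partialPotential V l R R' : ℂ)) (fun R R' => (partialPotential V l R R' : ℂ)) :=
    ⟨fun _ => hK, hK, hK, Eventually.of_forall fun p => ⟨fun _ => le_rfl, tendsto_const_nhds⟩⟩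
  exact ⟨_, hc.comp hB⟩

lemma continuous_sigma (hε : 0 < ε) (hV : IsNonlocalPotential ε α V) (l : ℕ) (g : ℂ) :
    Continuous fun k : strip α => sigma V l k g := by
  -- The strip is first countable, so sequences suffice and the dominated convergence results apply.
  refine continuous_iff_continuousAt.mpr fun k₀ => tendsto_of_seq_tendsto fun k hk => ?_
  obtain ⟨B, hB⟩ := dominatedConvergence_scatteringKernel hε hV l (fun j => (k j).2) k₀.2
    ((continuous_subtype_val.tendsto k₀).comp hk)
  simp only [Function.comp_def, sigma_eq ε α]
  exact hB.tendsto_fredholmDenominator g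

lemma continuous_scatteringOp (hε : 0 < ε) (hV : IsNonlocalPotential ε α V) (l : ℕ) :
    Continuous fun k : strip α => kernelOp (isL2Kernel_scatteringKernel hε hV l k.2) := by
  refine continuous_iff_continuousAt.mpr fun k₀ => tendsto_of_seq_tendsto fun k hk => ?_
  obtain ⟨B, hB⟩ := dominatedConvergence_scatteringKernel hε hV l (fun j => (k j).2) k₀.2
    ((continuous_subtype_val.tendsto k₀).comp hk)
  exact hB.tendsto_kernelOp

lemma isOpen_strip (α : ℝ) : IsOpen (strip α) :=
  isOpen_lt (Complex.continuous_im.abs) continuous_const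

lemma eventually_nhds_of_strip {p : ℂ → Prop} {k₀ : ℂ} (hk₀ : k₀ ∈ strip α)
    (h : ∀ᶠ k : strip α in 𝓝 ⟨k₀, hk₀⟩, p k) : ∀ᶠ k in 𝓝 k₀, p k := by
  rw [← map_nhds_subtype_coe_eq_nhds hk₀ ((isOpen_strip α).mem_nhds hk₀)]
  exact h

/-- Continuity carries σ ≠ 0 from k = 0 to nearby k, and the inverse at k = 0 gives a uniform
estimate for the nearby inverses. The bound c = C|k|^{l+1} then enters squared. -/
lemma exists_bound_threshold (hε : 0 < ε) (hα : 0 < α) (hV : IsNonlocalPotential ε α V) (l : ℕ)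
    {g : ℂ} (hg : sigma V l 0 g ≠ 0) :
    ∃ M : ℝ, ∀ᶠ k in 𝓝 (0 : ℂ), (sigma V l k g ≠ 0 ∧ IsWellPosed ε α V l k g) ∧
      ‖k‖ * ‖amplitude ε α V l k g‖ ≤ M * (‖k‖ ^ (l + 1)) ^ 2 := by
  have h0 : (0 : ℂ) ∈ strip α := by simpa [strip] using hα
  obtain ⟨D, hD0, hD⟩ := exists_mul_norm_amplitude_le hε hV l g
  obtain ⟨C, hC0, hC⟩ := exists_norm_riccatiBessel_le_pow hα l
  set T : strip α → _ := fun k => kernelOp (isL2Kernel_scatteringKernel hε hV l k.2)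
  have hσ : ∀ᶠ k : strip α in 𝓝 ⟨0, h0⟩, sigma V l k g ≠ 0 :=
    ((continuous_sigma hε hV l g).tendsto ⟨0, h0⟩).eventually_ne hg
  obtain ⟨u, hu⟩ := (isL2Kernel_scatteringKernel hε hV l h0).isUnit_one_sub (g := g)
    (by rwa [← sigma_eq ε α])
  set S : Lp ℂ 2 (weightedMeasure ε α) →L[ℂ] Lp ℂ 2 (weightedMeasure ε α) := ↑u⁻¹
  have hST : S * (1 - g • T ⟨0, h0⟩) = 1 := by
    have h := u.inv_mul
    rwa [hu] at h
  have hlim : Tendsto (fun k => ‖S‖ * (‖g‖ * ‖T k - T ⟨0, h0⟩‖)) (𝓝 ⟨0, h0⟩) (𝓝 0) := by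
    have h1 := tendsto_iff_norm_sub_tendsto_zero.mp
      ((continuous_scatteringOp hε hV l).tendsto ⟨0, h0⟩)
    simpa using (h1.const_mul ‖g‖).const_mul ‖S‖
  have hN : ∀ᶠ k in 𝓝 (⟨0, h0⟩ : strip α), ∀ f, ‖f‖ ≤ 2 * ‖S‖ * ‖(1 - g • T k) f‖ := by
    filter_upwards [hlim.eventually_le_const (show (0 : ℝ) < 1 / 2 by norm_num)] with k hk f
    -- With S the inverse at k = 0, the second term is at most ‖f‖/2 for k near 0 and is absorbed
    -- into the left side; this gives the constant 2‖S‖.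
    have e1 : f = S ((1 - g • T k) f) + S (g • (T k - T ⟨0, h0⟩) f) := by
      calc f = (S * (1 - g • T ⟨0, h0⟩)) f := by rw [hST]; rfl
        _ = S ((1 - g • T ⟨0, h0⟩) f) := rfl
        _ = S ((1 - g • T k) f + g • (T k - T ⟨0, h0⟩) f) := by
            congr 1
            simp only [sub_apply, smul_apply, smul_sub]
            abel
        _ = _ := map_add _ _ _
    have e2 : ‖S (g • (T k - T ⟨0, h0⟩) f)‖ ≤ 1 / 2 * ‖f‖ := by
      calc _ ≤ ‖S‖ * (‖g‖ * (‖T k - T ⟨0, h0⟩‖ * ‖f‖)) := by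
            refine (S.le_opNorm _).trans ?_
            rw [norm_smul]
            gcongr
            exact ContinuousLinearMap.le_opNorm _ _
        _ = ‖S‖ * (‖g‖ * ‖T k - T ⟨0, h0⟩‖) * ‖f‖ := by ring
        _ ≤ _ := by gcongr
    have e3 := S.le_opNorm ((1 - g • T k) f)
    have e4 := norm_add_le (S ((1 - g • T k) f)) (S (g • (T k - T ⟨0, h0⟩) f))
    rw [← e1] at e4
    linarith
  have hsmall : ∀ᶠ k : strip α in 𝓝 ⟨0, h0⟩, |(k : ℂ).im| ≤ α / 2 := by
    have h1 : Continuous fun k : strip α => |(k : ℂ).im| := by fun_prop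
    exact (h1.tendsto ⟨0, h0⟩).eventually_le_const (by simpa using hα)
  refine ⟨D * (2 * ‖S‖) * C ^ 2, eventually_nhds_of_strip h0 ?_⟩
  filter_upwards [hσ, hN, hsmall] with k hk1 hk2 hk3
  have hw : IsWellPosed ε α V l k g := isWellPosed_of_isUnit hε hV l k.2
    ((isL2Kernel_scatteringKernel hε hV l k.2).isUnit_one_sub (by rwa [← sigma_eq ε α]))
  refine ⟨⟨hk1, hw⟩, (hD k k.2 (2 * ‖S‖) (C * ‖(k : ℂ)‖ ^ (l + 1)) (by positivity) (by positivity)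
    hw hk2 (hC k hk3)).trans (le_of_eq ?_)⟩
  ring

lemma exists_threshold_factor (hε : 0 < ε) (hα : 0 < α) (hV : IsNonlocalPotential ε α V) (l : ℕ)
    {g : ℂ} (hg : sigma V l 0 g ≠ 0) :
    ∃ U ∈ 𝓝 (0 : ℂ), ∃ (That : ℂ → ℂ) (M : ℝ), ∀ k ∈ U,
      amplitude ε α V l k g = k ^ (2 * l + 1) * That k ∧ ‖That k‖ ≤ M := by
  obtain ⟨M, hM⟩ := exists_bound_threshold hε hα hV l hg
  refine ⟨_, hM, fun k => amplitude ε α V l k g / k ^ (2 * l + 1), max M 0, fun k hk => ?_⟩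
  obtain ⟨⟨-, hw⟩, hk⟩ := hk
  -- At k = 0 the quotient is 0 by the convention x/0 = 0, consistent with the vanishing amplitude.
  -- Elsewhere one factor |k| is cancelled from |k|^{2l+2}.
  by_cases h0 : k = 0
  · subst h0
    rw [amplitude_zero hw]
    simp
  have hk0 : 0 < ‖k‖ := norm_pos_iff.mpr h0
  refine ⟨by field_simp, ?_⟩
  rw [norm_div, norm_pow, div_le_iff₀ (by positivity)]
  refine le_of_mul_le_mul_left (hk.trans ?_) hk0
  calc M * (‖k‖ ^ (l + 1)) ^ 2 ≤ max M 0 * (‖k‖ ^ (l + 1)) ^ 2 := by gcongr; exact le_max_left _ _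
    _ = _ := by ring

end Threshold

end NonlocalScattering

end

/-! ### Assembly of the three statements -/

open NonlocalScattering in
theorem mainTheorem11 (ε α : ℝ) (hε : 0 < ε) (hα : 0 < α) (V : ℝ → ℝ → ℝ → ℝ)
    (hV : IsNonlocalPotential ε α V) (l : ℕ) :
    -- behaviour at infinity in the strip
    (∀ g : ℝ,
      (∀ᶠ k in atInftyInStrip α, sigma V l k g ≠ 0 ∧ IsWellPosed ε α V l k g) ∧
      (fun k : ℂ => amplitude ε α V l k g) =O[atInftyInStrip α] fun k : ℂ => 1 / k) ∧
    -- threshold behaviour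
    (∀ g : ℂ, sigma V l 0 g ≠ 0 →
      (∀ᶠ k in 𝓝 (0 : ℂ), sigma V l k g ≠ 0 ∧ IsWellPosed ε α V l k g) ∧
      ∃ U ∈ 𝓝 (0 : ℂ), ∃ (That : ℂ → ℂ) (M : ℝ), ∀ k ∈ U,
        amplitude ε α V l k g = k ^ (2 * l + 1) * That k ∧ ‖That k‖ ≤ M) ∧
    -- phase shifts, which are defined modulo `π`
    (∀ g : ℝ,
      (∀ᶠ k in atInftyInStrip α, ∃ d : ℂ, IsPhaseShift ε α V l k g d) ∧
      ∀ δ : ℂ → ℂ, (∀ᶠ k in atInftyInStrip α, IsPhaseShift ε α V l k g (δ k)) →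
        Tendsto (fun k => (QuotientAddGroup.mk (δ k) :
          ℂ ⧸ AddSubgroup.zmultiples (Real.pi : ℂ))) (atInftyInStrip α) (𝓝 0)) := by
  refine ⟨fun g => ⟨eventually_isWellPosed_atInfty hε hV l g,
      amplitude_isBigO_atInfty hε hV l g⟩, fun g hg => ⟨?_, exists_threshold_factor hε hα hV l hg⟩,
    fun g => phaseShift_atInfty hε hV l g⟩
  obtain ⟨M, hM⟩ := exists_bound_threshold hε hα hV l hg
  exact hM.mono fun k hk => hk.1
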